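/- Write $\mathbb R^+=(0,\infty)$ and let $\pi(x,y)=x$. **Setting.** Let $f_0:(0,1)\to\mathbb R^+$ be $C^2$ with (A1) $\lim_{x\to0^+}f_0(x)=0$ and $\lim_{x\to1^-}f_0(x)=+\infty$; (A2) $f_0'>1$ on $(0,1)$; (A3) $\lim_{x\to0^+}f_0'(x)=1$; (A4) $f_0''>0$ on $(0,1)$; (A5) $f_0''/(f_0')^2$ is decreasing; (A6) $\sup_{(0,1)}f_0''/(f_0')^2<\infty$. Let $g_0:\mathbb R^+\to(0,1)$ be the inverse of $f_0$, and put $g_0(0)=0$. Assume (B) there are, for $i=1,2$, decreasing sequences $(\omega^{(i)}_n)_{n\ge1}$ in $(0,1)$ converging to $0$, constants $C_I^{(i)}>0$ and $\sigma_i\in(0,1)$ with $\sum_{n\ge1}[\omega_n^{(i)}]^{1-\sigma_i}<\infty$, $g_0'(n-1)\le C_I^{(1)}\omega_n^{(1)}$ for all integers $n\ge2$, and $\prod_{j=1}^{n-1}g_0'(g_0^j(1))\le C_I^{(2)}\omega_n^{(2)}$ for all integers $n\ge1$ (the empty product is $1$). Let $f(x)=f_0(x)$, $g_x(y)=g_0(y)$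 if $0<x<1$, and $f(x)=x-1$, $g_x(y)=y+1$ if $x>1$; let $\mathcal P(x,y)=(f(x),g_x(y))$ on $(\mathbb R^+\setminus\{1\})\times\mathbb R^+$ (the values on the Lebesgue-null line $x=1$ play no role). Assume (C) $m$ is a nonzero, possibly infinite measure on $\mathbb R^+\times\mathbb R^+$, absolutely continuous with respect to Lebesgue measure, $\mathcal P$-invariant and ergodic, with $m((a,b)\times\mathbb R^+)<\infty$ whenever $0<a<b<\infty$. **Induced maps.** Let $\tau$ be the first return time of $f$ to $(0,1)$ and $F=f^{\tau}$; let $\kappa$ be the first return time of $F$ to $(g_0(1),1)$ and $\widehat F=F^{\kappa}$. For integers $s\ge2$, $q\ge1$ let $J_s^q$ be the set of $x\in(g_0(s-1),g_0(s))$ with $F(x)\in(g_0^q(1),g_0^{q-1}(1))$. Put $\Delta=\bigcup_{s\ge2,\,q\ge1}J_s^q$ and $\widetilde\Delta=\bigcup_{s_0,s_1\ge2,\ q_0,q_1\ge1}J_{s_0}^{q_0}\cap\widehat F^{-1}(J_{s_1}^{q_1})$. Let $P(x,y)=\mathcal P^{\tau(x)}(x,y)$, $\widehat P(x,y)=P^{\kappa(x)}(x,y)$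 and $\widetilde P=\widehat P\circ\widehat P$ on $\widetilde\Delta\times\mathbb R^+$. Let $\widehat\mu=\frac{1}{\pi_*m(\Delta)}(\pi_*m)|_\Delta$. For an open set $U$ of $\mathbb R$ or $\mathbb R^2$, $C_b^1(U)$ is the set of bounded $C^1$ functions $u:U\to\mathbb R$ with $\sup_U\|Du\|<\infty$. **Proposition.** 1. There exists a probability measure $\nu$ on $\widetilde\Delta\times\mathbb R^+$ which is $\widetilde P$-invariant and ergodic and satisfies $\pi_*\nu=\widehat\mu$; it is the only $\widetilde P$-invariant probability measure on $\widetilde\Delta\times\mathbb R^+$ that projects to $\widehat\mu$ under $\pi$. 2. There is a family $\{\nu_x\}_{x\in\widetilde\Delta}$ of probability measures on $\widetilde\Delta\times\mathbb R^+$ such that, writing $\overline v(x)=\int v\,d\nu_x$ for $x\in\widetilde\Delta$: (i) $\nu_x(\{x\}\times\mathbb R^+)=1$ for every $x\in\widetilde\Delta$; (ii) $\overline v\in L^\infty_{\widehat\mu}(\widetilde\Delta)$ for every bounded uniformly continuous $v:\widetilde\Delta\times\mathbb R^+\to\mathbb R$; (iii) $\int v\,d\nu=\int_{\widetilde\Delta}\overline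 v\,d\widehat\mu$ for every such $v$; (iv) there exists $C_R>0$ such that for every $v\in C_b^1(\widetilde\Delta\times\mathbb R^+)$ with $Dv$ uniformly continuous, $\overline v\in C_b^1(\widetilde\Delta)$ and, for every $x\in\widetilde\Delta$, $$|D\overline v(x)|\le C_R\sup_{y\in\mathbb R^+}|v(x,y)|+C_R\sup_{y\in\mathbb R^+}\|Dv(x,y)\|.$$ -/

import Mathlib

open Set Filter Topology MeasureTheory

noncomputable section

namespace NonCompactMixing

/-- Assumptions (A1)-(A6) on the `C²` map `f₀ : (0,1) → ℝ⁺`. The values of `f₀` outside `(0,1)`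
are irrelevant: no definition below reads them. -/
structure AssumptionA (f₀ : ℝ → ℝ) : Prop where
  mapsTo : MapsTo f₀ (Ioo 0 1) (Ioi 0)
  contDiffOn : ContDiffOn ℝ 2 f₀ (Ioo 0 1)
  tendsto_zero : Tendsto f₀ (𝓝[>] 0) (𝓝 0)
  tendsto_one : Tendsto f₀ (𝓝[<] 1) atTop
  one_lt_deriv : ∀ x ∈ Ioo (0 : ℝ) 1, 1 < deriv f₀ x
  tendsto_deriv_zero : Tendsto (deriv f₀) (𝓝[>] 0) (𝓝 1)
  deriv2_pos : ∀ x ∈ Ioo (0 : ℝ) 1, 0 < deriv (deriv f₀) x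
  antitone_ratio : AntitoneOn (fun x => deriv (deriv f₀) x / (deriv f₀ x) ^ 2) (Ioo 0 1)
  adler : BddAbove ((fun x => deriv (deriv f₀) x / (deriv f₀ x) ^ 2) '' Ioo 0 1)

/-- The inverse `g₀ : ℝ⁺ → (0,1)` of `f₀`, continued by `g₀ = 0` on `(-∞, 0]`. -/
def g₀ (f₀ : ℝ → ℝ) (y : ℝ) : ℝ :=
  if 0 < y then Function.invFunOn f₀ (Ioo 0 1) y else 0

/-- A sequence `(ω n)`, `n ≥ 1`, in `(0,1)` that decreases to `0` and has
`∑_{n ≥ 1} (ω n) ^ (1 - σ) < ∞`. -/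
structure IsRate (ω : ℕ → ℝ) (σ : ℝ) : Prop where
  mem_Ioo : ∀ n, 1 ≤ n → ω n ∈ Ioo (0 : ℝ) 1
  antitone : AntitoneOn ω (Ici 1)
  tendsto : Tendsto ω atTop (𝓝 0)
  summable : Summable (fun n : ℕ => (ω (n + 1)) ^ (1 - σ))

/-- Assumption (B). The product in the last clause is empty, hence `1`, for `n = 1`. -/
def AssumptionB (f₀ : ℝ → ℝ) : Prop :=
  ∃ (ω₁ ω₂ : ℕ → ℝ) (C₁ C₂ σ₁ σ₂ : ℝ),
    0 < C₁ ∧ 0 < C₂ ∧ σ₁ ∈ Ioo (0 : ℝ) 1 ∧ σ₂ ∈ Ioo (0 : ℝ) 1 ∧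
    IsRate ω₁ σ₁ ∧ IsRate ω₂ σ₂ ∧
    (∀ n : ℕ, 2 ≤ n → deriv (g₀ f₀) ((n : ℝ) - 1) ≤ C₁ * ω₁ n) ∧
    (∀ n : ℕ, 1 ≤ n →
      ∏ j ∈ Finset.Ico 1 n, deriv (g₀ f₀) ((g₀ f₀)^[j] 1) ≤ C₂ * ω₂ n)

/-- The base map in the first coordinate: `f₀` on `(0,1)`, `x ↦ x - 1` on `(1,∞)`, `0` at `1`
(and `0` on the irrelevant set `(-∞, 0]`). -/
def f (f₀ : ℝ → ℝ) (x : ℝ) : ℝ :=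
  if x ∈ Ioo (0 : ℝ) 1 then f₀ x else if 1 < x then x - 1 else 0

/-- The fibre maps: `g₀` if `x < 1`, `y ↦ y + 1` if `x > 1`. At the single point `x = 1` the value
`+∞` is replaced by `0`; the line `x = 1` is null for every measure considered. -/
def g (f₀ : ℝ → ℝ) (x y : ℝ) : ℝ :=
  if x < 1 then g₀ f₀ y else if 1 < x then y + 1 else 0

/-- The base map `𝒫 (x, y) = (f x, g_x y)`. -/
def P₀ (f₀ : ℝ → ℝ) (z : ℝ × ℝ) : ℝ × ℝ := (f f₀ z.1, g f₀ z.1 z.2)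

/-- Assumption (C): `m` is a (nonzero, possibly infinite) measure on `ℝ⁺ × ℝ⁺`, absolutely
continuous, invariant and ergodic under `𝒫`, and finite on `(a, b) × ℝ⁺` for `0 < a < b`. -/
structure AssumptionC (f₀ : ℝ → ℝ) (m : Measure (ℝ × ℝ)) : Prop where
  ne_zero : m ≠ 0
  concentrated : m (Ioi 0 ×ˢ Ioi 0)ᶜ = 0
  absolutelyContinuous : m ≪ volume
  ergodic : Ergodic (P₀ f₀) m
  finite : ∀ a b : ℝ, 0 < a → a < b → m (Ioo a b ×ˢ Ioi 0) < ⊤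

/-- First return time of `x` to `A` under `T` (it is `0` if there is no return). -/
def returnTime (T : ℝ → ℝ) (A : Set ℝ) (x : ℝ) : ℕ := sInf {n : ℕ | 1 ≤ n ∧ T^[n] x ∈ A}

/-- First return time of `f` to `(0,1)`. -/
def τ (f₀ : ℝ → ℝ) (x : ℝ) : ℕ := returnTime (f f₀) (Ioo 0 1) x

/-- First induced map `F = f ^ τ`. -/
def F (f₀ : ℝ → ℝ) (x : ℝ) : ℝ := (f f₀)^[τ f₀ x] x

/-- First return time of `F` to `(g₀(1), 1)`. -/
def κ (f₀ : ℝ → ℝ) (x : ℝ) : ℕ := returnTime (F f₀) (Ioo (g₀ f₀ 1) 1) x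

/-- Second induced map `F̂ = F ^ κ`. -/
def Fhat (f₀ : ℝ → ℝ) (x : ℝ) : ℝ := (F f₀)^[κ f₀ x] x

/-- `I_s = (g₀(s-1), g₀(s))`. -/
def I (f₀ : ℝ → ℝ) (s : ℕ) : Set ℝ := Ioo (g₀ f₀ ((s : ℝ) - 1)) (g₀ f₀ (s : ℝ))

/-- `J_s^q`: the part of `I_s` that `F` maps into `(g₀^q(1), g₀^{q-1}(1))`. -/
def J (f₀ : ℝ → ℝ) (s q : ℕ) : Set ℝ :=
  {x | x ∈ I f₀ s ∧ F f₀ x ∈ Ioo ((g₀ f₀)^[q] 1) ((g₀ f₀)^[q - 1] 1)}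

/-- `Δ`, the union of the `J_s^q` over `s ≥ 2`, `q ≥ 1`. -/
def Δ (f₀ : ℝ → ℝ) : Set ℝ := {x | ∃ s q : ℕ, 2 ≤ s ∧ 1 ≤ q ∧ x ∈ J f₀ s q}

/-- `Δ̃`, the union of the sets `J_{s₀}^{q₀} ∩ F̂⁻¹(J_{s₁}^{q₁})` over `s₀, s₁ ≥ 2`,
`q₀, q₁ ≥ 1`. -/
def Δtilde (f₀ : ℝ → ℝ) : Set ℝ :=
  {x | ∃ s₀ s₁ q₀ q₁ : ℕ, 2 ≤ s₀ ∧ 2 ≤ s₁ ∧ 1 ≤ q₀ ∧ 1 ≤ q₁ ∧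
    x ∈ J f₀ s₀ q₀ ∩ Fhat f₀ ⁻¹' J f₀ s₁ q₁}

/-- `P = 𝒫 ^ τ`. -/
def P₁ (f₀ : ℝ → ℝ) (z : ℝ × ℝ) : ℝ × ℝ := (P₀ f₀)^[τ f₀ z.1] z

/-- `P̂ = P ^ κ`. -/
def Phat (f₀ : ℝ → ℝ) (z : ℝ × ℝ) : ℝ × ℝ := (P₁ f₀)^[κ f₀ z.1] z

/-- `P̃ = P̂ ∘ P̂`. -/
def Ptilde (f₀ : ℝ → ℝ) (z : ℝ × ℝ) : ℝ × ℝ := Phat f₀ (Phat f₀ z)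

/-- The phase space `Δ̃ × ℝ⁺`. -/
def Space (f₀ : ℝ → ℝ) : Set (ℝ × ℝ) := Δtilde f₀ ×ˢ Ioi 0

/-- `μ̂ = (π_* m)|_Δ / π_* m (Δ)`, where `π` is the projection to the first coordinate. -/
def muHat (f₀ : ℝ → ℝ) (m : Measure (ℝ × ℝ)) : Measure ℝ :=
  (m.map Prod.fst (Δ f₀))⁻¹ • (m.map Prod.fst).restrict (Δ f₀)

/-- `ν` is a probability measure on `Δ̃ × ℝ⁺` that is invariant under `P̃` and projects to `μ̂`. -/
structure IsInvariantLift (f₀ : ℝ → ℝ) (m : Measure (ℝ × ℝ)) (ν : Measure (ℝ × ℝ)) : Prop where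
  isProbability : IsProbabilityMeasure ν
  concentrated : ν (Space f₀)ᶜ = 0
  invariant : MeasurePreserving (Ptilde f₀) ν ν
  projects : ν.map Prod.fst = muHat f₀ m

/-- `u ∈ C_b¹(U)` for an open set `U`: `u` is `C¹`, bounded, and has bounded derivative on `U`. -/
structure IsCb1 {E : Type*} [NormedAddCommGroup E] [NormedSpace ℝ E] (U : Set E) (u : E → ℝ) :
    Prop where
  contDiffOn : ContDiffOn ℝ 1 u U
  bounded : ∃ C : ℝ, ∀ z ∈ U, |u z| ≤ C
  deriv_bounded : ∃ C : ℝ, ∀ z ∈ U, ‖fderiv ℝ u z‖ ≤ C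

/-- The fibre average `v̄(x) = ∫ v dν_x`. -/
def fibreAverage (νx : ℝ → Measure (ℝ × ℝ)) (v : ℝ × ℝ → ℝ) (x : ℝ) : ℝ := ∫ z, v z ∂(νx x)

/-- `(ν_x)`, `x ∈ Δ̃`, is a `C¹` disintegration of `ν` over `Δ̃` with respect to `μ̂`. -/
structure IsC1Disintegration (f₀ : ℝ → ℝ) (m : Measure (ℝ × ℝ)) (ν : Measure (ℝ × ℝ))
    (νx : ℝ → Measure (ℝ × ℝ)) : Prop where
  isProbability : ∀ x ∈ Δtilde f₀, IsProbabilityMeasure (νx x)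
  supported : ∀ x ∈ Δtilde f₀, νx x ({x} ×ˢ Ioi 0)ᶜ = 0
  memLp_top : ∀ v : ℝ × ℝ → ℝ, UniformContinuousOn v (Space f₀) →
    (∃ C : ℝ, ∀ z ∈ Space f₀, |v z| ≤ C) → MemLp (fibreAverage νx v) ⊤ (muHat f₀ m)
  integral_eq : ∀ v : ℝ × ℝ → ℝ, UniformContinuousOn v (Space f₀) →
    (∃ C : ℝ, ∀ z ∈ Space f₀, |v z| ≤ C) →
    ∫ z, v z ∂ν = ∫ x, fibreAverage νx v x ∂(muHat f₀ m)
  regular : ∃ C : ℝ, 0 < C ∧ ∀ v : ℝ × ℝ → ℝ, IsCb1 (Space f₀) v →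
    UniformContinuousOn (fderiv ℝ v) (Space f₀) →
    IsCb1 (Δtilde f₀) (fibreAverage νx v) ∧
    ∀ x ∈ Δtilde f₀, ‖fderiv ℝ (fibreAverage νx v) x‖ ≤
      C * (⨆ y : Ioi (0 : ℝ), |v (x, y)|) + C * (⨆ y : Ioi (0 : ℝ), ‖fderiv ℝ v (x, y)‖)

end NonCompactMixing

end

open Set Filter Topology MeasureTheory

noncomputable section

namespace NonCompactMixing

/-! ### First-return maps -/

/-! Up to a countable set, `Fhat` is a full-branch expanding map of `(g₀(1), 1)` with inverse
branches `phi c`, and `Phat` is the skew product `(phi c x, y) ↦ (x, psi c y)`, whose fibre map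
depends on the branch only. Assumption (B) makes the derivatives of the branches summable, and (A6)
bounds the nonlinearity of `g₀`.

Base. The transfer operator sends a cone of positive functions with bounded logarithmic derivative
strictly into itself. Cancelling a common constant from two images (`exists_coupling`) gives
exponential loss of memory in `C¹`. Hence there is a density `h` which generates, up to scaling, the
only finite absolutely continuous measure invariant under a power of `Fhat`
(`exists_invariantDensity`, `IsInvariantDensity.eq_withDensity`); so `muHat` has density `h`.

Existence. `Phat` is the first return map of `𝒫` to the strip over `(g₀(1), 1)`, which has positive
finite `m`-measure; the normalised restriction of `m` is therefore a lift.

Uniqueness. Long compositions of the maps `psi c` contract uniformly (`contracting_psi`). For any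
lift `ρ`, then, `∫ v dρ = ∫ v ∘ Phat^(2n) dρ` is close to `∫ v (Phat^(2n) (x, 1)) dμ̂(x)`, where `ρ`
no longer appears. By duality (`integral_iterate_skew`) this is the integral of `v` against laws of
random compositions of the `psi c`, the branches being drawn with weights `p · (h ∘ φ) / h`. Over
every `x` these laws converge to a limit `η_x` (`exists_limitLaw`), which gives both the formula for
`∫ v dρ` and the disintegration.

Regularity. Differentiating one step of the recursion for the laws costs `K` times the supremum and
multiplies the previous derivative by at most `lam < 1`. Derivatives thus stay below `K / (1 - lam)`
times the supremum, and the same estimate after `k` contractions makes them uniformly Cauchy.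

Ergodicity follows from uniqueness: the normalised restriction of `ν` to an invariant set of
positive measure projects to an absolutely continuous `Fhat²`-invariant probability, that is to
`muHat`, so it is a lift and equals `ν`. -/

lemma measurable_iterate_apply {α : Type*} [MeasurableSpace α] {T : α → α} (hT : Measurable T)
    {N : α → ℕ} (hN : Measurable N) : Measurable fun x => T^[N x] x := by
  intro B hB
  have : (fun x => T^[N x] x) ⁻¹' B = ⋃ n, N ⁻¹' {n} ∩ (T^[n]) ⁻¹' B := by
    ext x; simp
  rw [this]
  exact .iUnion fun n => (hN (measurableSet_singleton n)).inter (hT.iterate n hB)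

lemma measurable_returnTime {T : ℝ → ℝ} (hT : Measurable T) {A : Set ℝ} (hA : MeasurableSet A) :
    Measurable (returnTime T A) := by
  have hset : ∀ n, MeasurableSet {x | 1 ≤ n ∧ T^[n] x ∈ A} := fun n =>
    (MeasurableSet.const _).inter (hT.iterate n hA)
  refine measurable_to_countable' fun n => ?_
  have hle : ∀ k, 1 ≤ k → MeasurableSet {x | returnTime T A x = k} := by
    intro k hk
    have : {x | returnTime T A x = k} =
        {x | 1 ≤ k ∧ T^[k] x ∈ A} ∩ ⋂ j ∈ Finset.range k, {x | 1 ≤ j ∧ T^[j] x ∈ A}ᶜ := by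
      ext x
      simp only [returnTime, mem_ofPred_eq, mem_inter_iff, mem_iInter, Finset.mem_range, mem_compl_iff]
      constructor
      · intro h
        have hne : {n : ℕ | 1 ≤ n ∧ T^[n] x ∈ A}.Nonempty := by
          by_contra hcon
          rw [not_nonempty_iff_eq_empty] at hcon
          rw [hcon, Nat.sInf_empty] at h; omega
        refine ⟨h ▸ Nat.sInf_mem hne, fun j hj hj' => ?_⟩
        have := Nat.sInf_le (s := {n : ℕ | 1 ≤ n ∧ T^[n] x ∈ A}) hj'
        omega
      · rintro ⟨h1, h2⟩
        refine le_antisymm (Nat.sInf_le h1) (le_of_not_gt fun hlt => h2 _ hlt ?_)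
        exact Nat.sInf_mem (s := {n : ℕ | 1 ≤ n ∧ T^[n] x ∈ A}) ⟨k, h1⟩
    rw [this]
    exact (hset k).inter (.biInter (Finset.range k).countable_toSet fun j _ => (hset j).compl)
  rcases Nat.eq_zero_or_pos n with rfl | hn
  · have : returnTime T A ⁻¹' {0} = (⋃ k, {x | returnTime T A x = k + 1})ᶜ := by
      ext x
      simp only [mem_preimage, mem_singleton_iff, mem_compl_iff, mem_iUnion, mem_ofPred_eq,
        not_exists]
      constructor
      · intro h k; omega
      · intro h; by_contra h0; exact h (returnTime T A x - 1) (by omega)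
    rw [this]
    exact (MeasurableSet.iUnion fun k => hle _ (by omega)).compl
  · exact hle n hn

lemma returnTime_eq {T : ℝ → ℝ} {A : Set ℝ} {x : ℝ} {n : ℕ} (hn : 1 ≤ n) (hx : T^[n] x ∈ A)
    (hlt : ∀ j, 1 ≤ j → j < n → T^[j] x ∉ A) : returnTime T A x = n := by
  refine le_antisymm (Nat.sInf_le ⟨hn, hx⟩) (le_of_not_gt fun h => ?_)
  have := Nat.sInf_mem (s := {n : ℕ | 1 ≤ n ∧ T^[n] x ∈ A}) ⟨n, hn, hx⟩
  exact hlt _ this.1 h this.2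

/-- The first return map to a set of finite measure preserves the restricted measure. -/
lemma measurePreserving_firstReturn {α : Type*} [MeasurableSpace α] {μ : Measure α} {T R : α → α}
    (hT : MeasurePreserving T μ μ) (hR : Measurable R) {A : Set α} (hA : MeasurableSet A)
    (hfin : μ A ≠ ⊤) {N : α → ℕ} (hN : Measurable N)
    (h : ∀ᵐ x ∂μ.restrict A, 1 ≤ N x ∧ R x = T^[N x] x ∧ T^[N x] x ∈ A ∧
      ∀ j, 1 ≤ j → j < N x → T^[j] x ∉ A) :
    MeasurePreserving R (μ.restrict A) (μ.restrict A) := by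
  -- One inequality is enough: applied to the complement of `B`, with finite total mass, it yields
  -- the reverse one.
  have key : ∀ B, MeasurableSet B → (μ.restrict A) (R ⁻¹' B) ≤ (μ.restrict A) B := by
    intro B hB
    let Q : ℕ → Set α := fun k => {x | x ∈ A ∧ N x = k ∧ T^[k] x ∈ A ∩ B ∧
      ∀ j, 1 ≤ j → j < k → T^[j] x ∉ A}
    have hQm : ∀ k, MeasurableSet (Q k) := by
      intro k
      have : Q k = A ∩ (N ⁻¹' {k} ∩ (T^[k] ⁻¹' (A ∩ B) ∩
          ⋂ j, ⋂ (_ : 1 ≤ j), ⋂ (_ : j < k), (T^[j] ⁻¹' A)ᶜ)) := by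
        ext x; simp [Q]; tauto
      rw [this]
      refine hA.inter ((hN (measurableSet_singleton k)).inter
        ((hT.measurable.iterate k (hA.inter hB)).inter ?_))
      exact .iInter fun j => .iInter fun _ => .iInter fun _ => (hT.measurable.iterate j hA).compl
    have hfinite : ∀ n, ∑ k ∈ Finset.range n, μ (Q (k + 1)) ≤ μ (A ∩ B) := by
      intro n
      have h1 : ∀ k ∈ Finset.range n, μ (Q (k + 1)) = μ (T^[n - (k + 1)] ⁻¹' Q (k + 1)) := by
        intro k _
        exact ((hT.iterate _).measure_preimage (hQm _).nullMeasurableSet).symm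
      -- On the `k`-th set the orbit is in `A ∩ B` at time `n`, and `n - (k + 1)` is its last visit
      -- to `A` before `n`. The sets are therefore disjoint subsets of `T^[n] ⁻¹' (A ∩ B)`.
      rw [Finset.sum_congr rfl h1, ← measure_biUnion_finset]
      · rw [← (hT.iterate n).measure_preimage (hA.inter hB).nullMeasurableSet]
        refine measure_mono ?_
        intro x hx
        simp only [mem_iUnion, Finset.mem_range, mem_preimage] at hx
        obtain ⟨k, hk, hx⟩ := hx
        have := hx.2.2.1
        rw [← Function.iterate_add_apply] at this
        rwa [show k + 1 + (n - (k + 1)) = n by omega] at this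
      · have aux : ∀ k l, k < l → l < n →
            Disjoint (T^[n - (k + 1)] ⁻¹' Q (k + 1)) (T^[n - (l + 1)] ⁻¹' Q (l + 1)) := by
          intro k l hkl hl
          rw [Set.disjoint_left]
          intro x hx hx'
          have hx1 := hx'.2.2.2 (l - k) (by omega) (by omega)
          rw [← Function.iterate_add_apply,
            show l - k + (n - (l + 1)) = n - (k + 1) by omega] at hx1
          exact hx1 hx.1
        intro k hk l hl hkl
        simp only [Finset.coe_range, mem_Iio] at hk hl
        rcases lt_or_gt_of_ne hkl with h | h
        · exact aux k l h hl
        · exact (aux l k h hk).symm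
      · intro k _
        exact hT.measurable.iterate _ (hQm _)
    have hle : ∑' k, μ (Q (k + 1)) ≤ μ (A ∩ B) :=
      ENNReal.tsum_le_of_sum_range_le hfinite
    rw [Measure.restrict_apply hB, inter_comm B A, Measure.restrict_apply (hR hB)]
    refine le_trans ?_ hle
    refine le_trans ?_ (measure_iUnion_le _)
    rw [ae_restrict_iff' hA] at h
    refine measure_mono_ae ?_
    filter_upwards [h] with x hx hxA
    obtain ⟨h1, h2, h3, h4⟩ := hx hxA.2
    refine mem_iUnion.2 ⟨N x - 1, ?_⟩
    rw [Nat.sub_add_cancel h1]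
    refine ⟨hxA.2, rfl, ⟨h3, ?_⟩, h4⟩
    rw [← h2]; exact hxA.1
  have : IsFiniteMeasure (μ.restrict A) := ⟨by simpa using lt_top_iff_ne_top.2 hfin⟩
  refine ⟨hR, Measure.ext fun B hB => ?_⟩
  rw [Measure.map_apply hR hB]
  refine le_antisymm (key B hB) ?_
  have h1 := key Bᶜ hB.compl
  rw [preimage_compl, measure_compl (hR hB) (measure_ne_top _ _),
    measure_compl hB (measure_ne_top _ _)] at h1
  have h2 : (μ.restrict A) B ≤ (μ.restrict A) univ := measure_mono (subset_univ _)
  have h3 : (μ.restrict A) (R ⁻¹' B) ≤ (μ.restrict A) univ := measure_mono (subset_univ _)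
  exact (ENNReal.sub_le_sub_iff_left h2 (measure_ne_top _ _)).1 h1

/-! ### Weighted iterated function systems on an interval -/

/-- `u` is continuously differentiable on the open set `U`. -/
structure IsC1 (U : Set ℝ) (u : ℝ → ℝ) : Prop where
  diff : ∀ x ∈ U, DifferentiableAt ℝ u x
  cont : ContinuousOn (deriv u) U

lemma IsC1.continuousOn {U : Set ℝ} {u : ℝ → ℝ} (h : IsC1 U u) : ContinuousOn u U :=
  fun x hx => (h.diff x hx).continuousAt.continuousWithinAt

lemma IsC1.of_hasDerivAt {U : Set ℝ} {u u' : ℝ → ℝ} (h : ∀ x ∈ U, HasDerivAt u (u' x) x)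
    (h' : ContinuousOn u' U) : IsC1 U u :=
  ⟨fun x hx => (h x hx).differentiableAt, h'.congr fun x hx => (h x hx).deriv⟩

/-- Countably many `C¹` contractions `φ c` of the interval `(a, b)`, with `C¹` weights `w c` of
bounded logarithmic derivative. -/
structure WeightedIFS (ι : Type*) (a b : ℝ) where
  φ : ι → ℝ → ℝ
  p : ι → ℝ → ℝ
  w : ι → ℝ → ℝ
  w' : ι → ℝ → ℝ
  M : ι → ℝ
  K : ℝ
  lam : ℝ
  mapsTo : ∀ c, MapsTo (φ c) (Ioo a b) (Ioo a b)
  hasDerivAt_φ : ∀ c, ∀ x ∈ Ioo a b, HasDerivAt (φ c) (p c x) x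
  continuousOn_p : ∀ c, ContinuousOn (p c) (Ioo a b)
  p_pos : ∀ c, ∀ x ∈ Ioo a b, 0 < p c x
  p_le : ∀ c, ∀ x ∈ Ioo a b, p c x ≤ lam
  lam_pos : 0 < lam
  lam_lt_one : lam < 1
  hasDerivAt_w : ∀ c, ∀ x ∈ Ioo a b, HasDerivAt (w c) (w' c x) x
  continuousOn_w' : ∀ c, ContinuousOn (w' c) (Ioo a b)
  w_pos : ∀ c, ∀ x ∈ Ioo a b, 0 < w c x
  w_le : ∀ c, ∀ x ∈ Ioo a b, w c x ≤ M c
  summable_M : Summable M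
  K_nonneg : 0 ≤ K
  abs_w'_le : ∀ c, ∀ x ∈ Ioo a b, |w' c x| ≤ K * w c x

namespace WeightedIFS

variable {ι : Type*} {a b : ℝ} (S : WeightedIFS ι a b)

/-- The weighted sum `∑ w_c · (u_c ∘ φ_c)`. -/
def op (u : ι → ℝ → ℝ) (x : ℝ) : ℝ := ∑' c, S.w c x * u c (S.φ c x)

/-- The derivative of `∑ w_c · (u_c ∘ φ_c)`. -/
def dop (u : ι → ℝ → ℝ) (x : ℝ) : ℝ :=
  ∑' c, (S.w' c x * u c (S.φ c x) + S.w c x * (deriv (u c) (S.φ c x) * S.p c x))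

variable {S} {u : ι → ℝ → ℝ} {B B' : ℝ}

lemma abs_term_le (hu : ∀ c, ∀ x ∈ Ioo a b, |u c x| ≤ B) (c : ι) {x : ℝ} (hx : x ∈ Ioo a b) :
    |S.w c x * u c (S.φ c x)| ≤ S.w c x * B := by
  rw [abs_mul, abs_of_pos (S.w_pos c x hx)]
  exact mul_le_mul_of_nonneg_left (hu c _ (S.mapsTo c hx)) (S.w_pos c x hx).le

lemma summable_w {x : ℝ} (hx : x ∈ Ioo a b) : Summable fun c => S.w c x :=
  S.summable_M.of_nonneg_of_le (fun c => (S.w_pos c x hx).le) fun c => S.w_le c x hx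

lemma summable_op (hu : ∀ c, ∀ x ∈ Ioo a b, |u c x| ≤ B) {x : ℝ} (hx : x ∈ Ioo a b) :
    Summable fun c => S.w c x * u c (S.φ c x) :=
  Summable.of_norm_bounded ((summable_w hx).mul_right B) fun c => abs_term_le hu c hx

/-- Differentiating the weight costs `K`, differentiating through the branch costs `lam`. The weight
is kept as a factor, so that the bound can be summed again against the weights. -/
lemma abs_dterm_le (c : ι) {x : ℝ} (hx : x ∈ Ioo a b) :
    |S.w' c x * u c (S.φ c x) + S.w c x * (deriv (u c) (S.φ c x) * S.p c x)| ≤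
      S.w c x * (S.K * |u c (S.φ c x)| + S.lam * |deriv (u c) (S.φ c x)|) := by
  have hw := (S.w_pos c x hx).le
  have h1 : |S.w' c x * u c (S.φ c x)| ≤ S.K * S.w c x * |u c (S.φ c x)| := by
    rw [abs_mul]
    exact mul_le_mul_of_nonneg_right (S.abs_w'_le c x hx) (abs_nonneg _)
  have h2 : |S.w c x * (deriv (u c) (S.φ c x) * S.p c x)| ≤
      S.w c x * (|deriv (u c) (S.φ c x)| * S.lam) := by
    rw [abs_mul, abs_of_nonneg hw, abs_mul, abs_of_pos (S.p_pos c x hx)]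
    exact mul_le_mul_of_nonneg_left
      (mul_le_mul_of_nonneg_left (S.p_le c x hx) (abs_nonneg _)) hw
  calc _ ≤ _ := abs_add_le _ _
    _ ≤ _ := add_le_add h1 h2
    _ = _ := by ring

lemma abs_dterm_le_bound (hu : ∀ c, ∀ x ∈ Ioo a b, |u c x| ≤ B)
    (hd : ∀ c, ∀ x ∈ Ioo a b, |deriv (u c) x| ≤ B') (c : ι) {x : ℝ} (hx : x ∈ Ioo a b) :
    |S.w' c x * u c (S.φ c x) + S.w c x * (deriv (u c) (S.φ c x) * S.p c x)| ≤
      S.w c x * (S.K * B + S.lam * B') := by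
  refine (abs_dterm_le c hx).trans (mul_le_mul_of_nonneg_left ?_ (S.w_pos c x hx).le)
  exact add_le_add (mul_le_mul_of_nonneg_left (hu c _ (S.mapsTo c hx)) S.K_nonneg)
    (mul_le_mul_of_nonneg_left (hd c _ (S.mapsTo c hx)) S.lam_pos.le)

lemma summable_dop (hu : ∀ c, ∀ x ∈ Ioo a b, |u c x| ≤ B)
    (hd : ∀ c, ∀ x ∈ Ioo a b, |deriv (u c) x| ≤ B') {x : ℝ} (hx : x ∈ Ioo a b) :
    Summable fun c =>
      (S.w' c x * u c (S.φ c x) + S.w c x * (deriv (u c) (S.φ c x) * S.p c x)) :=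
  Summable.of_norm_bounded ((summable_w hx).mul_right _) fun c => abs_dterm_le_bound hu hd c hx

/-- Termwise differentiation: the derivatives of the summands are dominated by a multiple of the
summable `M`. -/
lemma hasDerivAt_op (hC : ∀ c, IsC1 (Ioo a b) (u c)) (hu : ∀ c, ∀ x ∈ Ioo a b, |u c x| ≤ B)
    (hd : ∀ c, ∀ x ∈ Ioo a b, |deriv (u c) x| ≤ B') {x : ℝ} (hx : x ∈ Ioo a b) :
    HasDerivAt (S.op u) (S.dop u x) x := by
  refine hasDerivAt_tsum_of_isPreconnected (t := Ioo a b) (y₀ := x)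
    (g := fun c x => S.w c x * u c (S.φ c x)) (g' := fun c x =>
      S.w' c x * u c (S.φ c x) + S.w c x * (deriv (u c) (S.φ c x) * S.p c x))
    (u := fun c => S.M c * (S.K * B + S.lam * B')) (S.summable_M.mul_right _) isOpen_Ioo
    isPreconnected_Ioo ?_ ?_ hx (summable_op hu hx) hx
  · intro c y hy
    exact (S.hasDerivAt_w c y hy).mul
      (((hC c).diff _ (S.mapsTo c hy)).hasDerivAt.comp y (S.hasDerivAt_φ c y hy))
  · intro c y hy
    refine (abs_dterm_le_bound hu hd c hy).trans (mul_le_mul_of_nonneg_right (S.w_le c y hy) ?_)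
    have h1 := (abs_nonneg _).trans (hu c y hy)
    have h2 := (abs_nonneg _).trans (hd c y hy)
    have := S.K_nonneg
    have := S.lam_pos
    positivity

lemma continuousOn_φ (c : ι) : ContinuousOn (S.φ c) (Ioo a b) := fun x hx =>
  (S.hasDerivAt_φ c x hx).continuousAt.continuousWithinAt

lemma continuousOn_w (c : ι) : ContinuousOn (S.w c) (Ioo a b) := fun x hx =>
  (S.hasDerivAt_w c x hx).continuousAt.continuousWithinAt

lemma isC1_op (hC : ∀ c, IsC1 (Ioo a b) (u c)) (hu : ∀ c, ∀ x ∈ Ioo a b, |u c x| ≤ B)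
    (hd : ∀ c, ∀ x ∈ Ioo a b, |deriv (u c) x| ≤ B') : IsC1 (Ioo a b) (S.op u) := by
  refine IsC1.of_hasDerivAt (fun x hx => hasDerivAt_op hC hu hd hx) ?_
  refine continuousOn_tsum (u := fun c => S.M c * (S.K * B + S.lam * B')) ?_
    (S.summable_M.mul_right _) ?_
  · intro c
    refine ((S.continuousOn_w' c).mul ((hC c).continuousOn.comp (continuousOn_φ c)
      (S.mapsTo c))).add ((continuousOn_w c).mul (((hC c).cont.comp (continuousOn_φ c)
      (S.mapsTo c)).mul (S.continuousOn_p c)))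
  · intro c y hy
    refine (abs_dterm_le_bound hu hd c hy).trans (mul_le_mul_of_nonneg_right (S.w_le c y hy) ?_)
    have h1 := (abs_nonneg _).trans (hu c y hy)
    have h2 := (abs_nonneg _).trans (hd c y hy)
    have := S.K_nonneg
    have := S.lam_pos
    positivity

end WeightedIFS

/-! ### The cone of functions with bounded logarithmic derivative -/

/-- Positive `C¹` functions on `(a, b)` with logarithmic derivative bounded by `B`. -/
structure LogLip (a b B : ℝ) (u : ℝ → ℝ) : Prop where
  isC1 : IsC1 (Ioo a b) u
  pos : ∀ x ∈ Ioo a b, 0 < u x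
  abs_deriv_le : ∀ x ∈ Ioo a b, |deriv u x| ≤ B * u x

namespace LogLip

variable {a b B : ℝ} {u v : ℝ → ℝ}

lemma mono (h : LogLip a b B u) {B' : ℝ} (hB : B ≤ B') : LogLip a b B' u :=
  ⟨h.isC1, h.pos, fun x hx => (h.abs_deriv_le x hx).trans
    (mul_le_mul_of_nonneg_right hB (h.pos x hx).le)⟩

lemma const (B : ℝ) (hB : 0 ≤ B) {k : ℝ} (hk : 0 < k) : LogLip a b B fun _ => k :=
  ⟨⟨fun _ _ => differentiableAt_const _, by simpa using! continuousOn_const⟩, fun _ _ => hk,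
    fun _ _ => by simpa using by positivity⟩

lemma const_mul (h : LogLip a b B u) {k : ℝ} (hk : 0 < k) : LogLip a b B fun x => k * u x := by
  have hd : ∀ x ∈ Ioo a b, HasDerivAt (fun x => k * u x) (k * deriv u x) x := fun x hx =>
    (h.isC1.diff x hx).hasDerivAt.const_mul k
  refine ⟨.of_hasDerivAt hd (h.isC1.cont.const_mul k),
    fun x hx => mul_pos hk (h.pos x hx), fun x hx => ?_⟩
  rw [(hd x hx).deriv, abs_mul, abs_of_pos hk]
  nlinarith [h.abs_deriv_le x hx]

lemma B_nonneg (h : LogLip a b B u) (hab : a < b) : 0 ≤ B := by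
  obtain ⟨x, hx⟩ := nonempty_Ioo.2 hab
  have := (abs_nonneg _).trans (h.abs_deriv_le x hx)
  exact nonneg_of_mul_nonneg_left this (h.pos x hx)

/-- A Harnack inequality: `log u` is `B`-Lipschitz on an interval of length `b - a`. -/
lemma le_exp_mul (h : LogLip a b B u) {x y : ℝ} (hx : x ∈ Ioo a b) (hy : y ∈ Ioo a b) :
    u x ≤ Real.exp (B * (b - a)) * u y := by
  have hab : a < b := hx.1.trans hx.2
  have hB := h.B_nonneg hab
  have hmv : ‖Real.log (u x) - Real.log (u y)‖ ≤ B * ‖x - y‖ := by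
    refine (convex_Ioo a b).norm_image_sub_le_of_norm_hasDerivWithin_le
      (f' := fun z => deriv u z / u z)
      (fun z hz => ((h.isC1.diff z hz).hasDerivAt.log (h.pos z hz).ne').hasDerivWithinAt)
      (fun z hz => ?_) hy hx
    rw [Real.norm_eq_abs, abs_div, abs_of_pos (h.pos z hz), div_le_iff₀ (h.pos z hz)]
    exact h.abs_deriv_le z hz
  have hxy : ‖x - y‖ ≤ b - a := by
    rw [Real.norm_eq_abs, abs_le]; constructor <;> linarith [hx.1, hx.2, hy.1, hy.2]
  have h1 : Real.log (u x) - Real.log (u y) ≤ B * (b - a) :=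
    (le_abs_self _).trans (hmv.trans (mul_le_mul_of_nonneg_left hxy hB))
  rw [← Real.exp_log (h.pos x hx), ← Real.exp_log (h.pos y hy), ← Real.exp_add]
  exact Real.exp_le_exp.2 (by linarith)

lemma bddAbove (h : LogLip a b B u) (hab : a < b) : ∃ C, 0 < C ∧ ∀ x ∈ Ioo a b, u x ≤ C := by
  obtain ⟨y, hy⟩ := nonempty_Ioo.2 hab
  exact ⟨_, mul_pos (Real.exp_pos _) (h.pos y hy), fun x hx => h.le_exp_mul hx hy⟩

lemma integrableOn (h : LogLip a b B u) (hab : a < b) : IntegrableOn u (Ioo a b) := by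
  obtain ⟨C, _, hC⟩ := h.bddAbove hab
  refine Integrable.of_bound (h.isC1.continuousOn.aestronglyMeasurable measurableSet_Ioo) C ?_
  rw [ae_restrict_iff' measurableSet_Ioo]
  refine .of_forall fun x hx => ?_
  rw [Real.norm_eq_abs, abs_of_pos (h.pos x hx)]
  exact hC x hx

lemma integral_le (h : LogLip a b B u) {y : ℝ} (hy : y ∈ Ioo a b) :
    ∫ x in Ioo a b, u x ≤ (b - a) * (Real.exp (B * (b - a)) * u y) := by
  have hab : a < b := hy.1.trans hy.2
  calc ∫ x in Ioo a b, u x ≤ ∫ _ in Ioo a b, Real.exp (B * (b - a)) * u y :=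
        setIntegral_mono_on (h.integrableOn hab) (integrableOn_const (by simp)) measurableSet_Ioo
          fun x hx => h.le_exp_mul hx hy
    _ = _ := by
        rw [setIntegral_const]
        simp [Measure.real, Real.volume_Ioo, ENNReal.toReal_ofReal (sub_nonneg.2 hab.le)]

lemma le_integral (h : LogLip a b B u) {y : ℝ} (hy : y ∈ Ioo a b) :
    (b - a) * u y ≤ Real.exp (B * (b - a)) * ∫ x in Ioo a b, u x := by
  have hab : a < b := hy.1.trans hy.2
  calc (b - a) * u y = ∫ _ in Ioo a b, u y := by
        rw [setIntegral_const]
        simp [Measure.real, Real.volume_Ioo, ENNReal.toReal_ofReal (sub_nonneg.2 hab.le)]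
    _ ≤ ∫ x in Ioo a b, Real.exp (B * (b - a)) * u x :=
        setIntegral_mono_on (integrableOn_const (by simp)) ((h.integrableOn hab).const_mul _) measurableSet_Ioo
          fun x hx => h.le_exp_mul hy hx
    _ = _ := integral_const_mul _ _

lemma integral_pos (h : LogLip a b B u) (hab : a < b) : 0 < ∫ x in Ioo a b, u x := by
  obtain ⟨y, hy⟩ := nonempty_Ioo.2 hab
  have := (mul_pos (sub_pos.2 hab) (h.pos y hy)).trans_le (h.le_integral hy)
  exact pos_of_mul_pos_right this (Real.exp_pos _).le

end LogLip

/-- Completeness of `C¹` for the uniform norms of the function and its derivative, with one modulus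
`r` for both. It produces the invariant density and the limits of the fibre averages. -/
lemma exists_isC1_limit {a b : ℝ} {H : ℕ → ℝ → ℝ} (hC : ∀ n, IsC1 (Ioo a b) (H n)) {r : ℕ → ℝ}
    (hr : Tendsto r atTop (𝓝 0))
    (hH : ∀ k n m, k ≤ n → k ≤ m → ∀ x ∈ Ioo a b,
      |H n x - H m x| ≤ r k ∧ |deriv (H n) x - deriv (H m) x| ≤ r k) :
    ∃ h, IsC1 (Ioo a b) h ∧ (∀ x ∈ Ioo a b, Tendsto (fun n => H n x) atTop (𝓝 (h x))) ∧
      (∀ x ∈ Ioo a b, Tendsto (fun n => deriv (H n) x) atTop (𝓝 (deriv h x))) ∧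
      ∀ n, ∀ x ∈ Ioo a b, |H n x - h x| ≤ r n := by
  have lim : ∀ G : ℕ → ℝ → ℝ, (∀ k n m, k ≤ n → k ≤ m → ∀ x ∈ Ioo a b, |G n x - G m x| ≤ r k) →
      ∃ g : ℝ → ℝ, (∀ x ∈ Ioo a b, Tendsto (fun n => G n x) atTop (𝓝 (g x))) ∧
        (∀ n, ∀ x ∈ Ioo a b, |G n x - g x| ≤ r n) ∧ TendstoUniformlyOn G g atTop (Ioo a b) := by
    intro G hG
    have hex : ∀ x, ∃ y, x ∈ Ioo a b → Tendsto (fun n => G n x) atTop (𝓝 y) := by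
      intro x
      by_cases hx : x ∈ Ioo a b
      · obtain ⟨y, hy⟩ := cauchySeq_tendsto_of_complete
          (cauchySeq_of_le_tendsto_0 (s := fun n => G n x) r (fun n m N hn hm => hG N n m hn hm x hx) hr)
        exact ⟨y, fun _ => hy⟩
      · exact ⟨0, fun h => (hx h).elim⟩
    choose g hg using hex
    have hle : ∀ n, ∀ x ∈ Ioo a b, |G n x - g x| ≤ r n := fun n x hx =>
      le_of_tendsto ((tendsto_const_nhds.sub (hg x hx)).abs)
        (eventually_atTop.2 ⟨n, fun m hm => hG n n m le_rfl hm x hx⟩)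
    refine ⟨g, fun x hx => hg x hx, hle, Metric.tendstoUniformlyOn_iff.2 fun ε hε => ?_⟩
    filter_upwards [hr.eventually (gt_mem_nhds hε)] with n hn x hx
    rw [dist_comm]
    exact (hle n x hx).trans_lt hn
  obtain ⟨h, h1, h2, h3⟩ := lim H fun k n m hn hm x hx => (hH k n m hn hm x hx).1
  obtain ⟨h', h1', h2', h3'⟩ := lim (fun n => deriv (H n))
    fun k n m hn hm x hx => (hH k n m hn hm x hx).2
  have hd : ∀ x ∈ Ioo a b, HasDerivAt h (h' x) x := fun x hx =>
    hasDerivAt_of_tendstoUniformlyOn isOpen_Ioo h3'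
      (.of_forall fun n y hy => ((hC n).diff y hy).hasDerivAt) h1 hx
  refine ⟨h, .of_hasDerivAt hd (h3'.continuousOn (.of_forall fun n => (hC n).cont)), h1, ?_, h2⟩
  intro x hx
  rw [(hd x hx).deriv]
  exact h1' x hx

lemma IsC1.congr {a b : ℝ} {u v : ℝ → ℝ} (h : IsC1 (Ioo a b) u) (huv : EqOn v u (Ioo a b)) :
    IsC1 (Ioo a b) v := by
  refine .of_hasDerivAt (u' := deriv u) (fun x hx => ?_) h.cont
  exact (h.diff x hx).hasDerivAt.congr_of_eventuallyEq
    (huv.eventuallyEq_of_mem (isOpen_Ioo.mem_nhds hx))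

lemma deriv_congr_Ioo {a b : ℝ} {u v : ℝ → ℝ} (huv : EqOn v u (Ioo a b)) {x : ℝ}
    (hx : x ∈ Ioo a b) : deriv v x = deriv u x :=
  (huv.eventuallyEq_of_mem (isOpen_Ioo.mem_nhds hx)).deriv_eq

/-! ### The transfer operator and its contraction of the cone. -/

namespace WeightedIFS

variable {ι : Type*} {a b : ℝ}

/-- The system consists of the inverse branches of a full-branch map of `(a, b)`, weighted by
their derivatives. -/
structure IsBranchSystem (S : WeightedIFS ι a b) : Prop where
  w_eq : S.w = S.p
  lintegral_eq : ∀ Γ : ℝ → ENNReal, Measurable Γ →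
    ∫⁻ x in Ioo a b, Γ x = ∫⁻ x in Ioo a b, ∑' c, ENNReal.ofReal (S.p c x) * Γ (S.φ c x)

variable (S : WeightedIFS ι a b)

/-- The transfer operator. -/
def transfer (u : ℝ → ℝ) : ℝ → ℝ := S.op fun _ => u

variable {S} {u v : ℝ → ℝ} {B B' : ℝ}

lemma transfer_congr (h : EqOn u v (Ioo a b)) : EqOn (S.transfer u) (S.transfer v) (Ioo a b) :=
  fun x hx => tsum_congr fun c => by simp only [h (S.mapsTo c hx)]

lemma transfer_sub (hu : ∃ C, ∀ x ∈ Ioo a b, |u x| ≤ C) (hv : ∃ C, ∀ x ∈ Ioo a b, |v x| ≤ C)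
    {x : ℝ} (hx : x ∈ Ioo a b) :
    S.transfer u x - S.transfer v x = S.transfer (fun y => u y - v y) x := by
  obtain ⟨C, hC⟩ := hu
  obtain ⟨D, hD⟩ := hv
  simp only [transfer, op, mul_sub]
  exact ((summable_op (u := fun _ => u) (fun _ => hC) hx).tsum_sub
    (summable_op (u := fun _ => v) (fun _ => hD) hx)).symm

end WeightedIFS

lemma LogLip.bdd_abs {a b B : ℝ} {u : ℝ → ℝ} (h : LogLip a b B u) :
    ∃ C, ∀ x ∈ Ioo a b, |u x| ≤ C := by
  rcases lt_or_ge a b with hab | hab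
  · obtain ⟨C, _, hC⟩ := h.bddAbove hab
    exact ⟨C, fun x hx => by rw [abs_of_pos (h.pos x hx)]; exact hC x hx⟩
  · exact ⟨0, fun x hx => absurd (hx.1.trans hx.2) hab.not_gt⟩

lemma LogLip.bdd_abs_deriv {a b B : ℝ} {u : ℝ → ℝ} (h : LogLip a b B u) :
    ∃ C, ∀ x ∈ Ioo a b, |deriv u x| ≤ C := by
  rcases lt_or_ge a b with hab | hab
  · obtain ⟨C, _, hC⟩ := h.bddAbove hab
    exact ⟨B * C, fun x hx => (h.abs_deriv_le x hx).trans
      (mul_le_mul_of_nonneg_left (hC x hx) (h.B_nonneg hab))⟩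
  · exact ⟨0, fun x hx => absurd (hx.1.trans hx.2) hab.not_gt⟩

namespace WeightedIFS

variable {ι : Type*} {a b : ℝ} {S : WeightedIFS ι a b} {u v : ℝ → ℝ} {B B' : ℝ}

/-- Summing `abs_dterm_le` over the branches turns the bound `B` into `K + lam * B`. As `lam < 1`,
this is smaller than `B` once `B` is large: the operator improves the cone. -/
lemma _root_.NonCompactMixing.LogLip.transfer [Nonempty ι] (h : LogLip a b B u) :
    LogLip a b (S.K + S.lam * B) (S.transfer u) := by
  obtain ⟨C, hC⟩ := h.bdd_abs
  obtain ⟨D, hD⟩ := h.bdd_abs_deriv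
  have hsum : ∀ x ∈ Ioo a b, Summable fun c => S.w c x * u (S.φ c x) := fun x hx =>
    summable_op (u := fun _ => u) (fun _ => hC) hx
  refine ⟨isC1_op (fun _ => h.isC1) (fun _ => hC) (fun _ => hD), fun x hx => ?_, fun x hx => ?_⟩
  · exact (hsum x hx).tsum_pos (fun c => (mul_pos (S.w_pos c x hx) (h.pos _ (S.mapsTo c hx))).le)
      (Classical.arbitrary ι) (mul_pos (S.w_pos _ x hx) (h.pos _ (S.mapsTo _ hx)))
  · rw [WeightedIFS.transfer, (hasDerivAt_op (fun _ => h.isC1) (fun _ => hC) (fun _ => hD) hx).deriv, ← Real.norm_eq_abs]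
    refine tsum_of_norm_bounded ((hsum x hx).hasSum.mul_left (S.K + S.lam * B)) fun c => ?_
    refine (abs_dterm_le (u := fun _ => u) c hx).trans ?_
    have hφ := S.mapsTo c hx
    have h1 := h.abs_deriv_le _ hφ
    rw [abs_of_pos (h.pos _ hφ)]
    have h2 : S.lam * |deriv u (S.φ c x)| ≤ S.lam * (B * u (S.φ c x)) :=
      mul_le_mul_of_nonneg_left h1 S.lam_pos.le
    calc _ ≤ S.w c x * (S.K * u (S.φ c x) + S.lam * (B * u (S.φ c x))) :=
          mul_le_mul_of_nonneg_left (by linarith) (S.w_pos c x hx).le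
      _ = _ := by ring

lemma measurable_indicator_ofReal (hu : ContinuousOn u (Ioo a b)) :
    Measurable ((Ioo a b).indicator fun x => ENNReal.ofReal (u x)) := by
  rw [← Set.piecewise_eq_indicator]
  exact (ENNReal.continuous_ofReal.comp_continuousOn hu).measurable_piecewise
    continuousOn_const measurableSet_Ioo

/-- After the change of variables along the branches, `T (φ c x) = x` makes `Γ (T ·)` the common
factor `Γ x` of all the terms. -/
lemma lintegral_transfer [Countable ι] (hS : S.IsBranchSystem) (h : LogLip a b B u)
    {Γ : ℝ → ENNReal} (hΓ : Measurable Γ) {T : ℝ → ℝ} (hTm : Measurable T)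
    (hT : ∀ c, ∀ x ∈ Ioo a b, T (S.φ c x) = x) :
    ∫⁻ x in Ioo a b, Γ (T x) * ENNReal.ofReal (u x) =
      ∫⁻ x in Ioo a b, Γ x * ENNReal.ofReal (S.transfer u x) := by
  obtain ⟨C, hC⟩ := h.bdd_abs
  have h1 : ∫⁻ x in Ioo a b, Γ (T x) * ENNReal.ofReal (u x) =
      ∫⁻ x in Ioo a b, Γ (T x) * (Ioo a b).indicator (fun x => ENNReal.ofReal (u x)) x :=
    setLIntegral_congr_fun measurableSet_Ioo fun x hx => by simp [indicator_of_mem hx]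
  have h0 : Measurable fun x => Γ (T x) * (Ioo a b).indicator (fun x => ENNReal.ofReal (u x)) x :=
    (hΓ.comp hTm).mul (measurable_indicator_ofReal h.isC1.continuousOn)
  rw [h1, hS.lintegral_eq _ h0]
  refine setLIntegral_congr_fun measurableSet_Ioo fun x hx => ?_
  have h2 : ∀ c, ENNReal.ofReal (S.p c x) * (Γ (T (S.φ c x)) *
      (Ioo a b).indicator (fun x => ENNReal.ofReal (u x)) (S.φ c x)) =
      Γ x * ENNReal.ofReal (S.w c x * u (S.φ c x)) := by
    intro c
    rw [hT c x hx, indicator_of_mem (S.mapsTo c hx), hS.w_eq,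
      ENNReal.ofReal_mul (S.p_pos c x hx).le]
    ring
  simp only [h2]
  rw [ENNReal.tsum_mul_left, transfer, op, ENNReal.ofReal_tsum_of_nonneg]
  · exact fun c => (mul_pos (S.w_pos c x hx) (h.pos _ (S.mapsTo c hx))).le
  · exact summable_op (u := fun _ => u) (fun _ => hC) hx

lemma integral_transfer [Countable ι] [Nonempty ι] (hS : S.IsBranchSystem) (h : LogLip a b B u) :
    ∫ x in Ioo a b, S.transfer u x = ∫ x in Ioo a b, u x := by
  obtain ⟨C, hC⟩ := h.bdd_abs
  have key : ∫⁻ x in Ioo a b, ENNReal.ofReal (u x) =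
      ∫⁻ x in Ioo a b, ENNReal.ofReal (S.transfer u x) := by
    have h1 : ∫⁻ x in Ioo a b, ENNReal.ofReal (u x) =
        ∫⁻ x in Ioo a b, (Ioo a b).indicator (fun x => ENNReal.ofReal (u x)) x :=
      setLIntegral_congr_fun measurableSet_Ioo fun x hx => by simp [indicator_of_mem hx]
    rw [h1, hS.lintegral_eq _ (measurable_indicator_ofReal h.isC1.continuousOn)]
    refine setLIntegral_congr_fun measurableSet_Ioo fun x hx => ?_
    rw [transfer, op, ENNReal.ofReal_tsum_of_nonneg
      (fun c => (mul_pos (S.w_pos c x hx) (h.pos _ (S.mapsTo c hx))).le)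
      (summable_op (u := fun _ => u) (fun _ => hC) hx)]
    refine tsum_congr fun c => ?_
    rw [indicator_of_mem (S.mapsTo c hx), hS.w_eq, ENNReal.ofReal_mul (S.p_pos c x hx).le]
  have hL := h.transfer (S := S)
  rw [integral_eq_lintegral_of_nonneg_ae, integral_eq_lintegral_of_nonneg_ae, key]
  · exact (ae_restrict_iff' measurableSet_Ioo).2 (.of_forall fun x hx => (h.pos x hx).le)
  · exact h.isC1.continuousOn.aestronglyMeasurable measurableSet_Ioo
  · exact (ae_restrict_iff' measurableSet_Ioo).2 (.of_forall fun x hx => (hL.pos x hx).le)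
  · exact hL.isC1.continuousOn.aestronglyMeasurable measurableSet_Ioo

/-- One step of the coupling argument: a definite fraction of the mass of the two images can be
cancelled without leaving the cone. -/
lemma exists_coupling [Countable ι] [Nonempty ι] (hS : S.IsBranchSystem) (hab : a < b)
    (hB : S.K + S.lam * B < B) :
    ∃ θ : ℝ, 0 ≤ θ ∧ θ < 1 ∧ ∀ u v, LogLip a b B u → LogLip a b B v →
      ∫ x in Ioo a b, u x = ∫ x in Ioo a b, v x →
      ∃ u₁ v₁, LogLip a b B u₁ ∧ LogLip a b B v₁ ∧
        ∫ x in Ioo a b, u₁ x = ∫ x in Ioo a b, v₁ x ∧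
        ∫ x in Ioo a b, u₁ x = θ * ∫ x in Ioo a b, u x ∧
        ∀ x ∈ Ioo a b, S.transfer u x - S.transfer v x = u₁ x - v₁ x := by
  set B₁ := S.K + S.lam * B with hB₁
  have hl := sub_pos.2 hab
  have hBpos : 0 < B := by
    have := S.K_nonneg
    have := S.lam_lt_one
    by_contra hcon
    nlinarith [S.lam_pos]
  have hB₁0 : 0 ≤ B₁ := add_nonneg S.K_nonneg (mul_nonneg S.lam_pos.le hBpos.le)
  set q := Real.exp (B₁ * (b - a)) with hq
  have hq1 : 1 ≤ q := Real.one_le_exp (by positivity)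
  -- A constant `δ * I` can be subtracted from `S.transfer u` within the cone if `δ * I * B ≤ (B -
  -- B₁) * S.transfer u`. By Harnack `S.transfer u ≥ I / (q * (b - a))`; the factor `2` makes the
  -- inequality strict and so keeps the result positive.
  set δ := (B - B₁) / (B * (2 * q * (b - a))) with hδ
  have hδ0 : 0 < δ := div_pos (by linarith) (by positivity)
  have hδle : δ * (b - a) ≤ 1 := by
    rw [hδ, div_mul_eq_mul_div, div_le_one (by positivity)]
    have : (B - B₁) * (b - a) ≤ B * (b - a) := mul_le_mul_of_nonneg_right (by linarith) hl.le
    nlinarith [mul_pos hBpos hl]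
  refine ⟨1 - δ * (b - a), by linarith, by nlinarith [mul_pos hδ0 hl], ?_⟩
  -- Functions of equal mass lose the same constant, so the difference of the images is unchanged
  -- while each mass shrinks by the factor `1 - δ * (b - a)`.
  have step : ∀ u I, LogLip a b B u → ∫ x in Ioo a b, u x = I →
      LogLip a b B (fun x => S.transfer u x - δ * I) ∧
      ∫ x in Ioo a b, (S.transfer u x - δ * I) = (1 - δ * (b - a)) * I := by
    intro u I hu hI
    have hL := hu.transfer (S := S)
    rw [← hB₁] at hL
    have hLI : ∫ x in Ioo a b, S.transfer u x = I := (integral_transfer hS hu).trans hI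
    have hI0 : 0 < I := hI ▸ hu.integral_pos hab
    have hlow : ∀ x ∈ Ioo a b, δ * I * B < (B - B₁) * S.transfer u x := by
      intro x hx
      have h1 := hL.integral_le hx
      rw [hLI] at h1
      have h2 : δ * I * B = (B - B₁) * I / (2 * q * (b - a)) := by
        rw [hδ]; field_simp
      rw [h2, div_lt_iff₀ (by positivity)]
      have h3 : (B - B₁) * I ≤ (B - B₁) * ((b - a) * (q * S.transfer u x)) :=
        mul_le_mul_of_nonneg_left h1 (by linarith)
      have h4 : 0 < (B - B₁) * ((b - a) * (q * S.transfer u x)) := 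
        mul_pos (by linarith) (mul_pos hl (mul_pos (by positivity) (hL.pos x hx)))
      nlinarith
    have hd : ∀ x ∈ Ioo a b, HasDerivAt (fun x => S.transfer u x - δ * I)
        (deriv (S.transfer u) x) x := fun x hx => (hL.isC1.diff x hx).hasDerivAt.sub_const _
    refine ⟨⟨.of_hasDerivAt hd hL.isC1.cont, fun x hx => ?_, fun x hx => ?_⟩, ?_⟩
    · have := hlow x hx
      have h5 := hL.pos x hx
      by_contra hcon
      nlinarith [mul_nonneg hB₁0 h5.le]
    · rw [(hd x hx).deriv]
      have := hlow x hx
      linarith [hL.abs_deriv_le x hx]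
    · rw [integral_sub (hL.integrableOn hab) (integrableOn_const (by simp)), hLI, setIntegral_const]
      simp only [Measure.real, Real.volume_Ioo, ENNReal.toReal_ofReal hl.le, smul_eq_mul]
      ring
  intro u v hu hv huv
  obtain ⟨hu1, hu2⟩ := step u _ hu rfl
  obtain ⟨hv1, hv2⟩ := step v _ hv huv.symm
  exact ⟨_, _, hu1, hv1, hu2.trans hv2.symm, hu2, fun x _ => by ring⟩

lemma _root_.NonCompactMixing.LogLip.iterate_transfer [Nonempty ι] (hB : S.K + S.lam * B < B)
    (h : LogLip a b B u) (n : ℕ) : LogLip a b B (S.transfer^[n] u) := by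
  induction n with
  | zero => exact h
  | succ n ih => rw [Function.iterate_succ_apply']; exact ih.transfer.mono hB.le

lemma integral_iterate_transfer [Countable ι] [Nonempty ι] (hS : S.IsBranchSystem)
    (hB : S.K + S.lam * B < B) (h : LogLip a b B u) (n : ℕ) :
    ∫ x in Ioo a b, S.transfer^[n] u x = ∫ x in Ioo a b, u x := by
  induction n with
  | zero => rfl
  | succ n ih =>
    rw [Function.iterate_succ_apply', integral_transfer hS (h.iterate_transfer hB n), ih]

/-- Exponential loss of memory of the transfer operator in the `C¹` norm. -/
lemma exists_loss_of_memory [Countable ι] [Nonempty ι] (hS : S.IsBranchSystem) (hab : a < b)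
    (hB : S.K + S.lam * B < B) :
    ∃ θ C : ℝ, 0 ≤ θ ∧ θ < 1 ∧ ∀ u v, LogLip a b B u → LogLip a b B v →
      ∫ x in Ioo a b, u x = ∫ x in Ioo a b, v x → ∀ n, ∀ x ∈ Ioo a b,
        |S.transfer^[n] u x - S.transfer^[n] v x| ≤ C * θ ^ n * ∫ x in Ioo a b, u x ∧
        |deriv (S.transfer^[n] u) x - deriv (S.transfer^[n] v) x| ≤
          C * θ ^ n * ∫ x in Ioo a b, u x := by
  obtain ⟨θ, h0, h1, hstep⟩ := exists_coupling hS hab hB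
  have hl := sub_pos.2 hab
  set q := Real.exp (B * (b - a)) with hq
  -- A cone function of mass `I` is at most `q / (b - a) * I` and its derivative at most `B` times
  -- that. A difference of two such functions doubles these bounds, and `2 * (1 + B)` covers both.
  refine ⟨θ, 2 * (1 + B) * (q / (b - a)), h0, h1, fun u v hu hv huv n => ?_⟩
  have hBn := hu.B_nonneg hab
  -- The difference of the iterates is represented at each step by a new pair of cone functions of
  -- mass `θ ^ n` times the original; only the difference, not the pair, follows the iteration.
  have key : ∃ u₁ v₁, LogLip a b B u₁ ∧ LogLip a b B v₁ ∧
      ∫ x in Ioo a b, u₁ x = ∫ x in Ioo a b, v₁ x ∧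
      ∫ x in Ioo a b, u₁ x = θ ^ n * ∫ x in Ioo a b, u x ∧
      ∀ x ∈ Ioo a b, S.transfer^[n] u x - S.transfer^[n] v x = u₁ x - v₁ x := by
    induction n with
    | zero => exact ⟨u, v, hu, hv, huv, by simp, fun x _ => rfl⟩
    | succ n ih =>
      obtain ⟨u₁, v₁, hu₁, hv₁, h2, h3, h4⟩ := ih
      obtain ⟨u₂, v₂, hu₂, hv₂, h5, h6, h7⟩ := hstep u₁ v₁ hu₁ hv₁ h2
      refine ⟨u₂, v₂, hu₂, hv₂, h5, by rw [h6, h3]; ring, fun x hx => ?_⟩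
      rw [← h7 x hx, Function.iterate_succ_apply', Function.iterate_succ_apply',
        transfer_sub (hu.iterate_transfer hB n).bdd_abs (hv.iterate_transfer hB n).bdd_abs hx,
        transfer_sub hu₁.bdd_abs hv₁.bdd_abs hx]
      exact transfer_congr h4 hx
  obtain ⟨u₁, v₁, hu₁, hv₁, h2, h3, h4⟩ := key
  have bound : ∀ w, LogLip a b B w → ∫ x in Ioo a b, w x = ∫ x in Ioo a b, u₁ x →
      ∀ x ∈ Ioo a b, w x ≤ q / (b - a) * (θ ^ n * ∫ x in Ioo a b, u x) := by
    intro w hw hwI x hx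
    have := hw.le_integral hx
    rw [hwI, h3] at this
    rw [div_mul_eq_mul_div, le_div_iff₀ hl]
    linarith
  intro x hx
  have b1 := bound u₁ hu₁ rfl x hx
  have b2 := bound v₁ hv₁ h2.symm x hx
  set Q := q / (b - a) * (θ ^ n * ∫ x in Ioo a b, u x) with hQ
  have p1 := hu₁.pos x hx
  have p2 := hv₁.pos x hx
  have e : 2 * (1 + B) * (q / (b - a)) * θ ^ n * ∫ x in Ioo a b, u x = 2 * (1 + B) * Q := by
    rw [hQ]; ring
  rw [e]
  have hBQ : 0 ≤ B * Q := mul_nonneg hBn (p1.le.trans b1)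
  constructor
  · rw [h4 x hx, abs_le]; constructor <;> nlinarith
  · have hdd : deriv (S.transfer^[n] u) x - deriv (S.transfer^[n] v) x =
        deriv u₁ x - deriv v₁ x := by
      rw [← deriv_fun_sub ((hu.iterate_transfer hB n).isC1.diff x hx)
        ((hv.iterate_transfer hB n).isC1.diff x hx),
        ← deriv_fun_sub (hu₁.isC1.diff x hx) (hv₁.isC1.diff x hx)]
      exact deriv_congr_Ioo (fun y hy => h4 y hy) hx
    rw [hdd]
    have d1 := hu₁.abs_deriv_le x hx
    have d2 := hv₁.abs_deriv_le x hx
    have d3 := abs_sub (deriv u₁ x) (deriv v₁ x)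
    have d4 := mul_le_mul_of_nonneg_left b1 hBn
    have d5 := mul_le_mul_of_nonneg_left b2 hBn
    have : 0 ≤ Q := p1.le.trans b1
    linarith

end WeightedIFS

lemma norm_setIntegral_sub_le {a b : ℝ} (hab : a < b) {u v : ℝ → ℝ} {s : Set ℝ}
    (hs : s ⊆ Ioo a b) (hu : IntegrableOn u (Ioo a b))
    (hv : IntegrableOn v (Ioo a b)) {r : ℝ} (h : ∀ x ∈ Ioo a b, |u x - v x| ≤ r) :
    |(∫ x in s, u x) - ∫ x in s, v x| ≤ r * (b - a) := by
  rw [← integral_sub (hu.mono_set hs) (hv.mono_set hs)]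
  have hr : 0 ≤ r := by
    obtain ⟨x, hx⟩ := nonempty_Ioo.2 hab
    exact (abs_nonneg _).trans (h x hx)
  have hvol : volume s ≤ ENNReal.ofReal (b - a) := by
    rw [← Real.volume_Ioo]; exact measure_mono hs
  have h1 := norm_setIntegral_le_of_norm_le_const (μ := volume) (s := s) (C := r)
    (f := fun x => u x - v x) (hvol.trans_lt ENNReal.ofReal_lt_top) fun x hx => h x (hs hx)
  refine h1.trans (mul_le_mul_of_nonneg_left ?_ hr)
  exact ENNReal.toReal_le_of_le_ofReal (sub_pos.2 hab).le hvol

/-- Nonnegative integrable functions are `L¹`-limits of functions with bounded logarithmic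
derivative. -/
lemma exists_logLip_approx {a b : ℝ} (hab : a < b) {k : ℝ → ℝ} (hk : IntegrableOn k (Ioo a b))
    (hk0 : ∀ x, 0 ≤ k x) {ε : ℝ} (hε : 0 < ε) :
    ∃ B u, LogLip a b B u ∧ ∫ x in Ioo a b, |k x - u x| ≤ ε := by
  obtain ⟨g, -, hg, hgc, hgi⟩ :=
    Integrable.exists_hasCompactSupport_integral_sub_le hk (half_pos hε)
  have hl := sub_pos.2 hab
  -- Raising `|g|` by `2 * η` before approximating it within `η` by a polynomial keeps the
  -- polynomial above `η`, which bounds its logarithmic derivative. The `L¹` cost is at most `3 * η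
  -- * (b - a) = ε / 2`.
  set η := ε / (6 * (b - a)) with hη
  have hη0 : 0 < η := by positivity
  obtain ⟨P, hP⟩ := exists_polynomial_near_of_continuousOn a b (fun x => |g x| + 2 * η)
    ((hgc.abs.add continuous_const).continuousOn) η hη0
  have hlow : ∀ x ∈ Ioo a b, η < P.eval x := fun x hx => by
    have := (abs_lt.1 (hP x (Ioo_subset_Icc_self hx))).1
    linarith [abs_nonneg (g x)]
  obtain ⟨C, hC⟩ := isCompact_Icc.exists_bound_of_continuousOn (s := Icc a b)
    (f := fun x => P.derivative.eval x) P.derivative.continuous.continuousOn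
  have hC0 : 0 ≤ C := (norm_nonneg _).trans (hC a (left_mem_Icc.2 hab.le))
  have hu : LogLip a b (C / η) fun x => P.eval x := by
    refine ⟨.of_hasDerivAt (fun x _ => P.hasDerivAt x) P.derivative.continuous.continuousOn,
      fun x hx => hη0.trans (hlow x hx), fun x hx => ?_⟩
    rw [(P.hasDerivAt x).deriv]
    refine (hC x (Ioo_subset_Icc_self hx)).trans ?_
    rw [div_mul_eq_mul_div, le_div_iff₀ hη0]
    exact mul_le_mul_of_nonneg_left (hlow x hx).le hC0
  refine ⟨_, _, hu, ?_⟩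
  have hgI : Integrable (fun x => |k x - g x|) (volume.restrict (Ioo a b)) := (hk.sub hgi).abs
  have h1 : ∫ x in Ioo a b, |k x - P.eval x| ≤ ∫ x in Ioo a b, (|k x - g x| + 3 * η) := by
    refine setIntegral_mono_on (hk.sub (hu.integrableOn hab)).abs
      (hgI.add (integrableOn_const (by simp))) measurableSet_Ioo fun x hx => ?_
    have h2 := abs_lt.1 (hP x (Ioo_subset_Icc_self hx))
    have h3 : |k x - (|g x|)| ≤ |k x - g x| := by
      conv_lhs => rw [← abs_of_nonneg (hk0 x)]
      exact abs_abs_sub_abs_le _ _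
    rw [abs_le] at h3 ⊢
    constructor <;> linarith
  refine h1.trans ?_
  rw [integral_add hgI (integrableOn_const (by simp)), setIntegral_const]
  simp only [Measure.real, Real.volume_Ioo, ENNReal.toReal_ofReal hl.le, smul_eq_mul]
  have h4 : (b - a) * (3 * η) = ε / 2 := by rw [hη]; field_simp; norm_num
  have : ∫ x in Ioo a b, |k x - g x| ≤ ε / 2 := hg
  linarith

/-! ### The invariant density: existence and uniqueness. -/

namespace WeightedIFS

variable {ι : Type*} {a b : ℝ} {S : WeightedIFS ι a b} {u v h : ℝ → ℝ} {B B' : ℝ}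

/-- `h` is the normalised fixed point of the transfer operator and attracts all functions with
bounded logarithmic derivative. -/
structure IsInvariantDensity (S : WeightedIFS ι a b) (B : ℝ) (h : ℝ → ℝ) : Prop where
  logLip : LogLip a b B h
  fixed : EqOn (S.transfer h) h (Ioo a b)
  integral_eq_one : ∫ x in Ioo a b, h x = 1
  attracts : ∀ B' u, LogLip a b B' u → ∃ r : ℕ → ℝ, Tendsto r atTop (𝓝 0) ∧
    ∀ n, ∀ x ∈ Ioo a b, |S.transfer^[n] u x - (∫ y in Ioo a b, u y) * h x| ≤ r n

lemma exists_lt_of_K (S : WeightedIFS ι a b) (B₀ : ℝ) :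
    ∃ B, B₀ ≤ B ∧ S.K + S.lam * B < B := by
  have h1 : 0 < 1 - S.lam := sub_pos.2 S.lam_lt_one
  refine ⟨max B₀ ((S.K + 1) / (1 - S.lam)), le_max_left _ _, ?_⟩
  have h2 : (S.K + 1) / (1 - S.lam) ≤ max B₀ ((S.K + 1) / (1 - S.lam)) := le_max_right _ _
  rw [div_le_iff₀ h1] at h2
  linarith

/-- The iterates of the constant density are Cauchy in `C¹`: for `k ≤ n, m` the `n`-th and the
`m`-th are the `k`-th images of two cone functions of mass one, to which loss of memory applies. -/
theorem exists_invariantDensity [Countable ι] [Nonempty ι] (hS : S.IsBranchSystem) (hab : a < b) :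
    ∃ B h, S.IsInvariantDensity B h := by
  obtain ⟨B, hB0, hB⟩ := exists_lt_of_K S 0
  have hl := sub_pos.2 hab
  obtain ⟨θ, C, hθ0, hθ1, hmem⟩ := exists_loss_of_memory hS hab hB
  set u₀ : ℝ → ℝ := fun _ => 1 / (b - a) with hu₀
  have hu₀L : LogLip a b B u₀ := LogLip.const B hB0 (by positivity)
  have hu₀I : ∫ x in Ioo a b, u₀ x = 1 := by
    rw [hu₀, setIntegral_const]
    simp only [Measure.real, Real.volume_Ioo, ENNReal.toReal_ofReal hl.le, smul_eq_mul]
    field_simp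
  set H : ℕ → ℝ → ℝ := fun n => S.transfer^[n] u₀ with hH
  have hHL : ∀ n, LogLip a b B (H n) := hu₀L.iterate_transfer hB
  have hHI : ∀ n, ∫ x in Ioo a b, H n x = 1 := fun n =>
    (integral_iterate_transfer hS hB hu₀L n).trans hu₀I
  have hr : Tendsto (fun n => C * θ ^ n) atTop (𝓝 0) := by
    simpa using (tendsto_pow_atTop_nhds_zero_of_lt_one hθ0 hθ1).const_mul C
  obtain ⟨h, hC1, hlim, hdlim, hunif⟩ := exists_isC1_limit (fun n => (hHL n).isC1) hr (by
    intro k n m hn hm x hx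
    have := hmem (H (n - k)) (H (m - k)) (hHL _) (hHL _) (by rw [hHI, hHI]) k x hx
    rw [hHI, mul_one] at this
    simp only [hH] at this ⊢
    rwa [← Function.iterate_add_apply, ← Function.iterate_add_apply, Nat.add_sub_cancel' hn,
      Nat.add_sub_cancel' hm] at this)
  have hhL : LogLip a b B h := by
    refine ⟨hC1, fun x hx => ?_, fun x hx => ?_⟩
    -- Positivity survives the limit because Harnack bounds cone functions of mass one from below
    -- uniformly.
    · have h1 : ∀ n, (1 : ℝ) / ((b - a) * Real.exp (B * (b - a))) ≤ H n x := fun n => by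
        have := (hHL n).integral_le hx
        rw [hHI] at this
        rw [div_le_iff₀ (by positivity)]
        linarith
      exact lt_of_lt_of_le (by positivity) (ge_of_tendsto' (hlim x hx) h1)
    · exact le_of_tendsto_of_tendsto' (hdlim x hx).abs ((hlim x hx).const_mul B)
        fun n => (hHL n).abs_deriv_le x hx
  have hint : ∫ x in Ioo a b, h x = 1 := by
    have h1 : Tendsto (fun n => |(∫ x in Ioo a b, H n x) - ∫ x in Ioo a b, h x|) atTop (𝓝 0) :=
      squeeze_zero (fun _ => abs_nonneg _) (fun n => norm_setIntegral_sub_le hab subset_rfl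
        ((hHL n).integrableOn hab) (hhL.integrableOn hab) (hunif n))
        (by simpa using hr.mul_const (b - a))
    simp only [hHI] at h1
    have := tendsto_nhds_unique h1 tendsto_const_nhds
    linarith [abs_eq_zero.1 this.symm]
  have hfix : EqOn (S.transfer h) h (Ioo a b) := by
    intro x hx
    have h1 : Tendsto (fun n => S.transfer (H n) x) atTop (𝓝 (h x)) := by
      have := (hlim x hx).comp (tendsto_add_atTop_nat 1)
      simpa only [Function.comp_def, hH, Function.iterate_succ_apply'] using this
    have h2 : Tendsto (fun n => S.transfer (H n) x) atTop (𝓝 (S.transfer h x)) := by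
      rw [tendsto_iff_dist_tendsto_zero]
      refine squeeze_zero (fun _ => dist_nonneg) (g := fun n => (∑' c, S.w c x) * (C * θ ^ n))
        (fun n => ?_) (by simpa using hr.const_mul (∑' c, S.w c x))
      rw [Real.dist_eq, transfer_sub (hHL n).bdd_abs hhL.bdd_abs hx, ← Real.norm_eq_abs]
      exact tsum_of_norm_bounded ((summable_w hx).hasSum.mul_right _) fun c =>
        abs_term_le (u := fun _ y => H n y - h y) (fun _ => hunif n) c hx
    exact tendsto_nhds_unique h2 h1
  refine ⟨B, h, hhL, hfix, hint, fun B' u hu => ?_⟩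
  -- A function with another bound `B'` is compared with `I * h` in a larger cone that contains
  -- both.
  obtain ⟨B₁, hB₁0, hB₁⟩ := exists_lt_of_K S (max B B')
  obtain ⟨θ', C', hθ0', hθ1', hmem'⟩ := exists_loss_of_memory hS hab hB₁
  set I := ∫ y in Ioo a b, u y with hI
  have hI0 : 0 < I := hu.integral_pos hab
  have hIh := (hhL.const_mul hI0)
  have hfixn : ∀ n, EqOn (S.transfer^[n] fun x => I * h x) (fun x => I * h x) (Ioo a b) := by
    intro n
    induction n with
    | zero => exact fun _ _ => rfl
    | succ n ih =>
      intro x hx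
      rw [Function.iterate_succ_apply', transfer_congr ih hx]
      change _ = I * h x
      rw [← hfix hx]
      simp only [transfer, op]
      rw [← tsum_mul_left]
      exact tsum_congr fun c => by ring
  refine ⟨fun n => C' * θ' ^ n * I, ?_, fun n x hx => ?_⟩
  · simpa using ((tendsto_pow_atTop_nhds_zero_of_lt_one hθ0' hθ1').const_mul C').mul_const I
  · have := (hmem' u _ (hu.mono ((le_max_right _ _).trans hB₁0))
      (hIh.mono ((le_max_left _ _).trans hB₁0)) (by
        rw [integral_const_mul, hint, mul_one]) n x hx).1
    rwa [hfixn n hx] at this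

lemma lintegral_iterate_transfer [Countable ι] [Nonempty ι] (hS : S.IsBranchSystem)
    (hB : S.K + S.lam * B < B) (h : LogLip a b B u) {T : ℝ → ℝ} (hTm : Measurable T)
    (hT : ∀ c, ∀ x ∈ Ioo a b, T (S.φ c x) = x) (n : ℕ) {Γ : ℝ → ENNReal} (hΓ : Measurable Γ) :
    ∫⁻ x in Ioo a b, Γ (T^[n] x) * ENNReal.ofReal (u x) =
      ∫⁻ x in Ioo a b, Γ x * ENNReal.ofReal (S.transfer^[n] u x) := by
  induction n generalizing Γ with
  | zero => rfl
  | succ n ih =>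
    rw [Function.iterate_succ_apply',
      ← lintegral_transfer hS (h.iterate_transfer hB n) hΓ hTm hT]
    refine Eq.trans ?_ (ih (Γ := fun x => Γ (T x)) (hΓ.comp hTm))
    simp only [Function.iterate_succ_apply']

lemma setIntegral_iterate_transfer [Countable ι] [Nonempty ι] (hS : S.IsBranchSystem)
    (hab : a < b)
    (hB : S.K + S.lam * B < B) (h : LogLip a b B u) {T : ℝ → ℝ} (hTm : Measurable T)
    (hT : ∀ c, ∀ x ∈ Ioo a b, T (S.φ c x) = x) (n : ℕ) {E : Set ℝ} (hE : MeasurableSet E) :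
    ∫ x in T^[n] ⁻¹' E ∩ Ioo a b, u x = ∫ x in E ∩ Ioo a b, S.transfer^[n] u x := by
  have aux : ∀ (v : ℝ → ℝ) (s : Set ℝ), LogLip a b B v → MeasurableSet s →
      ∫ x in s ∩ Ioo a b, v x =
        (∫⁻ x in Ioo a b, s.indicator 1 x * ENNReal.ofReal (v x)).toReal := by
    intro v s hv hs
    rw [integral_eq_lintegral_of_nonneg_ae]
    · rw [← Measure.restrict_restrict hs, ← lintegral_indicator hs]
      congr 1
      refine lintegral_congr fun x => ?_
      by_cases hx : x ∈ s <;> simp [hx]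
    · exact (ae_restrict_iff' (hs.inter measurableSet_Ioo)).2
        (.of_forall fun x hx => (hv.pos x hx.2).le)
    · exact ((hv.integrableOn hab).mono_set inter_subset_right).aestronglyMeasurable
  rw [aux u _ h (hTm.iterate n hE), aux _ E (h.iterate_transfer hB n) hE,
    ← lintegral_iterate_transfer hS hB h hTm hT n (measurable_one.indicator hE)]
  rfl

/-- The invariant density gives the only absolutely continuous measure invariant under a power of
the full-branch map, up to scaling. -/
theorem IsInvariantDensity.eq_withDensity [Countable ι] [Nonempty ι] (hS : S.IsBranchSystem)
    (hab : a < b) (hh : S.IsInvariantDensity B h) {T : ℝ → ℝ} (hTm : Measurable T)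
    (hT : ∀ c, ∀ x ∈ Ioo a b, T (S.φ c x) = x) {k : ℕ} (hk : 1 ≤ k) {μ : Measure ℝ}
    [IsFiniteMeasure μ] (hac : μ ≪ volume) (hμ : μ (Ioo a b)ᶜ = 0)
    (hinv : MeasurePreserving T^[k] μ μ) :
    μ = μ univ • (volume.restrict (Ioo a b)).withDensity fun x => ENNReal.ofReal (h x) := by
  set ρ : ℝ → ℝ := fun x => (μ.rnDeriv volume x).toReal with hρ
  have hρi : Integrable ρ := Measure.integrable_toReal_rnDeriv
  have hl := sub_pos.2 hab
  have hIoo : ∀ s, μ.real (s ∩ Ioo a b) = μ.real s := fun s => by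
    simp only [Measure.real, measure_inter_conull hμ]
  have hhi := hh.logLip.integrableOn hab
  have hmain : ∀ E, MeasurableSet E → μ.real E = μ.real univ * ∫ x in E ∩ Ioo a b, h x := by
    intro E hE
    have hEh1 : ∫ x in E ∩ Ioo a b, h x ≤ 1 := by
      rw [← hh.integral_eq_one]
      refine setIntegral_mono_set hhi ?_ (LE.le.eventuallyLE inter_subset_right)
      exact (ae_restrict_iff' measurableSet_Ioo).2 (.of_forall fun x hx => (hh.logLip.pos x hx).le)
    have hEh0 : 0 ≤ ∫ x in E ∩ Ioo a b, h x :=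
      setIntegral_nonneg (hE.inter measurableSet_Ioo) fun x hx => (hh.logLip.pos x hx.2).le
    -- The three errors are: replacing the density of `μ` by a function `w` of some cone, replacing
    -- a late iterate of `w` by `(∫ w) * h`, and replacing `∫ w` by the mass of `μ`. Invariance
    -- moves `E` to its preimage at a late time, where the second error is small.
    have hbound : ∀ ε > 0, |μ.real E - μ.real univ * ∫ x in E ∩ Ioo a b, h x| ≤ 3 * ε := by
      intro ε hε
      obtain ⟨B', w, hw, hwε⟩ := exists_logLip_approx hab (hρi.integrableOn (s := Ioo a b))
        (fun x => ENNReal.toReal_nonneg) hε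
      have hdiff : ∀ s, MeasurableSet s →
          |μ.real s - ∫ x in s ∩ Ioo a b, w x| ≤ ε := by
        intro s hs
        have h1 : μ.real s = ∫ x in s ∩ Ioo a b, ρ x := by
          rw [← hIoo]; exact (Measure.setIntegral_toReal_rnDeriv hac _).symm
        have hwi := (hw.integrableOn hab).mono_set (inter_subset_right (s := s))
        have hρw : IntegrableOn (fun x => ρ x - w x) (Ioo a b) :=
          hρi.integrableOn.sub (hw.integrableOn hab)
        rw [h1, ← integral_sub hρi.integrableOn hwi]
        rw [← Real.norm_eq_abs]
        refine (norm_integral_le_integral_norm _).trans (le_trans ?_ hwε)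
        exact setIntegral_mono_set hρw.abs (.of_forall fun x => abs_nonneg _)
          (LE.le.eventuallyLE inter_subset_right)
      obtain ⟨r, hr0, hr⟩ := hh.attracts B' w hw
      obtain ⟨B₁, hB₁0, hB₁⟩ := exists_lt_of_K S B'
      have hw₁ := hw.mono hB₁0
      have hev : ∀ᶠ n in atTop, r n * (b - a) < ε := by
        have : Tendsto (fun n => r n * (b - a)) atTop (𝓝 0) := by simpa using hr0.mul_const (b - a)
        exact this.eventually (gt_mem_nhds hε)
      obtain ⟨N, hN⟩ := eventually_atTop.1 hev
      -- Only multiples of `k` can serve as times, because it is `T^[k]` that is assumed to preserve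
      -- `μ`; `1 ≤ k` gives `N ≤ k * N`.
      have hN' := hN (k * N) (by nlinarith)
      have e1 : μ.real E = μ.real (T^[k * N] ⁻¹' E) := by
        rw [Function.iterate_mul]
        simp only [Measure.real]
        rw [(hinv.iterate N).measure_preimage hE.nullMeasurableSet]
      have e2 := hdiff _ (hTm.iterate (k * N) hE)
      rw [← e1, setIntegral_iterate_transfer hS hab hB₁ hw₁ hTm hT (k * N) hE] at e2
      have e3 := norm_setIntegral_sub_le hab (inter_subset_right (s := E))
        ((hw₁.iterate_transfer hB₁ (k * N)).integrableOn hab)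
        (hhi.const_mul (∫ y in Ioo a b, w y)) (hr (k * N))
      rw [integral_const_mul] at e3
      have e4 := hdiff univ .univ
      rw [univ_inter] at e4
      set X := ∫ x in E ∩ Ioo a b, h x
      set W := ∫ y in Ioo a b, w y
      have e5 : |W * X - μ.real univ * X| ≤ ε := by
        rw [← sub_mul, abs_mul, abs_of_nonneg hEh0, abs_sub_comm]
        nlinarith [abs_nonneg (μ.real univ - W)]
      rw [abs_le] at *
      constructor <;> linarith
    have h0 : |μ.real E - μ.real univ * ∫ x in E ∩ Ioo a b, h x| ≤ 0 := by
      refine le_of_forall_pos_le_add fun ε hε => ?_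
      have := hbound (ε / 3) (by positivity)
      linarith
    linarith [abs_eq_zero.1 (le_antisymm h0 (abs_nonneg _))]
  refine Measure.ext fun E hE => ?_
  rw [Measure.smul_apply, withDensity_apply _ hE, Measure.restrict_restrict hE, smul_eq_mul,
    ← ofReal_integral_eq_lintegral_ofReal (hhi.mono_set inter_subset_right)
      ((ae_restrict_iff' (hE.inter measurableSet_Ioo)).2
        (.of_forall fun x hx => (hh.logLip.pos x hx.2).le)),
    ← ENNReal.ofReal_toReal (measure_ne_top μ E), ← ENNReal.ofReal_toReal (measure_ne_top μ univ),
    ← ENNReal.ofReal_mul ENNReal.toReal_nonneg]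
  exact congrArg _ (hmain E hE)

end WeightedIFS
namespace WeightedIFS

variable {ι : Type*} {a b : ℝ}

/-! ### Random compositions of the fibre maps -/

/-- The law of the `n`-fold composition of fibre maps `ψ_c`, applied to `y₀`, over the point `x`:
the branches are chosen according to the weights along the backward orbit of `x`. -/
def fibreLaw (S : WeightedIFS ι a b) {X : Type*} [MeasurableSpace X] (ψ : ι → X → X) (y₀ : X) :
    ℕ → ℝ → Measure X
  | 0, _ => Measure.dirac y₀
  | n + 1, x => Measure.sum fun c =>
      ENNReal.ofReal (S.w c x) • (fibreLaw S ψ y₀ n (S.φ c x)).map (ψ c)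

/-- After `k` applications of the fibre maps the function `v` varies by at most `ε`. -/
def OscLE {X : Type*} (ψ : ι → X → X) (ε : ℝ) : ℕ → (X → ℝ) → Prop
  | 0, v => ∀ y y', |v y - v y'| ≤ ε
  | k + 1, v => ∀ c, OscLE ψ ε k (v ∘ ψ c)

lemma oscLE_of_forall_list {X : Type*} {ψ : ι → X → X} {ε : ℝ} {k : ℕ} {v : X → ℝ}
    (h : ∀ l : List ι, l.length = k → ∀ y y',
      |v (l.foldr ψ y) - v (l.foldr ψ y')| ≤ ε) : OscLE ψ ε k v := by
  induction k generalizing v with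
  | zero => exact h [] rfl
  -- `foldr` applies the head of the list last, and `OscLE` peels off the outermost map first, so
  -- the new letter goes to the head.
  | succ k ih => exact fun c => ih fun l hl y y' => h (c :: l) (by simp [hl]) y y'

variable {S : WeightedIFS ι a b} {X : Type*} [MeasurableSpace X] {ψ : ι → X → X} {y₀ : X}
  {v : X → ℝ} {B : ℝ}

lemma isProbabilityMeasure_fibreLaw (h1 : ∀ x ∈ Ioo a b, HasSum (fun c => S.w c x) 1)
    (hψ : ∀ c, Measurable (ψ c)) (n : ℕ) {x : ℝ} (hx : x ∈ Ioo a b) :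
    IsProbabilityMeasure (S.fibreLaw ψ y₀ n x) := by
  induction n generalizing x with
  | zero => rw [fibreLaw]; infer_instance
  | succ n ih =>
    refine ⟨?_⟩
    rw [fibreLaw, Measure.sum_apply _ .univ]
    have : ∀ c, (ENNReal.ofReal (S.w c x) • (S.fibreLaw ψ y₀ n (S.φ c x)).map (ψ c)) univ =
        ENNReal.ofReal (S.w c x) := by
      intro c
      have := ih (S.mapsTo c hx)
      rw [Measure.smul_apply, Measure.map_apply (hψ c) .univ, preimage_univ, measure_univ,
        smul_eq_mul, mul_one]
    simp only [this]
    rw [← ENNReal.ofReal_tsum_of_nonneg (fun c => (S.w_pos c x hx).le) (h1 x hx).summable,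
      (h1 x hx).tsum_eq, ENNReal.ofReal_one]

lemma integrable_of_bdd {μ : Measure X} [IsFiniteMeasure μ] (hv : Measurable v)
    (hB : ∀ y, |v y| ≤ B) : Integrable v μ :=
  Integrable.of_bound hv.aestronglyMeasurable B (.of_forall hB)

lemma abs_integral_le_of_bdd {μ : Measure X} [IsProbabilityMeasure μ] (hB : ∀ y, |v y| ≤ B) :
    |∫ y, v y ∂μ| ≤ B := by
  have := norm_integral_le_of_norm_le_const (μ := μ) (f := v) (C := B) (.of_forall hB)
  simpa using this

/-- Expresses the recursion of the laws through `op`, so that the `C¹` calculus of weighted sums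
applies to the averages. -/
lemma integral_fibreLaw_succ (h1 : ∀ x ∈ Ioo a b, HasSum (fun c => S.w c x) 1)
    (hψ : ∀ c, Measurable (ψ c)) (hv : Measurable v) (hB : ∀ y, |v y| ≤ B) (n : ℕ) {x : ℝ}
    (hx : x ∈ Ioo a b) :
    ∫ y, v y ∂S.fibreLaw ψ y₀ (n + 1) x =
      S.op (fun c x' => ∫ y, (v ∘ ψ c) y ∂S.fibreLaw ψ y₀ n x') x := by
  have := isProbabilityMeasure_fibreLaw (y₀ := y₀) h1 hψ (n + 1) hx
  have hs := hasSum_integral_measure (f := v) (μ := fun c =>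
    ENNReal.ofReal (S.w c x) • (S.fibreLaw ψ y₀ n (S.φ c x)).map (ψ c))
    (integrable_of_bdd (μ := S.fibreLaw ψ y₀ (n + 1) x) hv hB)
  rw [show S.fibreLaw ψ y₀ (n + 1) x = Measure.sum fun c =>
      ENNReal.ofReal (S.w c x) • (S.fibreLaw ψ y₀ n (S.φ c x)).map (ψ c) from rfl, ← hs.tsum_eq, op]
  refine tsum_congr fun c => ?_
  rw [integral_smul_measure, ENNReal.toReal_ofReal (S.w_pos c x hx).le, smul_eq_mul,
    integral_map (hψ c).aemeasurable hv.aestronglyMeasurable]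
  rfl

/-- The bound on the logarithmic derivative of arbitrarily long products of weights. -/
def distortion (S : WeightedIFS ι a b) : ℝ := S.K / (1 - S.lam)

lemma distortion_nonneg : 0 ≤ S.distortion :=
  div_nonneg S.K_nonneg (sub_nonneg.2 S.lam_lt_one.le)

/-- The distortion is the fixed point of `D ↦ K + lam * D`; this is why the derivative bounds do not
deteriorate with the number of compositions. -/
lemma K_add_distortion : S.K + S.lam * S.distortion = S.distortion := by
  have : 1 - S.lam ≠ 0 := (sub_pos.2 S.lam_lt_one).ne'
  unfold distortion
  field_simp
  ring

/-- Induction on `n`, simultaneously for all `v`. As the weights sum to one, the bound `distortion *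
B` on the inner averages reproduces itself by `K_add_distortion`. -/
lemma fibreLaw_isC1 (h1 : ∀ x ∈ Ioo a b, HasSum (fun c => S.w c x) 1)
    (hψ : ∀ c, Measurable (ψ c)) (n : ℕ) (hv : Measurable v) (hB : ∀ y, |v y| ≤ B) :
    IsC1 (Ioo a b) (fun x => ∫ y, v y ∂S.fibreLaw ψ y₀ n x) ∧
      ∀ x ∈ Ioo a b, |deriv (fun x => ∫ y, v y ∂S.fibreLaw ψ y₀ n x) x| ≤ S.distortion * B := by
  have hB0 : 0 ≤ B := (abs_nonneg _).trans (hB y₀)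
  induction n generalizing v with
  | zero =>
    simp only [fibreLaw]
    refine ⟨⟨fun _ _ => differentiableAt_const _, by simpa using! continuousOn_const⟩,
      fun x _ => ?_⟩
    simpa using mul_nonneg distortion_nonneg hB0
  | succ n ih =>
    set u : ι → ℝ → ℝ := fun c x' => ∫ y, (v ∘ ψ c) y ∂S.fibreLaw ψ y₀ n x' with hu
    have heq : EqOn (fun x => ∫ y, v y ∂S.fibreLaw ψ y₀ (n + 1) x) (S.op u) (Ioo a b) :=
      fun x hx => integral_fibreLaw_succ h1 hψ hv hB n hx
    have hih := fun c => ih (v := v ∘ ψ c) (hv.comp (hψ c)) (fun y => hB _)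
    have huB : ∀ c, ∀ x ∈ Ioo a b, |u c x| ≤ B := fun c x hx => by
      have := isProbabilityMeasure_fibreLaw (y₀ := y₀) h1 hψ n hx
      exact abs_integral_le_of_bdd fun y => hB _
    refine ⟨(isC1_op (fun c => (hih c).1) huB fun c => (hih c).2).congr heq, fun x hx => ?_⟩
    rw [deriv_congr_Ioo heq hx,
      (hasDerivAt_op (fun c => (hih c).1) huB (fun c => (hih c).2) hx).deriv, ← Real.norm_eq_abs]
    have hs := (h1 x hx).mul_right (S.K * B + S.lam * (S.distortion * B))
    have e : 1 * (S.K * B + S.lam * (S.distortion * B)) = S.distortion * B := by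
      linear_combination B * K_add_distortion (S := S)
    rw [e] at hs
    exact tsum_of_norm_bounded hs fun c => abs_dterm_le_bound huB (fun c => (hih c).2) c hx

/-- Induction on `k`. For `k = 0` the bounds of `fibreLaw_isC1` are applied to `v - v y₀`, which is
at most `ε`, once for each law. In the inductive step the two recursions have the same weights, so
their difference is a weighted sum of earlier differences and inherits both bounds. -/
lemma fibreLaw_cauchy (h1 : ∀ x ∈ Ioo a b, HasSum (fun c => S.w c x) 1)
    (hψ : ∀ c, Measurable (ψ c)) {ε : ℝ} {k n m : ℕ} (hv : Measurable v) (hB : ∀ y, |v y| ≤ B)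
    (hosc : OscLE ψ ε k v) (hn : k ≤ n) (hm : k ≤ m) {x : ℝ} (hx : x ∈ Ioo a b) :
    |(∫ y, v y ∂S.fibreLaw ψ y₀ n x) - ∫ y, v y ∂S.fibreLaw ψ y₀ m x| ≤ 2 * ε ∧
    |deriv (fun x => ∫ y, v y ∂S.fibreLaw ψ y₀ n x) x -
      deriv (fun x => ∫ y, v y ∂S.fibreLaw ψ y₀ m x) x| ≤ S.distortion * (2 * ε) := by
  induction k generalizing v n m x with
  | zero =>
    have hw : Measurable fun y => v y - v y₀ := hv.sub_const _
    have hwB : ∀ y, |v y - v y₀| ≤ ε := fun y => hosc y y₀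
    have heq : ∀ j, EqOn (fun x => ∫ y, v y ∂S.fibreLaw ψ y₀ j x)
        (fun x => (∫ y, (v y - v y₀) ∂S.fibreLaw ψ y₀ j x) + v y₀) (Ioo a b) := fun j x hx => by
      have := isProbabilityMeasure_fibreLaw (y₀ := y₀) h1 hψ j hx
      simp only
      rw [integral_sub (integrable_of_bdd hv hB) (integrable_const _)]
      simp
    have hb : ∀ j, |∫ y, (v y - v y₀) ∂S.fibreLaw ψ y₀ j x| ≤ ε := fun j => by
      have := isProbabilityMeasure_fibreLaw (y₀ := y₀) h1 hψ j hx
      exact abs_integral_le_of_bdd hwB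
    have hd : ∀ j, |deriv (fun x => ∫ y, v y ∂S.fibreLaw ψ y₀ j x) x| ≤ S.distortion * ε := by
      intro j
      rw [deriv_congr_Ioo (heq j) hx, deriv_add_const]
      exact (fibreLaw_isC1 h1 hψ j hw hwB).2 x hx
    constructor
    · have e1 := heq n hx
      have e2 := heq m hx
      simp only at e1 e2
      have := abs_le.1 (hb n)
      have := abs_le.1 (hb m)
      rw [e1, e2, abs_le]
      constructor <;> linarith
    · have := abs_le.1 (hd n)
      have := abs_le.1 (hd m)
      rw [abs_le]
      constructor <;> linarith
  | succ k ih =>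
    obtain ⟨n, rfl⟩ : ∃ j, n = j + 1 := ⟨n - 1, by omega⟩
    obtain ⟨m, rfl⟩ : ∃ j, m = j + 1 := ⟨m - 1, by omega⟩
    set u : ℕ → ι → ℝ → ℝ := fun j c x' => ∫ y, (v ∘ ψ c) y ∂S.fibreLaw ψ y₀ j x' with hu
    have heq : ∀ j, EqOn (fun x => ∫ y, v y ∂S.fibreLaw ψ y₀ (j + 1) x) (S.op (u j)) (Ioo a b) :=
      fun j x hx => integral_fibreLaw_succ h1 hψ hv hB j hx
    have hC1 := fun j c => fibreLaw_isC1 (y₀ := y₀) (v := v ∘ ψ c) h1 hψ j (hv.comp (hψ c))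
      (fun y => hB _)
    have huB : ∀ j c, ∀ x ∈ Ioo a b, |u j c x| ≤ B := fun j c x hx => by
      have := isProbabilityMeasure_fibreLaw (y₀ := y₀) h1 hψ j hx
      exact abs_integral_le_of_bdd fun y => hB _
    have hih := fun c {x'} (hx' : x' ∈ Ioo a b) => ih (v := v ∘ ψ c) (n := n) (m := m)
      (hv.comp (hψ c)) (fun y => hB _) (hosc c) (by omega) (by omega) hx'
    constructor
    · have e1 := heq n hx
      have e2 := heq m hx
      simp only at e1 e2
      rw [e1, e2, op, op, ← (summable_op (huB n) hx).tsum_sub (summable_op (huB m) hx),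
        ← Real.norm_eq_abs]
      have hs := (h1 x hx).mul_right (2 * ε)
      rw [one_mul] at hs
      refine tsum_of_norm_bounded hs fun c => ?_
      rw [← mul_sub, Real.norm_eq_abs, abs_mul, abs_of_pos (S.w_pos c x hx)]
      exact mul_le_mul_of_nonneg_left (hih c (S.mapsTo c hx)).1 (S.w_pos c x hx).le
    · rw [deriv_congr_Ioo (heq n) hx, deriv_congr_Ioo (heq m) hx,
        (hasDerivAt_op (fun c => (hC1 n c).1) (huB n) (fun c => (hC1 n c).2) hx).deriv,
        (hasDerivAt_op (fun c => (hC1 m c).1) (huB m) (fun c => (hC1 m c).2) hx).deriv, dop, dop,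
        ← (summable_dop (huB n) (fun c => (hC1 n c).2) hx).tsum_sub
          (summable_dop (huB m) (fun c => (hC1 m c).2) hx), ← Real.norm_eq_abs]
      have hs := (h1 x hx).mul_right (S.K * (2 * ε) + S.lam * (S.distortion * (2 * ε)))
      have e : 1 * (S.K * (2 * ε) + S.lam * (S.distortion * (2 * ε))) =
          S.distortion * (2 * ε) := by
        linear_combination (2 * ε) * K_add_distortion (S := S)
      rw [e] at hs
      refine tsum_of_norm_bounded hs fun c => ?_
      have hφ := S.mapsTo c hx
      obtain ⟨g1, g2⟩ := hih c hφ
      have e1 : S.w' c x * u n c (S.φ c x) + S.w c x * (deriv (u n c) (S.φ c x) * S.p c x) -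
          (S.w' c x * u m c (S.φ c x) + S.w c x * (deriv (u m c) (S.φ c x) * S.p c x)) =
          S.w' c x * (u n c (S.φ c x) - u m c (S.φ c x)) +
          S.w c x * ((deriv (u n c) (S.φ c x) - deriv (u m c) (S.φ c x)) * S.p c x) := by ring
      rw [e1, Real.norm_eq_abs]
      refine (abs_add_le _ _).trans ?_
      rw [abs_mul, abs_mul, abs_mul, abs_of_pos (S.w_pos c x hx), abs_of_pos (S.p_pos c x hx),
        mul_add]
      have hw := (S.w_pos c x hx).le
      refine add_le_add ?_ (mul_le_mul_of_nonneg_left ?_ hw)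
      · calc _ ≤ (S.K * S.w c x) * (2 * ε) := mul_le_mul (S.abs_w'_le c x hx) g1 (abs_nonneg _)
              (mul_nonneg S.K_nonneg hw)
          _ = _ := by ring
      · calc _ ≤ (S.distortion * (2 * ε)) * S.lam := mul_le_mul g2 (S.p_le c x hx)
              (S.p_pos c x hx).le ((abs_nonneg _).trans g2)
          _ = _ := by ring

end WeightedIFS
-- Limits of the fibre laws, and normalisation of the weights.
namespace WeightedIFS

variable {ι : Type*} {a b : ℝ} {S : WeightedIFS ι a b}

section Limit

variable {X : Type*} [PseudoMetricSpace X] [T2Space X] [MeasurableSpace X] [BorelSpace X]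
  {ψ : ι → X → X} {y₀ : X} {v : X → ℝ} {B : ℝ}

/-- The outermost branch is drawn with weights `S.w c x` whatever `n ≥ 1` is. Finitely many branches
carry all but `ε` of the weight, and each has its range in a compact set. The point `y₀` takes care
of `n = 0`. -/
lemma isTightMeasureSet_fibreLaw [Countable ι] (h1 : ∀ x ∈ Ioo a b, HasSum (fun c => S.w c x) 1)
    (hψ : ∀ c, Measurable (ψ c)) (hc : ∀ c, ∃ K, IsCompact K ∧ range (ψ c) ⊆ K) {x : ℝ}
    (hx : x ∈ Ioo a b) : IsTightMeasureSet {μ | ∃ n, S.fibreLaw ψ y₀ n x = μ} := by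
  rw [isTightMeasureSet_iff_exists_isCompact_measure_compl_le]
  intro ε hε
  choose Kc hKc hKr using hc
  have hsum : ∑' c, ENNReal.ofReal (S.w c x) ≠ ⊤ := by
    rw [← ENNReal.ofReal_tsum_of_nonneg (fun c => (S.w_pos c x hx).le) (h1 x hx).summable]
    exact ENNReal.ofReal_ne_top
  obtain ⟨s, hs⟩ := ((ENNReal.tendsto_tsum_compl_atTop_zero hsum).eventually
    (ge_mem_nhds hε)).exists
  set K : Set X := {y₀} ∪ ⋃ c ∈ s, Kc c with hK
  have hKcomp : IsCompact K := isCompact_singleton.union (s.isCompact_biUnion fun c _ => hKc c)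
  refine ⟨K, hKcomp, ?_⟩
  have hKm : MeasurableSet Kᶜ := hKcomp.isClosed.measurableSet.compl
  rintro _ ⟨n, rfl⟩
  cases n with
  | zero =>
    rw [fibreLaw, Measure.dirac_apply' _ hKm, indicator_of_notMem (by simp [hK])]
    exact zero_le
  | succ n =>
    rw [fibreLaw, Measure.sum_apply _ hKm]
    have hterm : ∀ c, (ENNReal.ofReal (S.w c x) • (S.fibreLaw ψ y₀ n (S.φ c x)).map (ψ c)) Kᶜ ≤
        indicator {c | c ∉ s} (fun c => ENNReal.ofReal (S.w c x)) c := by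
      intro c
      have := isProbabilityMeasure_fibreLaw (y₀ := y₀) h1 hψ n (S.mapsTo c hx)
      rw [Measure.smul_apply, Measure.map_apply (hψ c) hKm, smul_eq_mul]
      by_cases hcs : c ∈ s
      · have : ψ c ⁻¹' Kᶜ = ∅ := by
          ext y
          simp only [mem_preimage, mem_compl_iff, mem_empty_iff_false, iff_false, not_not, hK]
          exact Or.inr (mem_biUnion hcs (hKr c (mem_range_self y)))
        simp [this]
      · rw [indicator_of_mem (show c ∈ {c | c ∉ s} from hcs)]
        exact mul_le_of_le_one_right zero_le prob_le_one
    refine (ENNReal.tsum_le_tsum hterm).trans ?_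
    rw [← tsum_subtype]
    exact hs

/-- Over every base point the laws of long random compositions of the fibre maps converge. -/
theorem exists_limitLaw [Countable ι] (h1 : ∀ x ∈ Ioo a b, HasSum (fun c => S.w c x) 1)
    (hψ : ∀ c, Measurable (ψ c)) (hc : ∀ c, ∃ K, IsCompact K ∧ range (ψ c) ⊆ K)
    (hcontr : ∀ ε > 0, ∃ k, ∀ l : List ι, l.length = k → ∀ y y',
      dist (l.foldr ψ y) (l.foldr ψ y') ≤ ε) (y₀ : X) :
    ∃ η : ℝ → Measure X, (∀ x, IsProbabilityMeasure (η x)) ∧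
      ∀ (v : X → ℝ) (B : ℝ), UniformContinuous v → (∀ y, |v y| ≤ B) →
        (∀ x ∈ Ioo a b, Tendsto (fun n => ∫ y, v y ∂S.fibreLaw ψ y₀ n x) atTop
          (𝓝 (∫ y, v y ∂η x))) ∧
        IsC1 (Ioo a b) (fun x => ∫ y, v y ∂η x) ∧
        ∀ x ∈ Ioo a b, |deriv (fun x => ∫ y, v y ∂η x) x| ≤ S.distortion * B := by
  have hosc : ∀ v : X → ℝ, UniformContinuous v → ∀ ε > 0, ∃ k, OscLE ψ ε k v := by
    intro v hv ε hε
    obtain ⟨δ, hδ, hvδ⟩ := Metric.uniformContinuous_iff.1 hv ε hε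
    obtain ⟨k, hk⟩ := hcontr (δ / 2) (half_pos hδ)
    exact ⟨k, oscLE_of_forall_list fun l hl y y' =>
      (hvδ ((hk l hl y y').trans_lt (half_lt_self hδ))).le⟩
  have hlim : ∀ v : X → ℝ, ∀ B : ℝ, UniformContinuous v → (∀ y, |v y| ≤ B) →
      ∃ g : ℝ → ℝ, IsC1 (Ioo a b) g ∧
        (∀ x ∈ Ioo a b, Tendsto (fun n => ∫ y, v y ∂S.fibreLaw ψ y₀ n x) atTop (𝓝 (g x))) ∧
        ∀ x ∈ Ioo a b, |deriv g x| ≤ S.distortion * B := by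
    intro v B hv hB
    have hD := distortion_nonneg (S := S)
    -- The oscillation `ε'` is chosen so that both `2 * ε'` and `distortion * (2 * ε')`, the bounds
    -- of `fibreLaw_cauchy`, are at most `1 / (j + 1)`.
    have hex : ∀ j : ℕ, ∃ k, OscLE ψ (1 / (2 * (1 + S.distortion)) / ((j : ℝ) + 1)) k v :=
      fun j => hosc v hv _ (by positivity)
    choose k hk using hex
    -- pass to indices along which consecutive moduli are controlled
    have hC1 := fun n => fibreLaw_isC1 (y₀ := y₀) h1 hψ n hv.continuous.measurable hB
    set Q : ℕ → ℕ := fun j => ∑ i ∈ Finset.range (j + 1), k i with hQ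
    have hQmono : Monotone Q := fun i j hij =>
      Finset.sum_le_sum_of_subset (Finset.range_mono (by omega))
    have hkQ : ∀ j, k j ≤ Q j := fun j =>
      Finset.single_le_sum (f := k) (fun _ _ => Nat.zero_le _) (Finset.mem_range.2 (by omega))
    have hcau : ∀ j n m, k j ≤ n → k j ≤ m → ∀ x ∈ Ioo a b,
        |(∫ y, v y ∂S.fibreLaw ψ y₀ n x) - ∫ y, v y ∂S.fibreLaw ψ y₀ m x| ≤ 1 / ((j : ℝ) + 1) ∧
        |deriv (fun x => ∫ y, v y ∂S.fibreLaw ψ y₀ n x) x -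
          deriv (fun x => ∫ y, v y ∂S.fibreLaw ψ y₀ m x) x| ≤ 1 / ((j : ℝ) + 1) := by
      intro j n m hn hm x hx
      obtain ⟨g1, g2⟩ :=
        fibreLaw_cauchy (y₀ := y₀) h1 hψ hv.continuous.measurable hB (hk j) hn hm hx
      have e1 : 2 * (1 / (2 * (1 + S.distortion)) / ((j : ℝ) + 1)) ≤ 1 / ((j : ℝ) + 1) := by
        rw [div_div, mul_one_div, div_le_div_iff₀ (by positivity) (by positivity)]
        have : (0 : ℝ) ≤ (j : ℝ) + 1 := by positivity
        nlinarith [mul_nonneg hD this]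
      have e2 : S.distortion * (2 * (1 / (2 * (1 + S.distortion)) / ((j : ℝ) + 1))) ≤
          1 / ((j : ℝ) + 1) := by
        rw [div_div, mul_one_div, mul_div_assoc',
          div_le_div_iff₀ (by positivity) (by positivity)]
        have : (0 : ℝ) ≤ (j : ℝ) + 1 := by positivity
        nlinarith [mul_nonneg hD this]
      exact ⟨g1.trans e1, g2.trans e2⟩
    obtain ⟨g, hg1, hg2, hg3, -⟩ := exists_isC1_limit (a := a) (b := b)
      (H := fun j x => ∫ y, v y ∂S.fibreLaw ψ y₀ (Q j) x) (fun j => (hC1 _).1)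
      tendsto_one_div_add_atTop_nhds_zero_nat (fun j n m hn hm x hx =>
        hcau j _ _ ((hkQ j).trans (hQmono hn)) ((hkQ j).trans (hQmono hm)) x hx)
    refine ⟨g, hg1, fun x hx => ?_, fun x hx =>
      le_of_tendsto' (hg3 x hx).abs fun j => (hC1 _).2 x hx⟩
    have hCau : CauchySeq fun n => ∫ y, v y ∂S.fibreLaw ψ y₀ n x := by
      rw [Metric.cauchySeq_iff']
      intro ε hε
      obtain ⟨j, hj⟩ := exists_nat_one_div_lt hε
      exact ⟨k j, fun n hn => (hcau j n (k j) hn le_rfl x hx).1.trans_lt hj⟩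
    obtain ⟨l, hl⟩ := cauchySeq_tendsto_of_complete hCau
    -- `Q` need not be unbounded, so the limit along `Q` is not known to be a subsequential limit;
    -- it is compared with `l` through the moduli `k j`.
    have : g x = l := by
      refine tendsto_nhds_unique (hg2 x hx) ?_
      rw [Metric.tendsto_atTop]
      intro ε hε
      obtain ⟨j, hj⟩ := exists_nat_one_div_lt hε
      refine ⟨j, fun i hi => lt_of_le_of_lt ?_ hj⟩
      exact le_of_tendsto (tendsto_const_nhds.dist hl) (eventually_atTop.2 ⟨k j, fun m hm =>
        (hcau j _ m ((hkQ j).trans (hQmono hi)) hm x hx).1⟩)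
    rw [this]; exact hl
  -- `X` is neither assumed compact nor complete, so the limiting measure comes from tightness: by
  -- Prokhorov the laws converge along an ultrafilter. Averages of uniformly continuous functions
  -- converge already, so they converge to the integrals against this measure. Off the interval any
  -- probability measure will do.
  have hη : ∀ x, ∃ μ : Measure X, IsProbabilityMeasure μ ∧ (x ∈ Ioo a b →
      ∀ (v : X → ℝ) (B : ℝ), UniformContinuous v → (∀ y, |v y| ≤ B) →
        Tendsto (fun n => ∫ y, v y ∂S.fibreLaw ψ y₀ n x) atTop (𝓝 (∫ y, v y ∂μ))) := by
    intro x
    by_cases hx : x ∈ Ioo a b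
    swap
    · exact ⟨Measure.dirac y₀, inferInstance, fun h => (hx h).elim⟩
    let P : ℕ → ProbabilityMeasure X := fun n =>
      ⟨S.fibreLaw ψ y₀ n x, isProbabilityMeasure_fibreLaw h1 hψ n hx⟩
    have htight : IsTightMeasureSet {((μ : ProbabilityMeasure X) : Measure X) | μ ∈ range P} := by
      refine (isTightMeasureSet_fibreLaw (y₀ := y₀) h1 hψ hc hx).subset ?_
      rintro _ ⟨_, ⟨n, rfl⟩, rfl⟩
      exact ⟨n, rfl⟩
    obtain ⟨μ, -, hμ⟩ := (isCompact_closure_of_isTightMeasureSet htight).ultrafilter_le_nhds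
      ((hyperfilter ℕ).map P) (by
        rw [le_principal_iff]
        exact mem_map.2 (univ_mem' fun n => subset_closure (mem_range_self n)))
    refine ⟨μ, inferInstance, fun _ v B hv hB => ?_⟩
    obtain ⟨g, -, hg, -⟩ := hlim v B hv hB
    have h2 : Tendsto P (hyperfilter ℕ) (𝓝 μ) := hμ
    rw [ProbabilityMeasure.tendsto_iff_forall_integral_tendsto] at h2
    have h3 := h2 (BoundedContinuousFunction.ofNormedAddCommGroup v hv.continuous B hB)
    have h4 := (hg x hx).mono_left Nat.hyperfilter_le_atTop
    have h5 : g x = ∫ y, v y ∂(μ : Measure X) := tendsto_nhds_unique h4 h3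
    rw [← h5]
    exact hg x hx
  choose η hη1 hη2 using hη
  refine ⟨η, hη1, fun v B hv hB => ⟨fun x hx => hη2 x hx v B hv hB, ?_⟩⟩
  obtain ⟨g, hg1, hg2, hg3⟩ := hlim v B hv hB
  have heq : EqOn (fun x => ∫ y, v y ∂η x) g (Ioo a b) := fun x hx =>
    tendsto_nhds_unique (hη2 x hx v B hv hB) (hg2 x hx)
  refine ⟨hg1.congr heq, fun x hx => ?_⟩
  rw [deriv_congr_Ioo heq hx]
  exact hg3 x hx

end Limit

/-- The system with the weights normalised by the invariant density. -/
def normalized (S : WeightedIFS ι a b) {B : ℝ} {h : ℝ → ℝ} (hh : LogLip a b B h) (hab : a < b) :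
    WeightedIFS ι a b where
  φ := S.φ
  p := S.p
  w c x := S.w c x * h (S.φ c x) / h x
  w' c x := ((S.w' c x * h (S.φ c x) + S.w c x * (deriv h (S.φ c x) * S.p c x)) * h x -
    S.w c x * h (S.φ c x) * deriv h x) / h x ^ 2
  -- Harnack bounds `h (φ c x) / h x` by the exponential. In `K + 2 * B`, one `B` comes from the
  -- derivative of `h ∘ φ`, since `p ≤ 1`, and the other from that of `1 / h`.
  M c := S.M c * Real.exp (B * (b - a))
  K := S.K + 2 * B
  lam := S.lam
  mapsTo := S.mapsTo
  hasDerivAt_φ := S.hasDerivAt_φ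
  continuousOn_p := S.continuousOn_p
  p_pos := S.p_pos
  p_le := S.p_le
  lam_pos := S.lam_pos
  lam_lt_one := S.lam_lt_one
  hasDerivAt_w c x hx := ((S.hasDerivAt_w c x hx).mul
    ((hh.isC1.diff _ (S.mapsTo c hx)).hasDerivAt.comp x (S.hasDerivAt_φ c x hx))).div
    (hh.isC1.diff x hx).hasDerivAt (hh.pos x hx).ne'
  continuousOn_w' c := by
    have hφ := continuousOn_φ (S := S) c
    have h1 := hh.isC1.continuousOn
    have h2 := h1.comp hφ (S.mapsTo c)
    have h3 := hh.isC1.cont.comp hφ (S.mapsTo c)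
    have h4 := continuousOn_w (S := S) c
    exact (((((S.continuousOn_w' c).mul h2).add (h4.mul (h3.mul (S.continuousOn_p c)))).mul
      h1).sub ((h4.mul h2).mul hh.isC1.cont)).div (h1.pow 2)
      fun x hx => (pow_pos (hh.pos x hx) 2).ne'
  w_pos c x hx := div_pos (mul_pos (S.w_pos c x hx) (hh.pos _ (S.mapsTo c hx))) (hh.pos x hx)
  w_le c x hx := by
    rw [div_le_iff₀ (hh.pos x hx), mul_assoc]
    exact mul_le_mul (S.w_le c x hx) (hh.le_exp_mul (S.mapsTo c hx) hx)
      (hh.pos _ (S.mapsTo c hx)).le ((S.w_pos c x hx).le.trans (S.w_le c x hx))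
  summable_M := S.summable_M.mul_right _
  K_nonneg := by
    have := hh.B_nonneg hab
    have := S.K_nonneg
    positivity
  abs_w'_le c x hx := by
    have hB := hh.B_nonneg hab
    have hx0 := hh.pos x hx
    have hφ := S.mapsTo c hx
    have hφ0 := hh.pos _ hφ
    have hw := S.w_pos c x hx
    have g1 := S.abs_w'_le c x hx
    have g2 := hh.abs_deriv_le x hx
    have g3 := hh.abs_deriv_le _ hφ
    have hp1 : S.p c x ≤ 1 := (S.p_le c x hx).trans S.lam_lt_one.le
    have hp0 := S.p_pos c x hx
    have e1 : |S.w' c x * h (S.φ c x) * h x| ≤ S.K * S.w c x * h (S.φ c x) * h x := by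
      rw [abs_mul, abs_mul, abs_of_pos hφ0, abs_of_pos hx0]
      gcongr
    have e2 : |S.w c x * (deriv h (S.φ c x) * S.p c x) * h x| ≤
        S.w c x * (B * h (S.φ c x) * 1) * h x := by
      rw [abs_mul, abs_mul, abs_mul, abs_of_pos hw, abs_of_pos hp0, abs_of_pos hx0]
      gcongr
    have e3 : |S.w c x * h (S.φ c x) * deriv h x| ≤ S.w c x * h (S.φ c x) * (B * h x) := by
      rw [abs_mul, abs_mul, abs_of_pos hw, abs_of_pos hφ0]
      gcongr
    rw [abs_div, abs_of_pos (pow_pos hx0 2), div_le_iff₀ (pow_pos hx0 2)]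
    have e4 : (S.K + 2 * B) * (S.w c x * h (S.φ c x) / h x) * h x ^ 2 =
        S.K * S.w c x * h (S.φ c x) * h x + S.w c x * (B * h (S.φ c x) * 1) * h x +
          S.w c x * h (S.φ c x) * (B * h x) := by
      field_simp; ring
    rw [e4, abs_le]
    rw [abs_le] at e1 e2 e3
    constructor <;> nlinarith

/-- This is the fixed point equation of the transfer operator, divided by `h`. -/
lemma IsInvariantDensity.hasSum_normalized {B : ℝ} {h : ℝ → ℝ} (hh : S.IsInvariantDensity B h)
    (hab : a < b) : ∀ x ∈ Ioo a b, HasSum (fun c => (S.normalized hh.logLip hab).w c x) 1 := by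
  intro x hx
  obtain ⟨C, hC⟩ := hh.logLip.bdd_abs
  have h1 : HasSum (fun c => S.w c x * h (S.φ c x)) (S.transfer h x) :=
    (summable_op (u := fun _ => h) (fun _ => hC) hx).hasSum
  rw [hh.fixed hx] at h1
  have h2 := h1.div_const (h x)
  rwa [div_self (hh.logLip.pos x hx).ne'] at h2

end WeightedIFS
-- Duality between the skew product and the fibre laws.
namespace WeightedIFS

variable {ι : Type*} {a b : ℝ} {S : WeightedIFS ι a b}

/-- Stated on the subtype because the weights and branches are only controlled on the interval. -/
lemma measurable_fibreLaw [Countable ι] {X : Type*} [MeasurableSpace X] {ψ : ι → X → X}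
    (hψ : ∀ c, Measurable (ψ c)) (y₀ : X) (n : ℕ) :
    Measurable fun x : Ioo a b => S.fibreLaw ψ y₀ n x := by
  induction n with
  | zero => exact measurable_const
  | succ n ih =>
    refine Measure.measurable_of_measurable_coe _ fun E hE => ?_
    have : (fun x : Ioo a b => S.fibreLaw ψ y₀ (n + 1) x E) = fun x : Ioo a b =>
        ∑' c, ENNReal.ofReal (S.w c x) * S.fibreLaw ψ y₀ n (S.φ c x) (ψ c ⁻¹' E) := by
      funext x
      rw [fibreLaw, Measure.sum_apply _ hE]
      exact tsum_congr fun c => by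
        rw [Measure.smul_apply, Measure.map_apply (hψ c) hE, smul_eq_mul]
    rw [this]
    refine Measurable.tsum fun c => ?_
    have hw : Measurable fun x : Ioo a b => S.w c x :=
      (continuousOn_iff_continuous_domRestrict.1 (continuousOn_w c)).measurable
    have hφ : Measurable fun x : Ioo a b => (⟨S.φ c x, S.mapsTo c x.2⟩ : Ioo a b) :=
      (continuousOn_iff_continuous_domRestrict.1 (continuousOn_φ c)).measurable.subtype_mk
    exact hw.ennreal_ofReal.mul ((Measure.measurable_coe (hψ c hE)).comp (ih.comp hφ))

lemma measurable_lintegral_fibreLaw [Countable ι] {X : Type*} [MeasurableSpace X] {ψ : ι → X → X}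
    (h1 : ∀ x ∈ Ioo a b, HasSum (fun c => S.w c x) 1) (hψ : ∀ c, Measurable (ψ c)) (y₀ : X)
    (n : ℕ) {V : ℝ → X → ENNReal} (hV : Measurable (Function.uncurry V)) :
    Measurable fun x : Ioo a b => ∫⁻ y, V x y ∂S.fibreLaw ψ y₀ n x := by
  let κ : ProbabilityTheory.Kernel (Ioo a b) X := ⟨_, measurable_fibreLaw (S := S) hψ y₀ n⟩
  have : ProbabilityTheory.IsMarkovKernel κ :=
    ⟨fun x => isProbabilityMeasure_fibreLaw h1 hψ n x.2⟩
  exact Measurable.lintegral_kernel_prod_right (κ := κ) (f := fun (x : Ioo a b) y => V x y)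
    (hV.comp (measurable_subtype_coe.prodMap measurable_id))

lemma lintegral_fibreLaw_succ [Countable ι] {X : Type*} [MeasurableSpace X] {ψ : ι → X → X}
    (hψ : ∀ c, Measurable (ψ c)) (y₀ : X)
    (n : ℕ) {v : X → ENNReal} (hv : Measurable v) (x : ℝ) :
    ∫⁻ y, v y ∂S.fibreLaw ψ y₀ (n + 1) x =
      ∑' c, ENNReal.ofReal (S.w c x) * ∫⁻ y, v (ψ c y) ∂S.fibreLaw ψ y₀ n (S.φ c x) := by
  rw [fibreLaw, lintegral_sum_measure]
  exact tsum_congr fun c => by rw [lintegral_smul_measure, lintegral_map hv (hψ c), smul_eq_mul]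

/-- Duality between the skew product `R` and random compositions of its fibre maps. -/
theorem lintegral_iterate_skew [Countable ι] [Nonempty ι] {B : ℝ} {h : ℝ → ℝ}
    (hS : S.IsBranchSystem) (hab : a < b) (hh : S.IsInvariantDensity B h) {X Y : Type*}
    [MeasurableSpace X] [MeasurableSpace Y] {e : X → Y} (he : Measurable e)
    {ψ : ι → X → X} (hψ : ∀ c, Measurable (ψ c)) (y₀ : X) {R : ℝ × Y → ℝ × Y} (hR : Measurable R)
    (hRφ : ∀ c, ∀ x ∈ Ioo a b, ∀ y, R (S.φ c x, e y) = (x, e (ψ c y))) (n : ℕ)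
    {V : ℝ × Y → ENNReal} (hV : Measurable V) :
    ∫⁻ x in Ioo a b, V (R^[n] (x, e y₀)) * ENNReal.ofReal (h x) =
      ∫⁻ x in Ioo a b, (∫⁻ y, V (x, e y) ∂(S.normalized hh.logLip hab).fibreLaw ψ y₀ n x) *
        ENNReal.ofReal (h x) := by
  set N := S.normalized hh.logLip hab with hN
  have h1 := hh.hasSum_normalized hab
  have hem : Measurable fun z : ℝ × X => (z.1, e z.2) := measurable_fst.prodMk (he.comp measurable_snd)
  induction n generalizing V with
  | zero =>
    refine setLIntegral_congr_fun measurableSet_Ioo fun x _ => ?_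
    have hm : Measurable fun y => V (x, e y) := hV.comp (measurable_const.prodMk he)
    simp only [fibreLaw, Function.iterate_zero, id]
    rw [lintegral_dirac' _ hm]
  | succ n ih =>
    have hpos : ∀ x : Ioo a b, 0 < h x := fun x => hh.logLip.pos x x.2
    -- The change of variables of `IsBranchSystem` asks for a function measurable on the whole line,
    -- hence the extension by `0`.
    set G : ℝ → ENNReal := Function.extend Subtype.val (fun x : Ioo a b =>
      (∫⁻ y, V (R (x, e y)) ∂N.fibreLaw ψ y₀ n x) * ENNReal.ofReal (h x)) 0 with hG
    have hGx : ∀ x ∈ Ioo a b, G x = (∫⁻ y, V (R (x, e y)) ∂N.fibreLaw ψ y₀ n x) *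
        ENNReal.ofReal (h x) := fun x hx =>
      Subtype.val_injective.extend_apply _ _ (⟨x, hx⟩ : Ioo a b)
    have hGm : Measurable G := by
      refine (MeasurableEmbedding.subtype_coe measurableSet_Ioo).measurable_extend ?_
        measurable_const
      refine (measurable_lintegral_fibreLaw (V := fun x y => V (R (x, e y))) h1 hψ y₀ n
        ((hV.comp hR).comp hem)).mul ?_
      exact (continuousOn_iff_continuous_domRestrict.1
        hh.logLip.isC1.continuousOn).measurable.ennreal_ofReal
    calc ∫⁻ x in Ioo a b, V (R^[n + 1] (x, e y₀)) * ENNReal.ofReal (h x)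
        = ∫⁻ x in Ioo a b, (V ∘ R) (R^[n] (x, e y₀)) * ENNReal.ofReal (h x) := by
          simp only [Function.iterate_succ_apply', Function.comp]
      _ = ∫⁻ x in Ioo a b, (∫⁻ y, V (R (x, e y)) ∂N.fibreLaw ψ y₀ n x) *
            ENNReal.ofReal (h x) := ih (hV.comp hR)
      _ = ∫⁻ x in Ioo a b, G x := setLIntegral_congr_fun measurableSet_Ioo fun x hx => (hGx x hx).symm
      _ = ∫⁻ x in Ioo a b, ∑' c, ENNReal.ofReal (S.p c x) * G (S.φ c x) := hS.lintegral_eq _ hGm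
      _ = _ := by
          refine setLIntegral_congr_fun measurableSet_Ioo fun x hx => ?_
          have hVx : Measurable fun y => V (x, e y) := hV.comp (measurable_const.prodMk he)
          rw [lintegral_fibreLaw_succ hψ y₀ n hVx, ← ENNReal.tsum_mul_right]
          refine tsum_congr fun c => ?_
          have hφ := S.mapsTo c hx
          rw [hGx _ hφ]
          simp only [hRφ c x hx]
          -- The normalisation is designed for this identity: weighting by `N.w` under the density
          -- `h` at `x` is the Jacobian times the density at the preimage.
          have e1 : ENNReal.ofReal (N.w c x) * ENNReal.ofReal (h x) =
              ENNReal.ofReal (S.p c x) * ENNReal.ofReal (h (S.φ c x)) := by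
            rw [← ENNReal.ofReal_mul (N.w_pos c x hx).le, ← ENNReal.ofReal_mul (S.p_pos c x hx).le]
            congr 1
            change S.w c x * h (S.φ c x) / h x * h x = _
            rw [div_mul_cancel₀ _ (hh.logLip.pos x hx).ne', hS.w_eq]
          change ENNReal.ofReal (S.p c x) * ((∫⁻ y, V (x, e (ψ c y)) ∂N.fibreLaw ψ y₀ n (S.φ c x)) *
            ENNReal.ofReal (h (S.φ c x))) = ENNReal.ofReal (N.w c x) *
              (∫⁻ y, V (x, e (ψ c y)) ∂N.fibreLaw ψ y₀ n (S.φ c x)) * ENNReal.ofReal (h x)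
          rw [mul_right_comm, e1]
          ring

lemma lintegral_ofReal_add_const {α : Type*} [MeasurableSpace α] {μ : Measure α}
    [IsProbabilityMeasure μ] {f : α → ℝ} (hf : Integrable f μ) {C : ℝ}
    (h : ∀ᵐ x ∂μ, 0 ≤ f x + C) :
    ∫⁻ x, ENNReal.ofReal (f x + C) ∂μ = ENNReal.ofReal ((∫ x, f x ∂μ) + C) := by
  refine (ofReal_integral_eq_lintegral_ofReal (f := fun x => f x + C)
    (hf.add (integrable_const C)) h).symm.trans ?_
  rw [integral_add hf (integrable_const C)]
  simp

/-- The probability measure with density `h` on `(a, b)`. -/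
def densityMeasure (a b : ℝ) (h : ℝ → ℝ) : Measure ℝ :=
  (volume.restrict (Ioo a b)).withDensity fun x => ENNReal.ofReal (h x)

lemma IsInvariantDensity.isProbabilityMeasure {B : ℝ} {h : ℝ → ℝ} (hh : S.IsInvariantDensity B h)
    (hab : a < b) : IsProbabilityMeasure (densityMeasure a b h) := by
  refine ⟨?_⟩
  rw [densityMeasure, withDensity_apply _ .univ, Measure.restrict_univ,
    ← ofReal_integral_eq_lintegral_ofReal (hh.logLip.integrableOn hab)
      ((ae_restrict_iff' measurableSet_Ioo).2 (.of_forall fun x hx => (hh.logLip.pos x hx).le)),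
    hh.integral_eq_one, ENNReal.ofReal_one]

lemma ae_densityMeasure_mem {a b : ℝ} {h : ℝ → ℝ} : ∀ᵐ x ∂densityMeasure a b h, x ∈ Ioo a b :=
  (withDensity_absolutelyContinuous _ _).ae_le (ae_restrict_mem measurableSet_Ioo)

lemma aestronglyMeasurable_integral_fibreLaw [Countable ι] {h : ℝ → ℝ} {X Y : Type*}
    [MeasurableSpace X] [MeasurableSpace Y] {e : X → Y} (he : Measurable e)
    (h1 : ∀ x ∈ Ioo a b, HasSum (fun c => S.w c x) 1)
    {ψ : ι → X → X} (hψ : ∀ c, Measurable (ψ c)) (y₀ : X) (n : ℕ)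
    {V : ℝ × Y → ℝ} (hV : Measurable V) {C : ℝ} (hC : ∀ z, |V z| ≤ C) :
    AEStronglyMeasurable (fun x => ∫ y, V (x, e y) ∂S.fibreLaw ψ y₀ n x)
      (densityMeasure a b h) := by
  have hem : Measurable fun z : ℝ × X => (z.1, e z.2) :=
    measurable_fst.prodMk (he.comp measurable_snd)
  have hLm : AEMeasurable (fun x => ∫⁻ y, ENNReal.ofReal (V (x, e y) + C) ∂S.fibreLaw ψ y₀ n x)
      (volume.restrict (Ioo a b)) :=
    aemeasurable_restrict_of_measurable_subtype measurableSet_Ioo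
      (measurable_lintegral_fibreLaw (V := fun x y => ENNReal.ofReal (V (x, e y) + C)) h1 hψ
        y₀ n ((hV.add_const C).ennreal_ofReal.comp hem))
  have ham : AEMeasurable (fun x => (∫⁻ y, ENNReal.ofReal (V (x, e y) + C)
      ∂S.fibreLaw ψ y₀ n x).toReal - C) (densityMeasure a b h) :=
    (hLm.mono_ac (withDensity_absolutelyContinuous _ _)).ennreal_toReal.sub_const C
  refine ham.aestronglyMeasurable.congr (ae_densityMeasure_mem.mono fun x hx => ?_)
  have := isProbabilityMeasure_fibreLaw (y₀ := y₀) h1 hψ n hx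
  have hVx : Measurable fun y => V (x, e y) := hV.comp (measurable_const.prodMk he)
  have hb : |∫ y, V (x, e y) ∂S.fibreLaw ψ y₀ n x| ≤ C := abs_integral_le_of_bdd fun y => hC _
  simp only
  rw [lintegral_ofReal_add_const (integrable_of_bdd hVx fun y => hC _)
    (.of_forall fun y => by linarith [(abs_le.1 (hC (x, e y))).1]),
    ENNReal.toReal_ofReal (by linarith [(abs_le.1 hb).1])]
  ring

/-- The duality for nonnegative functions is applied to `V + C ≥ 0`; the constant cancels because
all the measures involved are probabilities. -/
theorem integral_iterate_skew [Countable ι] [Nonempty ι] {B : ℝ} {h : ℝ → ℝ}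
    (hS : S.IsBranchSystem) (hab : a < b) (hh : S.IsInvariantDensity B h) {X Y : Type*}
    [MeasurableSpace X] [MeasurableSpace Y] {e : X → Y} (he : Measurable e)
    {ψ : ι → X → X} (hψ : ∀ c, Measurable (ψ c)) (y₀ : X) {R : ℝ × Y → ℝ × Y} (hR : Measurable R)
    (hRφ : ∀ c, ∀ x ∈ Ioo a b, ∀ y, R (S.φ c x, e y) = (x, e (ψ c y))) (n : ℕ)
    {V : ℝ × Y → ℝ} (hV : Measurable V) {C : ℝ} (hC : ∀ z, |V z| ≤ C) :
    ∫ x, V (R^[n] (x, e y₀)) ∂densityMeasure a b h =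
      ∫ x, (∫ y, V (x, e y) ∂(S.normalized hh.logLip hab).fibreLaw ψ y₀ n x)
        ∂densityMeasure a b h := by
  set N := S.normalized hh.logLip hab with hN
  have h1 := hh.hasSum_normalized hab
  have hprob := hh.isProbabilityMeasure hab
  have hem : Measurable fun z : ℝ × X => (z.1, e z.2) := measurable_fst.prodMk (he.comp measurable_snd)
  have hnonneg : ∀ z, 0 ≤ V z + C := fun z => by linarith [(abs_le.1 (hC z)).1]
  have hWm : Measurable fun z => ENNReal.ofReal (V z + C) := (hV.add_const C).ennreal_ofReal
  have hhm : AEMeasurable (fun x => ENNReal.ofReal (h x)) (volume.restrict (Ioo a b)) :=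
    (hh.logLip.isC1.continuousOn.aemeasurable measurableSet_Ioo).ennreal_ofReal
  have hdens : ∀ g : ℝ → ENNReal, AEMeasurable g (volume.restrict (Ioo a b)) →
      ∫⁻ x, g x ∂densityMeasure a b h = ∫⁻ x in Ioo a b, g x * ENNReal.ofReal (h x) := by
    intro g hg
    rw [densityMeasure, lintegral_withDensity_eq_lintegral_mul₀ hhm hg]
    exact lintegral_congr fun x => mul_comm _ _
  have hRn : Measurable fun x : ℝ => R^[n] (x, e y₀) :=
    (hR.iterate n).comp (measurable_id.prodMk measurable_const)
  have hLm : AEMeasurable (fun x => ∫⁻ y, ENNReal.ofReal (V (x, e y) + C) ∂N.fibreLaw ψ y₀ n x)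
      (volume.restrict (Ioo a b)) := by
    exact aemeasurable_restrict_of_measurable_subtype measurableSet_Ioo
      (measurable_lintegral_fibreLaw (V := fun x y => ENNReal.ofReal (V (x, e y) + C)) h1 hψ
      y₀ n (hWm.comp hem))
  have key : ∫⁻ x, ENNReal.ofReal (V (R^[n] (x, e y₀)) + C) ∂densityMeasure a b h =
      ∫⁻ x, (∫⁻ y, ENNReal.ofReal (V (x, e y) + C) ∂N.fibreLaw ψ y₀ n x)
        ∂densityMeasure a b h := by
    rw [hdens (fun x => ENNReal.ofReal (V (R^[n] (x, e y₀)) + C)) (hWm.comp hRn).aemeasurable,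
      hdens _ hLm]
    exact lintegral_iterate_skew hS hab hh he hψ y₀ hR hRφ n hWm
  have hinner : ∀ x ∈ Ioo a b, ∫⁻ y, ENNReal.ofReal (V (x, e y) + C) ∂N.fibreLaw ψ y₀ n x =
      ENNReal.ofReal ((∫ y, V (x, e y) ∂N.fibreLaw ψ y₀ n x) + C) := by
    intro x hx
    have := isProbabilityMeasure_fibreLaw (y₀ := y₀) h1 hψ n hx
    have hVx : Measurable fun y => V (x, e y) := hV.comp (measurable_const.prodMk he)
    have hi : Integrable (fun y => V (x, e y)) (N.fibreLaw ψ y₀ n x) :=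
      integrable_of_bdd hVx fun y => hC _
    exact lintegral_ofReal_add_const hi (.of_forall fun y => hnonneg _)
  have hbd : ∀ x ∈ Ioo a b, |∫ y, V (x, e y) ∂N.fibreLaw ψ y₀ n x| ≤ C := fun x hx => by
    have := isProbabilityMeasure_fibreLaw (y₀ := y₀) h1 hψ n hx
    exact abs_integral_le_of_bdd fun y => hC _
  rw [lintegral_congr_ae (ae_densityMeasure_mem.mono hinner)] at key
  have hi1 : Integrable (fun x => V (R^[n] (x, e y₀))) (densityMeasure a b h) :=
    integrable_of_bdd (hV.comp hRn) fun x => hC _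
  have hi2 : Integrable (fun x => ∫ y, V (x, e y) ∂N.fibreLaw ψ y₀ n x) (densityMeasure a b h) := by
    exact Integrable.of_bound (aestronglyMeasurable_integral_fibreLaw he h1 hψ y₀ n hV hC) C
      (ae_densityMeasure_mem.mono hbd)
  have hn2 : ∀ᵐ x ∂densityMeasure a b h, 0 ≤ (∫ y, V (x, e y) ∂N.fibreLaw ψ y₀ n x) + C :=
    ae_densityMeasure_mem.mono fun x hx => by linarith [(abs_le.1 (hbd x hx)).1]
  have hnn : ∀ f : ℝ → ℝ, Integrable f (densityMeasure a b h) →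
      (∀ᵐ x ∂densityMeasure a b h, 0 ≤ f x + C) → 0 ≤ (∫ x, f x ∂densityMeasure a b h) + C := by
    intro f hf hfn
    have := integral_nonneg_of_ae hfn
    rw [integral_add hf (integrable_const C)] at this
    simpa using this
  rw [lintegral_ofReal_add_const hi1 (.of_forall fun y => hnonneg _),
    lintegral_ofReal_add_const hi2 hn2, ENNReal.ofReal_eq_ofReal_iff
      (hnn _ hi1 (.of_forall fun y => hnonneg _)) (hnn _ hi2 hn2)] at key
  linarith

end WeightedIFS

/-! ### Differentiability of fibre averages -/

/-- A family of laws on `(0, ∞)` over `(a, b)` against which every bounded uniformly continuous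
function has a `C¹` average, with derivative bounded by `D` times its supremum. -/
structure IsC1Family (a b D : ℝ) (η : ℝ → Measure (Ioi (0 : ℝ))) : Prop where
  isProbabilityMeasure : ∀ x, IsProbabilityMeasure (η x)
  isC1 : ∀ (v : Ioi (0 : ℝ) → ℝ) (B : ℝ), UniformContinuous v → (∀ y, |v y| ≤ B) →
    IsC1 (Ioo a b) fun x => ∫ y, v y ∂η x
  abs_deriv_le : ∀ (v : Ioi (0 : ℝ) → ℝ) (B : ℝ), UniformContinuous v → (∀ y, |v y| ≤ B) →
    ∀ x ∈ Ioo a b, |deriv (fun x => ∫ y, v y ∂η x) x| ≤ D * B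

/-- The measures `δ_x × η_x`. -/
def fibreMeasures (η : ℝ → Measure (Ioi (0 : ℝ))) (x : ℝ) : Measure (ℝ × ℝ) :=
  (η x).map fun y : Ioi (0 : ℝ) => (x, (y : ℝ))

lemma measurableEmbedding_fibre (x : ℝ) :
    MeasurableEmbedding fun y : Ioi (0 : ℝ) => (x, (y : ℝ)) :=
  (measurableEmbedding_prodMk_left x).comp (.subtype_coe measurableSet_Ioi)

lemma fibreAverage_fibreMeasures (η : ℝ → Measure (Ioi (0 : ℝ))) (v : ℝ × ℝ → ℝ) (x : ℝ) :
    fibreAverage (fibreMeasures η) v x = ∫ y : Ioi (0 : ℝ), v (x, y) ∂η x :=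
  (measurableEmbedding_fibre x).integral_map _

/-- Separates the two ways in which a fibre average depends on the base point, through the slice of
the observable and through the law. -/
lemma continuousAt_diag {Φ : ℝ → ℝ → ℝ} {x : ℝ} (h1 : ContinuousAt (Φ x) x)
    (h2 : ∀ ε > 0, ∀ᶠ z in 𝓝 x, |Φ z z - Φ x z| ≤ ε) : ContinuousAt (fun z => Φ z z) x := by
  have h3 : Tendsto (fun z => Φ z z - Φ x z) (𝓝 x) (𝓝 0) := by
    rw [Metric.tendsto_nhds]
    intro ε hε
    filter_upwards [h2 (ε / 2) (half_pos hε)] with z hz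
    rw [dist_zero_right]
    exact hz.trans_lt (half_lt_self hε)
  have h4 := h3.add h1
  simpa [ContinuousAt] using h4

lemma dist_prodMk_left (x : ℝ) (y y' : ℝ) : dist (x, y) (x, y') = dist y y' := by
  simp [Prod.dist_eq]

lemma dist_prodMk_right (x x' : ℝ) (y : ℝ) : dist (x, y) (x', y) = dist x x' := by
  simp [Prod.dist_eq]

namespace IsC1Family

variable {a b D : ℝ} {η : ℝ → Measure (Ioi (0 : ℝ))} {O : Set ℝ} {v : ℝ × ℝ → ℝ}

lemma uniformContinuous_slice {E : Type*} [PseudoMetricSpace E] {u : ℝ × ℝ → E} {x : ℝ}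
    (hx : x ∈ O) (hu : UniformContinuousOn u (O ×ˢ Ioi 0)) :
    UniformContinuous fun y : Ioi (0 : ℝ) => u (x, y) := by
  rw [Metric.uniformContinuous_iff]
  intro ε hε
  obtain ⟨δ, hδ, h⟩ := Metric.uniformContinuousOn_iff.1 hu ε hε
  refine ⟨δ, hδ, fun y y' hyy => h _ ⟨hx, y.2⟩ _ ⟨hx, y'.2⟩ ?_⟩
  rwa [dist_prodMk_left]

lemma exists_slice_close {E : Type*} [PseudoMetricSpace E] {u : ℝ × ℝ → E} (hO : IsOpen O)
    {x : ℝ} (hx : x ∈ O) (hu : UniformContinuousOn u (O ×ˢ Ioi 0)) {ε : ℝ} (hε : 0 < ε) :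
    ∃ δ > 0, Metric.ball x δ ⊆ O ∧ ∀ z ∈ Metric.ball x δ, ∀ y ∈ Ioi (0 : ℝ),
      dist (u (z, y)) (u (x, y)) < ε := by
  obtain ⟨δ, hδ, h⟩ := Metric.uniformContinuousOn_iff.1 hu ε hε
  obtain ⟨δ', hδ', h'⟩ := Metric.isOpen_iff.1 hO x hx
  refine ⟨min δ δ', lt_min hδ hδ', fun z hz => h' (Metric.ball_subset_ball (min_le_right _ _) hz),
    fun z hz y hy => h _ ⟨h' (Metric.ball_subset_ball (min_le_right _ _) hz), hy⟩ _ ⟨hx, hy⟩ ?_⟩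
  rw [dist_prodMk_right]
  exact Metric.ball_subset_ball (min_le_left _ _) hz

lemma abs_integral_sub_le (h : IsC1Family a b D η) {w w' : Ioi (0 : ℝ) → ℝ} {B B' ε : ℝ}
    (hw : UniformContinuous w) (hwB : ∀ y, |w y| ≤ B) (hw' : UniformContinuous w')
    (hwB' : ∀ y, |w' y| ≤ B') (hε : ∀ y, |w y - w' y| ≤ ε) (x : ℝ) :
    |(∫ y, w y ∂η x) - ∫ y, w' y ∂η x| ≤ ε := by
  have := h.isProbabilityMeasure x
  rw [← integral_sub (WeightedIFS.integrable_of_bdd hw.continuous.measurable hwB)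
    (WeightedIFS.integrable_of_bdd hw'.continuous.measurable hwB')]
  exact WeightedIFS.abs_integral_le_of_bdd hε

lemma abs_deriv_sub_le (h : IsC1Family a b D η) {w w' : Ioi (0 : ℝ) → ℝ} {B B' ε : ℝ}
    (hw : UniformContinuous w) (hwB : ∀ y, |w y| ≤ B) (hw' : UniformContinuous w')
    (hwB' : ∀ y, |w' y| ≤ B') (hε : ∀ y, |w y - w' y| ≤ ε) {x : ℝ} (hx : x ∈ Ioo a b) :
    |deriv (fun x => ∫ y, w y ∂η x) x - deriv (fun x => ∫ y, w' y ∂η x) x| ≤ D * ε := by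
  rw [← deriv_fun_sub ((h.isC1 w B hw hwB).diff x hx) ((h.isC1 w' B' hw' hwB').diff x hx)]
  have : (fun x => (∫ y, w y ∂η x) - ∫ y, w' y ∂η x) = fun x => ∫ y, (w y - w' y) ∂η x := by
    funext x
    have := h.isProbabilityMeasure x
    rw [integral_sub (WeightedIFS.integrable_of_bdd hw.continuous.measurable hwB)
      (WeightedIFS.integrable_of_bdd hw'.continuous.measurable hwB')]
  rw [this]
  exact h.abs_deriv_le _ ε (hw.sub hw') hε x hx

lemma continuousOn_average (h : IsC1Family a b D η) (hO : IsOpen O) (hOab : O ⊆ Ioo a b)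
    (hv : UniformContinuousOn v (O ×ˢ Ioi 0)) {C : ℝ} (hC : ∀ z ∈ O ×ˢ Ioi 0, |v z| ≤ C) :
    ContinuousOn (fun x => ∫ y : Ioi (0 : ℝ), v (x, y) ∂η x) O := by
  intro x hx
  refine ContinuousAt.continuousWithinAt ?_
  have hsl := fun z (hz : z ∈ O) => uniformContinuous_slice hz hv
  refine continuousAt_diag (Φ := fun z x => ∫ y : Ioi (0 : ℝ), v (z, y) ∂η x) ?_ ?_
  · exact ((h.isC1 _ C (hsl x hx) fun y => hC _ ⟨hx, y.2⟩).diff x (hOab hx)).continuousAt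
  · intro ε hε
    obtain ⟨δ, hδ, hδO, hclose⟩ := exists_slice_close hO hx hv hε
    filter_upwards [Metric.ball_mem_nhds x hδ] with z hz
    exact h.abs_integral_sub_le (hsl z (hδO hz)) (fun y => hC _ ⟨hδO hz, y.2⟩) (hsl x hx)
      (fun y => hC _ ⟨hx, y.2⟩) (fun y => (hclose z hz y y.2).le) z

/-- The average of a `C¹` observable over a `C¹` family of fibre laws is `C¹`. -/
theorem isC1_average (h : IsC1Family a b D η) (hD : 0 ≤ D) (hO : IsOpen O) (hOab : O ⊆ Ioo a b)
    (hv : IsCb1 (O ×ˢ Ioi 0) v) (hdv : UniformContinuousOn (fderiv ℝ v) (O ×ˢ Ioi 0)) :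
    IsC1 O (fun x => ∫ y : Ioi (0 : ℝ), v (x, y) ∂η x) ∧
    ∀ x ∈ O, |deriv (fun x => ∫ y : Ioi (0 : ℝ), v (x, y) ∂η x) x| ≤
      (D + 1) * (⨆ y : Ioi (0 : ℝ), |v (x, y)|) +
        (D + 1) * (⨆ y : Ioi (0 : ℝ), ‖fderiv ℝ v (x, y)‖) := by
  obtain ⟨C, hC⟩ := hv.bounded
  obtain ⟨C₁, hC₁⟩ := hv.deriv_bounded
  have hopen : IsOpen (O ×ˢ Ioi (0 : ℝ)) := hO.prod isOpen_Ioi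
  have hd : ∀ z ∈ O ×ˢ Ioi (0 : ℝ), HasFDerivAt v (fderiv ℝ v z) z := fun z hz =>
    ((hv.contDiffOn.differentiableOn one_ne_zero).differentiableAt (hopen.mem_nhds hz)).hasFDerivAt
  have hdx : ∀ x ∈ O, ∀ y ∈ Ioi (0 : ℝ),
      HasDerivAt (fun t => v (t, y)) (fderiv ℝ v (x, y) (1, 0)) x := fun x hx y hy =>
    (hd (x, y) ⟨hx, hy⟩).comp_hasDerivAt x ((hasDerivAt_id x).prodMk (hasDerivAt_const x y))
  have hdy : ∀ x ∈ O, ∀ y ∈ Ioi (0 : ℝ),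
      HasDerivAt (fun t => v (x, t)) (fderiv ℝ v (x, y) (0, 1)) y := fun x hx y hy =>
    (hd (x, y) ⟨hx, hy⟩).comp_hasDerivAt y ((hasDerivAt_const y x).prodMk (hasDerivAt_id y))
  have h10 : ‖((1 : ℝ), (0 : ℝ))‖ = 1 := by simp [Prod.norm_def]
  have h01 : ‖((0 : ℝ), (1 : ℝ))‖ = 1 := by simp [Prod.norm_def]
  have hpx : ∀ x ∈ O, ∀ y ∈ Ioi (0 : ℝ), |fderiv ℝ v (x, y) (1, 0)| ≤ ‖fderiv ℝ v (x, y)‖ := by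
    intro x hx y hy
    have := (fderiv ℝ v (x, y)).le_opNorm (1, 0)
    rwa [h10, mul_one] at this
  have hpy : ∀ x ∈ O, ∀ y ∈ Ioi (0 : ℝ), ‖fderiv ℝ v (x, y) (0, 1)‖ ≤ C₁ := by
    intro x hx y hy
    have := (fderiv ℝ v (x, y)).le_opNorm (0, 1)
    rw [h01, mul_one] at this
    exact this.trans (hC₁ _ ⟨hx, hy⟩)
  -- slices of `v` and of its horizontal derivative
  have hsB : ∀ x ∈ O, ∀ y : Ioi (0 : ℝ), |v (x, y)| ≤ C := fun x hx y => hC _ ⟨hx, y.2⟩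
  -- `O` need not be convex, so a bounded derivative does not make `v` uniformly continuous. Each
  -- slice lives on the convex set `(0, ∞)` and is Lipschitz there.
  have hsU : ∀ x ∈ O, UniformContinuous fun y : Ioi (0 : ℝ) => v (x, y) := by
    intro x hx
    have hC₁0 : 0 ≤ C₁ := (norm_nonneg _).trans (hC₁ (x, 1) ⟨hx, mem_Ioi.2 one_pos⟩)
    refine LipschitzWith.uniformContinuous (K := ⟨C₁, hC₁0⟩) (.of_dist_le_mul fun y y' => ?_)
    rw [Real.dist_eq, Subtype.dist_eq, Real.dist_eq]
    exact (convex_Ioi (0 : ℝ)).norm_image_sub_le_of_norm_hasDerivWithin_le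
      (fun t ht => (hdy x hx t ht).hasDerivWithinAt) (fun t ht => hpy x hx t ht) y'.2 y.2
  set p : ℝ → Ioi (0 : ℝ) → ℝ := fun x y => fderiv ℝ v (x, y) (1, 0) with hp
  have hpB : ∀ x ∈ O, ∀ y, |p x y| ≤ C₁ := fun x hx y =>
    (hpx x hx y y.2).trans (hC₁ _ ⟨hx, y.2⟩)
  have hpU : ∀ x ∈ O, UniformContinuous (p x) := fun x hx =>
    (ContinuousLinearMap.apply ℝ ℝ ((1 : ℝ), (0 : ℝ))).uniformContinuous.comp
      (uniformContinuous_slice hx hdv)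
  have happ : ∀ z z' : ℝ × ℝ, |fderiv ℝ v z (1, 0) - fderiv ℝ v z' (1, 0)| ≤
      dist (fderiv ℝ v z) (fderiv ℝ v z') := by
    intro z z'
    have := (fderiv ℝ v z - fderiv ℝ v z').le_opNorm (1, 0)
    rwa [h10, mul_one, ← dist_eq_norm] at this
  set E : (Ioi (0 : ℝ) → ℝ) → ℝ → ℝ := fun w x => ∫ y, w y ∂η x with hE
  set s : ℝ → Ioi (0 : ℝ) → ℝ := fun x y => v (x, y) with hs
  have hC1s := fun x hx => h.isC1 (s x) C (hsU x hx) (hsB x hx)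
  have hC1p := fun x hx => h.isC1 (p x) C₁ (hpU x hx) (hpB x hx)
  have hderiv : ∀ x ∈ O, HasDerivAt (fun x => E (s x) x) (deriv (E (s x)) x + E (p x) x) x := by
    intro x hx
    have h1 : HasDerivAt (E (s x)) (deriv (E (s x)) x) x :=
      ((hC1s x hx).diff x (hOab hx)).hasDerivAt
    -- Here the slice moves while the law is `η z`. The mean value theorem and the uniform
    -- continuity of `Dv` replace the increment of the slice by `(z - x) * p x y`, up to `c / 2 * |z
    -- - x|` uniformly in `y`. Continuity of the average of the fixed slice `p x` then replaces `η
    -- z` by `η x`.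
    have h2 : HasDerivAt (fun z => E (s z) z - E (s x) z) (E (p x) x) x := by
      rw [hasDerivAt_iff_isLittleO, Asymptotics.isLittleO_iff]
      intro c hc
      obtain ⟨δ, hδ, hδO, hclose⟩ := exists_slice_close hO hx hdv (half_pos hc)
      have hcont : ContinuousAt (E (p x)) x := ((hC1p x hx).diff x (hOab hx)).continuousAt
      filter_upwards [Metric.ball_mem_nhds x hδ,
        hcont.eventually (Metric.ball_mem_nhds _ (half_pos hc))] with z hz hzc
      have := h.isProbabilityMeasure z
      have hzO := hδO hz
      have hi1 := WeightedIFS.integrable_of_bdd (μ := η z) (hsU z hzO).continuous.measurable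
        (hsB z hzO)
      have hi2 := WeightedIFS.integrable_of_bdd (μ := η z) (hsU x hx).continuous.measurable
        (hsB x hx)
      have hi3 := WeightedIFS.integrable_of_bdd (μ := η z) (hpU x hx).continuous.measurable
        (hpB x hx)
      have hpt : ∀ y : Ioi (0 : ℝ), |s z y - s x y - (z - x) * p x y| ≤ c / 2 * |z - x| := by
        intro y
        have hmv := (convex_ball x δ).norm_image_sub_le_of_norm_hasDerivWithin_le
          (f := fun t => v (t, (y : ℝ)) - (t - x) * p x y)
          (f' := fun t => fderiv ℝ v (t, (y : ℝ)) (1, 0) - 1 * p x y) (C := c / 2)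
          (fun t ht => ((hdx t (hδO ht) y y.2).sub
            (((hasDerivAt_id t).sub_const x).mul_const (p x y))).hasDerivWithinAt)
          (fun t ht => by
            rw [one_mul, Real.norm_eq_abs]
            exact (happ _ _).trans (hclose t ht y y.2).le)
          (Metric.mem_ball_self hδ) hz
        simp only [sub_self, zero_mul, sub_zero, Real.norm_eq_abs] at hmv
        rwa [sub_right_comm] at hmv
      have hint : |E (s z) z - E (s x) z - (z - x) * E (p x) z| ≤ c / 2 * |z - x| := by
        have e : E (s z) z - E (s x) z - (z - x) * E (p x) z =
            ∫ y, (s z y - s x y - (z - x) * p x y) ∂η z := by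
          refine Eq.symm ((integral_sub (hi1.sub hi2) (hi3.const_mul (z - x))).trans ?_)
          rw [integral_const_mul]
          exact congrArg (· - _) (integral_sub hi1 hi2)
        rw [e]
        exact WeightedIFS.abs_integral_le_of_bdd hpt
      rw [Real.dist_eq] at hzc
      simp only [sub_self, sub_zero, smul_eq_mul, Real.norm_eq_abs]
      have e : E (s z) z - E (s x) z - (z - x) * E (p x) x =
        (E (s z) z - E (s x) z - (z - x) * E (p x) z) + (z - x) * (E (p x) z - E (p x) x) := by ring
      rw [e]
      refine (abs_add_le _ _).trans ?_
      rw [abs_mul]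
      nlinarith [abs_nonneg (z - x)]
    have h3 := h1.add h2
    refine h3.congr_of_eventuallyEq (.of_forall fun z => ?_)
    simp
  constructor
  · refine .of_hasDerivAt hderiv fun x hx => ContinuousAt.continuousWithinAt ?_
    refine ContinuousAt.add ?_ ?_
    · refine continuousAt_diag (Φ := fun z x => deriv (E (s z)) x) ?_ ?_
      · exact (hC1s x hx).cont.continuousAt (isOpen_Ioo.mem_nhds (hOab hx))
      · intro ε hε
        -- Nearby slices are uniformly close by the mean value theorem on a ball inside `O`, with
        -- constant `C₁`.
        have hvU : ∀ ε' > 0, ∃ δ > 0, Metric.ball x δ ⊆ O ∧ ∀ z ∈ Metric.ball x δ,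
            ∀ y ∈ Ioi (0 : ℝ), |v (z, y) - v (x, y)| ≤ ε' := by
          intro ε' hε'
          obtain ⟨δ, hδ, hδO⟩ := Metric.isOpen_iff.1 hO x hx
          have hC₁0 : 0 ≤ C₁ := (norm_nonneg _).trans (hC₁ (x, 1) ⟨hx, mem_Ioi.2 one_pos⟩)
          refine ⟨min δ (ε' / (C₁ + 1)), lt_min hδ (by positivity),
            (Metric.ball_subset_ball (min_le_left _ _)).trans hδO, fun z hz y hy => ?_⟩
          have hmv := (convex_ball x δ).norm_image_sub_le_of_norm_hasDerivWithin_le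
            (f := fun t => v (t, y)) (C := C₁)
            (fun t ht => (hdx t (hδO ht) y hy).hasDerivWithinAt)
            (fun t ht => (hpx t (hδO ht) y hy).trans (hC₁ _ ⟨hδO ht, hy⟩))
            (Metric.mem_ball_self hδ) (Metric.ball_subset_ball (min_le_left _ _) hz)
          have hz2 : ‖z - x‖ < ε' / (C₁ + 1) := by
            rw [← dist_eq_norm]
            exact (Metric.mem_ball.1 hz).trans_le (min_le_right _ _)
          rw [lt_div_iff₀ (by positivity)] at hz2
          refine hmv.trans ?_
          nlinarith [norm_nonneg (z - x)]
        obtain ⟨δ, hδ, hδO, hclose⟩ := hvU (ε / (D + 1)) (by positivity)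
        filter_upwards [Metric.ball_mem_nhds x hδ] with z hz
        have := h.abs_deriv_sub_le (hsU z (hδO hz)) (hsB z (hδO hz)) (hsU x hx) (hsB x hx)
          (fun y => hclose z hz y y.2) (hOab (hδO hz))
        refine this.trans ?_
        rw [mul_div_assoc', div_le_iff₀ (by positivity)]
        nlinarith
    · refine continuousAt_diag (Φ := fun z x => E (p z) x) ?_ ?_
      · exact ((hC1p x hx).diff x (hOab hx)).continuousAt
      · intro ε hε
        obtain ⟨δ, hδ, hδO, hclose⟩ := exists_slice_close hO hx hdv hε
        filter_upwards [Metric.ball_mem_nhds x hδ] with z hz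
        exact h.abs_integral_sub_le (hpU z (hδO hz)) (hpB z (hδO hz)) (hpU x hx) (hpB x hx)
          (fun y => (happ _ _).trans (hclose z hz y y.2).le) z
  · intro x hx
    have := h.isProbabilityMeasure x
    rw [(hderiv x hx).deriv]
    have hb1 : ∀ y : Ioi (0 : ℝ), |v (x, y)| ≤ ⨆ y : Ioi (0 : ℝ), |v (x, y)| := fun y =>
      le_ciSup (f := fun y : Ioi (0 : ℝ) => |v (x, y)|)
        ⟨C, by rintro _ ⟨y, rfl⟩; exact hsB x hx y⟩ y
    have hb2 : ∀ y : Ioi (0 : ℝ), ‖fderiv ℝ v (x, y)‖ ≤ ⨆ y : Ioi (0 : ℝ), ‖fderiv ℝ v (x, y)‖ :=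
      fun y => le_ciSup (f := fun y : Ioi (0 : ℝ) => ‖fderiv ℝ v (x, y)‖)
        ⟨C₁, by rintro _ ⟨y, rfl⟩; exact hC₁ _ ⟨hx, y.2⟩⟩ y
    -- Moving the law costs `D * sup |v|`, moving the slice costs `sup ‖Dv‖`; `D + 1` dominates both
    -- factors.
    have g1 := h.abs_deriv_le (s x) _ (hsU x hx) hb1 x (hOab hx)
    have g2 : |E (p x) x| ≤ ⨆ y : Ioi (0 : ℝ), ‖fderiv ℝ v (x, y)‖ :=
      WeightedIFS.abs_integral_le_of_bdd fun y => (hpx x hx y y.2).trans (hb2 y)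
    have y1 : Ioi (0 : ℝ) := ⟨1, mem_Ioi.2 one_pos⟩
    have n1 := (abs_nonneg _).trans (hb1 y1)
    have n2 := (norm_nonneg _).trans (hb2 y1)
    refine (abs_add_le _ _).trans ?_
    nlinarith

lemma isCb1_fibreAverage (h : IsC1Family a b D η) (hD : 0 ≤ D) (hO : IsOpen O)
    (hOab : O ⊆ Ioo a b) (hv : IsCb1 (O ×ˢ Ioi 0) v)
    (hdv : UniformContinuousOn (fderiv ℝ v) (O ×ˢ Ioi 0)) :
    IsCb1 O (fibreAverage (fibreMeasures η) v) ∧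
    ∀ x ∈ O, ‖fderiv ℝ (fibreAverage (fibreMeasures η) v) x‖ ≤
      (D + 1) * (⨆ y : Ioi (0 : ℝ), |v (x, y)|) +
        (D + 1) * (⨆ y : Ioi (0 : ℝ), ‖fderiv ℝ v (x, y)‖) := by
  have e : fibreAverage (fibreMeasures η) v = fun x => ∫ y : Ioi (0 : ℝ), v (x, y) ∂η x :=
    funext fun x => fibreAverage_fibreMeasures η v x
  obtain ⟨h1, h2⟩ := h.isC1_average hD hO hOab hv hdv
  obtain ⟨C, hC⟩ := hv.bounded
  obtain ⟨C₁, hC₁⟩ := hv.deriv_bounded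
  rw [e]
  have h3 : ∀ x ∈ O, ‖fderiv ℝ (fun x => ∫ y : Ioi (0 : ℝ), v (x, y) ∂η x) x‖ ≤
      (D + 1) * (⨆ y : Ioi (0 : ℝ), |v (x, y)|) +
        (D + 1) * (⨆ y : Ioi (0 : ℝ), ‖fderiv ℝ v (x, y)‖) := by
    intro x hx
    rw [← norm_deriv_eq_norm_fderiv]
    exact h2 x hx
  have : Nonempty (Ioi (0 : ℝ)) := ⟨⟨1, mem_Ioi.2 one_pos⟩⟩
  refine ⟨⟨?_, ⟨C, fun x hx => ?_⟩, ⟨(D + 1) * C + (D + 1) * C₁, fun x hx => (h3 x hx).trans ?_⟩⟩, h3⟩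
  · rw [show (1 : WithTop ℕ∞) = 0 + 1 by simp, contDiffOn_succ_iff_deriv_of_isOpen hO]
    exact ⟨fun x hx => (h1.diff x hx).differentiableWithinAt, by simp, contDiffOn_zero.2 h1.cont⟩
  · have := h.isProbabilityMeasure x
    exact WeightedIFS.abs_integral_le_of_bdd fun y => hC _ ⟨hx, y.2⟩
  · have g1 : (⨆ y : Ioi (0 : ℝ), |v (x, y)|) ≤ C := ciSup_le fun y => hC _ ⟨hx, y.2⟩
    have g2 : (⨆ y : Ioi (0 : ℝ), ‖fderiv ℝ v (x, y)‖) ≤ C₁ := ciSup_le fun y => hC₁ _ ⟨hx, y.2⟩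
    have : 0 ≤ D + 1 := by linarith
    gcongr

end IsC1Family

/-! ### The inverse branch `g₀` -/

namespace AssumptionA

variable {f₀ : ℝ → ℝ}

lemma differentiableAt (hA : AssumptionA f₀) {x : ℝ} (hx : x ∈ Ioo (0 : ℝ) 1) :
    DifferentiableAt ℝ f₀ x :=
  (hA.contDiffOn.differentiableOn two_ne_zero).differentiableAt (isOpen_Ioo.mem_nhds hx)

lemma continuousOn (hA : AssumptionA f₀) : ContinuousOn f₀ (Ioo 0 1) := hA.contDiffOn.continuousOn

lemma contDiffOn_deriv (hA : AssumptionA f₀) : ContDiffOn ℝ 1 (deriv f₀) (Ioo 0 1) := by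
  have h := hA.contDiffOn
  rw [show (2 : WithTop ℕ∞) = 1 + 1 by norm_num, contDiffOn_succ_iff_deriv_of_isOpen isOpen_Ioo] at h
  exact h.2.2

lemma hasDerivAt_deriv (hA : AssumptionA f₀) {x : ℝ} (hx : x ∈ Ioo (0 : ℝ) 1) :
    HasDerivAt (deriv f₀) (deriv (deriv f₀) x) x :=
  ((hA.contDiffOn_deriv.differentiableOn one_ne_zero).differentiableAt
    (isOpen_Ioo.mem_nhds hx)).hasDerivAt

lemma continuousOn_deriv2 (hA : AssumptionA f₀) : ContinuousOn (deriv (deriv f₀)) (Ioo 0 1) := by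
  have h := hA.contDiffOn_deriv
  rw [show (1 : WithTop ℕ∞) = 0 + 1 by norm_num, contDiffOn_succ_iff_deriv_of_isOpen isOpen_Ioo] at h
  exact h.2.2.continuousOn

lemma strictMonoOn (hA : AssumptionA f₀) : StrictMonoOn f₀ (Ioo 0 1) :=
  strictMonoOn_of_deriv_pos (convex_Ioo 0 1) hA.continuousOn fun x hx =>
    one_pos.trans (hA.one_lt_deriv x (interior_subset hx))

lemma strictMonoOn_deriv (hA : AssumptionA f₀) : StrictMonoOn (deriv f₀) (Ioo 0 1) :=
  strictMonoOn_of_deriv_pos (convex_Ioo 0 1) hA.contDiffOn_deriv.continuousOn fun x hx =>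
    hA.deriv2_pos x (interior_subset hx)

/-- By (A2) `f₀ z - z` is strictly increasing, and by (A1) it tends to `0` at `0`. -/
lemma lt_apply (hA : AssumptionA f₀) {x : ℝ} (hx : x ∈ Ioo (0 : ℝ) 1) : x < f₀ x := by
  have hd : ∀ z ∈ Ioo (0 : ℝ) 1, HasDerivAt (fun z => f₀ z - z) (deriv f₀ z - 1) z := fun z hz =>
    (hA.differentiableAt hz).hasDerivAt.sub (hasDerivAt_id z)
  have hm : StrictMonoOn (fun z => f₀ z - z) (Ioo 0 1) :=
    strictMonoOn_of_deriv_pos (convex_Ioo 0 1) (hA.continuousOn.sub continuousOn_id) fun z hz => by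
      rw [(hd z (interior_subset hz)).deriv]
      exact sub_pos.2 (hA.one_lt_deriv z (interior_subset hz))
  have hx2 : x / 2 ∈ Ioo (0 : ℝ) 1 := ⟨half_pos hx.1, (half_lt_self hx.1).trans hx.2⟩
  have hlim : Tendsto (fun z => f₀ z - z) (𝓝[>] 0) (𝓝 (0 - 0)) :=
    hA.tendsto_zero.sub (tendsto_id.mono_left nhdsWithin_le_nhds)
  have h0 : (0 : ℝ) - 0 ≤ f₀ (x / 2) - x / 2 := by
    refine le_of_tendsto hlim ?_
    filter_upwards [Ioo_mem_nhdsGT hx2.1] with z hz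
    exact (hm ⟨hz.1, hz.2.trans hx2.2⟩ hx2 hz.2).le
  have := hm hx2 hx (half_lt_self hx.1)
  simp only at this
  linarith

lemma surjOn (hA : AssumptionA f₀) : SurjOn f₀ (Ioo 0 1) (Ioi 0) := by
  intro y hy
  obtain ⟨u, hu, hu1, hu2⟩ : ∃ u, f₀ u < y ∧ 0 < u ∧ u < 1 := by
    have h1 := hA.tendsto_zero.eventually (gt_mem_nhds hy)
    exact (h1.and (Ioo_mem_nhdsGT one_pos)).exists
  obtain ⟨v, hv, hv1, hv2⟩ : ∃ v, y < f₀ v ∧ 0 < v ∧ v < 1 := by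
    have h1 := hA.tendsto_one.eventually (eventually_gt_atTop y)
    exact (h1.and (Ioo_mem_nhdsLT one_pos)).exists
  have huv : u ≤ v := ((hA.strictMonoOn.lt_iff_lt ⟨hu1, hu2⟩ ⟨hv1, hv2⟩).1 (hu.trans hv)).le
  have hsub : Icc u v ⊆ Ioo 0 1 := fun z hz => ⟨hu1.trans_le hz.1, hz.2.trans_lt hv2⟩
  obtain ⟨z, hz, hzy⟩ := intermediate_value_Icc huv (hA.continuousOn.mono hsub) ⟨hu.le, hv.le⟩
  exact ⟨z, hsub hz, hzy⟩

lemma g₀_mem (hA : AssumptionA f₀) {y : ℝ} (hy : 0 < y) : g₀ f₀ y ∈ Ioo (0 : ℝ) 1 := by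
  rw [g₀, if_pos hy]
  exact Function.invFunOn_mem (hA.surjOn hy)

lemma apply_g₀ (hA : AssumptionA f₀) {y : ℝ} (hy : 0 < y) : f₀ (g₀ f₀ y) = y := by
  rw [g₀, if_pos hy]
  exact Function.invFunOn_eq (hA.surjOn hy)

lemma g₀_apply (hA : AssumptionA f₀) {x : ℝ} (hx : x ∈ Ioo (0 : ℝ) 1) : g₀ f₀ (f₀ x) = x :=
  hA.strictMonoOn.injOn (hA.g₀_mem (hA.mapsTo hx)) hx (hA.apply_g₀ (hA.mapsTo hx))

lemma strictMonoOn_g₀ (hA : AssumptionA f₀) : StrictMonoOn (g₀ f₀) (Ioi 0) := by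
  intro y hy y' hy' hlt
  rw [← hA.strictMonoOn.lt_iff_lt (hA.g₀_mem hy) (hA.g₀_mem hy'), hA.apply_g₀ hy, hA.apply_g₀ hy']
  exact hlt

lemma g₀_lt (hA : AssumptionA f₀) {y : ℝ} (hy : 0 < y) : g₀ f₀ y < y := by
  have := hA.lt_apply (hA.g₀_mem hy)
  rwa [hA.apply_g₀ hy] at this

lemma monotone_g₀ (hA : AssumptionA f₀) : Monotone (g₀ f₀) := by
  intro y y' h
  rcases le_or_gt y 0 with hy | hy
  · rw [g₀, if_neg hy.not_gt]
    rcases le_or_gt y' 0 with hy' | hy'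
    · rw [g₀, if_neg hy'.not_gt]
    · exact (hA.g₀_mem hy').1.le
  · exact hA.strictMonoOn_g₀.monotoneOn hy (hy.trans_le h) h

lemma measurable_g₀ (hA : AssumptionA f₀) : Measurable (g₀ f₀) := hA.monotone_g₀.measurable

lemma image_g₀ (hA : AssumptionA f₀) {U : Set ℝ} (hU : U ⊆ Ioi 0) :
    g₀ f₀ '' U = Ioo 0 1 ∩ f₀ ⁻¹' U := by
  ext x
  constructor
  · rintro ⟨y, hy, rfl⟩
    exact ⟨hA.g₀_mem (hU hy), by rw [mem_preimage, hA.apply_g₀ (hU hy)]; exact hy⟩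
  · rintro ⟨hx, hxU⟩
    exact ⟨f₀ x, hxU, hA.g₀_apply hx⟩

lemma isOpen_image_g₀ (hA : AssumptionA f₀) {U : Set ℝ} (hU : U ⊆ Ioi 0) (hUo : IsOpen U) :
    IsOpen (g₀ f₀ '' U) := by
  rw [hA.image_g₀ hU]
  exact hA.continuousOn.isOpen_inter_preimage isOpen_Ioo hUo

lemma continuousAt_g₀ (hA : AssumptionA f₀) {y : ℝ} (hy : 0 < y) : ContinuousAt (g₀ f₀) y := by
  refine continuousAt_of_monotoneOn_of_image_mem_nhds (hA.monotone_g₀.monotoneOn _)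
    (Ioi_mem_nhds hy) ?_
  exact (hA.isOpen_image_g₀ subset_rfl isOpen_Ioi).mem_nhds ⟨y, hy, rfl⟩

/-- The derivative of `g₀`. -/
def _root_.NonCompactMixing.dg₀ (f₀ : ℝ → ℝ) (y : ℝ) : ℝ := (deriv f₀ (g₀ f₀ y))⁻¹

/-- The second derivative of `g₀`. -/
def _root_.NonCompactMixing.ddg₀ (f₀ : ℝ → ℝ) (y : ℝ) : ℝ :=
  -(deriv (deriv f₀) (g₀ f₀ y) * dg₀ f₀ y) / deriv f₀ (g₀ f₀ y) ^ 2

lemma deriv_g₀_pos (hA : AssumptionA f₀) {y : ℝ} (hy : 0 < y) : 0 < deriv f₀ (g₀ f₀ y) :=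
  one_pos.trans (hA.one_lt_deriv _ (hA.g₀_mem hy))

lemma hasDerivAt_g₀ (hA : AssumptionA f₀) {y : ℝ} (hy : 0 < y) :
    HasDerivAt (g₀ f₀) (dg₀ f₀ y) y := by
  refine HasDerivAt.of_local_left_inverse (hA.continuousAt_g₀ hy)
    (hA.differentiableAt (hA.g₀_mem hy)).hasDerivAt (hA.deriv_g₀_pos hy).ne' ?_
  filter_upwards [Ioi_mem_nhds hy] with z hz using hA.apply_g₀ hz

lemma hasDerivAt_dg₀ (hA : AssumptionA f₀) {y : ℝ} (hy : 0 < y) :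
    HasDerivAt (dg₀ f₀) (ddg₀ f₀ y) y :=
  ((hA.hasDerivAt_deriv (hA.g₀_mem hy)).comp y (hA.hasDerivAt_g₀ hy)).inv (hA.deriv_g₀_pos hy).ne'

lemma continuousOn_g₀ (hA : AssumptionA f₀) : ContinuousOn (g₀ f₀) (Ioi 0) := fun _ hy =>
  (hA.continuousAt_g₀ hy).continuousWithinAt

lemma continuousOn_dg₀ (hA : AssumptionA f₀) : ContinuousOn (dg₀ f₀) (Ioi 0) := fun _ hy =>
  (hA.hasDerivAt_dg₀ hy).continuousAt.continuousWithinAt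

lemma continuousOn_ddg₀ (hA : AssumptionA f₀) : ContinuousOn (ddg₀ f₀) (Ioi 0) := by
  have hmaps : MapsTo (g₀ f₀) (Ioi 0) (Ioo 0 1) := fun y hy => hA.g₀_mem hy
  exact (((hA.continuousOn_deriv2.comp hA.continuousOn_g₀ hmaps).mul hA.continuousOn_dg₀).neg).div
    ((hA.contDiffOn_deriv.continuousOn.comp hA.continuousOn_g₀ hmaps).pow 2)
    fun y hy => (pow_pos (hA.deriv_g₀_pos hy) 2).ne'

lemma dg₀_pos (hA : AssumptionA f₀) {y : ℝ} (hy : 0 < y) : 0 < dg₀ f₀ y :=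
  inv_pos.2 (hA.deriv_g₀_pos hy)

lemma dg₀_lt_one (hA : AssumptionA f₀) {y : ℝ} (hy : 0 < y) : dg₀ f₀ y < 1 :=
  inv_lt_one_of_one_lt₀ (hA.one_lt_deriv _ (hA.g₀_mem hy))

lemma dg₀_anti (hA : AssumptionA f₀) {y y' : ℝ} (hy : 0 < y) (h : y ≤ y') :
    dg₀ f₀ y' ≤ dg₀ f₀ y :=
  inv_anti₀ (hA.deriv_g₀_pos hy) (hA.strictMonoOn_deriv.monotoneOn (hA.g₀_mem hy)
    (hA.g₀_mem (hy.trans_le h)) (hA.monotone_g₀ h))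

/-- `|g₀''| / g₀'` at `y` equals `f₀'' / (f₀')²` at `g₀ y`, so this is (A6). -/
lemma exists_abs_ddg₀_le (hA : AssumptionA f₀) :
    ∃ M, 0 ≤ M ∧ ∀ y, 0 < y → |ddg₀ f₀ y| ≤ M * dg₀ f₀ y := by
  obtain ⟨M, hM⟩ := hA.adler
  refine ⟨max M 0, le_max_right _ _, fun y hy => ?_⟩
  have h1 := hM (mem_image_of_mem _ (hA.g₀_mem hy))
  have hp := hA.deriv2_pos _ (hA.g₀_mem hy)
  have hd := hA.dg₀_pos hy
  rw [ddg₀, neg_div, abs_neg, abs_of_nonneg (by have := hA.deriv_g₀_pos hy; positivity),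
    mul_comm, mul_div_assoc, mul_comm]
  exact mul_le_mul_of_nonneg_right (h1.trans (le_max_left _ _)) hd.le

lemma iterate_g₀_pos (hA : AssumptionA f₀) {y : ℝ} (hy : 0 < y) (j : ℕ) : 0 < (g₀ f₀)^[j] y := by
  induction j with
  | zero => exact hy
  | succ j ih => rw [Function.iterate_succ_apply']; exact (hA.g₀_mem ih).1

lemma iterate_g₀_le (hA : AssumptionA f₀) {y : ℝ} (hy : 0 < y) (j : ℕ) : (g₀ f₀)^[j] y ≤ y := by
  induction j with
  | zero => exact le_rfl
  | succ j ih =>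
    rw [Function.iterate_succ_apply']
    exact (hA.g₀_lt (hA.iterate_g₀_pos hy j)).le.trans ih

lemma strictMonoOn_iterate_g₀ (hA : AssumptionA f₀) (j : ℕ) :
    StrictMonoOn ((g₀ f₀)^[j]) (Ioi 0) := by
  induction j with
  | zero => exact fun _ _ _ _ h => h
  | succ j ih =>
    intro y hy y' hy' h
    rw [Function.iterate_succ_apply', Function.iterate_succ_apply']
    exact hA.strictMonoOn_g₀ (hA.iterate_g₀_pos hy j) (hA.iterate_g₀_pos hy' j) (ih hy hy' h)

/-- The sequence decreases; a positive limit would be a fixed point of `g₀`, and `g₀ y < y`. -/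
lemma tendsto_iterate_g₀_one (hA : AssumptionA f₀) :
    Tendsto (fun j => (g₀ f₀)^[j] 1) atTop (𝓝 0) := by
  have hanti : Antitone fun j => (g₀ f₀)^[j] 1 := antitone_nat_of_succ_le fun j => by
    rw [Function.iterate_succ_apply']
    exact (hA.g₀_lt (hA.iterate_g₀_pos one_pos j)).le
  have hlim := tendsto_atTop_ciInf hanti
    ⟨0, by rintro _ ⟨j, rfl⟩; exact (hA.iterate_g₀_pos one_pos j).le⟩
  set l := ⨅ j, (g₀ f₀)^[j] 1
  have hl : 0 ≤ l := ge_of_tendsto' hlim fun j => (hA.iterate_g₀_pos one_pos j).le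
  rcases hl.eq_or_lt with h | h
  · rwa [← h] at hlim
  · have := isFixedPt_of_tendsto_iterate hlim (hA.continuousAt_g₀ h)
    exact absurd this (hA.g₀_lt h).ne

lemma abs_g₀_sub_le (hA : AssumptionA f₀) {a y y' : ℝ} (ha : 0 < a) (hy : a ≤ y) (hy' : a ≤ y') :
    |g₀ f₀ y - g₀ f₀ y'| ≤ dg₀ f₀ a * |y - y'| :=
  (convex_Ici a).norm_image_sub_le_of_norm_hasDerivWithin_le
    (fun z hz => (hA.hasDerivAt_g₀ (ha.trans_le hz)).hasDerivWithinAt)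
    (fun z hz => by
      rw [Real.norm_eq_abs, abs_of_pos (hA.dg₀_pos (ha.trans_le hz))]
      exact hA.dg₀_anti ha hz) hy' hy

lemma abs_g₀_sub_le_abs_sub (hA : AssumptionA f₀) {y y' : ℝ} (hy : 0 < y) (hy' : 0 < y') :
    |g₀ f₀ y - g₀ f₀ y'| ≤ |y - y'| := by
  refine (hA.abs_g₀_sub_le (lt_min hy hy') (min_le_left _ _) (min_le_right _ _)).trans ?_
  have := (hA.dg₀_lt_one (lt_min hy hy')).le
  nlinarith [abs_nonneg (y - y')]

lemma abs_iterate_g₀_sub_le (hA : AssumptionA f₀) {y y' : ℝ} (hy : 0 < y) (hy' : 0 < y') (j : ℕ) :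
    |(g₀ f₀)^[j] y - (g₀ f₀)^[j] y'| ≤ |y - y'| := by
  induction j with
  | zero => exact le_rfl
  | succ j ih =>
    rw [Function.iterate_succ_apply', Function.iterate_succ_apply']
    exact (hA.abs_g₀_sub_le_abs_sub (hA.iterate_g₀_pos hy j) (hA.iterate_g₀_pos hy' j)).trans ih

end AssumptionA

/-! ### The inverse branches of `F̂` -/

/-- The inverse branch of `F̂` onto `J_s^q`, where `s = i + 2` and `q = j + 1`. -/
def phi (f₀ : ℝ → ℝ) (c : ℕ × ℕ) (x : ℝ) : ℝ := g₀ f₀ ((g₀ f₀)^[c.2] x + (c.1 + 1))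

/-- The derivative of the `j`-th iterate of `g₀`. -/
def dIter (f₀ : ℝ → ℝ) (j : ℕ) (x : ℝ) : ℝ := ∏ k ∈ Finset.range j, dg₀ f₀ ((g₀ f₀)^[k] x)

/-- The derivative of an inverse branch of `F̂`. -/
def dphi (f₀ : ℝ → ℝ) (c : ℕ × ℕ) (x : ℝ) : ℝ :=
  dg₀ f₀ ((g₀ f₀)^[c.2] x + (c.1 + 1)) * dIter f₀ c.2 x

/-- A positive `C²` function `u` on `U` with derivatives `u₁ > 0` and `u₂`, whose nonlinearity
`u₂ / u₁` is bounded by `R`. -/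
structure IsC2Branch (U : Set ℝ) (u u₁ u₂ R : ℝ → ℝ) : Prop where
  pos : ∀ x ∈ U, 0 < u x
  hasDerivAt : ∀ x ∈ U, HasDerivAt u (u₁ x) x
  deriv_pos : ∀ x ∈ U, 0 < u₁ x
  hasDerivAt₂ : ∀ x ∈ U, HasDerivAt u₁ (u₂ x) x
  cont : ContinuousOn u₂ U
  abs_le : ∀ x ∈ U, |u₂ x| ≤ R x * u₁ x

namespace AssumptionA

variable {f₀ : ℝ → ℝ}

/-- The chain rule for nonlinearities: `(g₀ ∘ u)'' / (g₀ ∘ u)' = (g₀'' / g₀') ∘ u · u' + u'' / u'`,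
so one more `g₀` adds at most `M * u'`. -/
lemma comp_branch (hA : AssumptionA f₀) {M : ℝ} (hM : ∀ y, 0 < y → |ddg₀ f₀ y| ≤ M * dg₀ f₀ y)
    {U : Set ℝ} {u u₁ u₂ R : ℝ → ℝ} (h : IsC2Branch U u u₁ u₂ R) :
    IsC2Branch U (fun x => g₀ f₀ (u x)) (fun x => dg₀ f₀ (u x) * u₁ x)
      (fun x => ddg₀ f₀ (u x) * u₁ x * u₁ x + dg₀ f₀ (u x) * u₂ x) (fun x => R x + M * u₁ x) where
  pos x hx := (hA.g₀_mem (h.pos x hx)).1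
  hasDerivAt x hx := (hA.hasDerivAt_g₀ (h.pos x hx)).comp x (h.hasDerivAt x hx)
  deriv_pos x hx := mul_pos (hA.dg₀_pos (h.pos x hx)) (h.deriv_pos x hx)
  hasDerivAt₂ x hx := ((hA.hasDerivAt_dg₀ (h.pos x hx)).comp x (h.hasDerivAt x hx)).mul
    (h.hasDerivAt₂ x hx)
  cont := by
    have h0 : ContinuousOn u U := fun x hx => (h.hasDerivAt x hx).continuousAt.continuousWithinAt
    have h1 : ContinuousOn u₁ U := fun x hx => (h.hasDerivAt₂ x hx).continuousAt.continuousWithinAt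
    have hm : MapsTo u U (Ioi 0) := fun x hx => h.pos x hx
    exact (((hA.continuousOn_ddg₀.comp h0 hm).mul h1).mul h1).add
      ((hA.continuousOn_dg₀.comp h0 hm).mul h.cont)
  abs_le x hx := by
    have h1 := h.deriv_pos x hx
    have hg := hA.dg₀_pos (h.pos x hx)
    refine (abs_add_le _ _).trans ?_
    rw [abs_mul, abs_mul, abs_mul, abs_of_pos h1, abs_of_pos hg]
    have g1 := hM _ (h.pos x hx)
    have g2 := h.abs_le x hx
    have g3 : |ddg₀ f₀ (u x)| * u₁ x * u₁ x ≤ M * dg₀ f₀ (u x) * u₁ x * u₁ x := by gcongr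
    have g4 : dg₀ f₀ (u x) * |u₂ x| ≤ dg₀ f₀ (u x) * (R x * u₁ x) := by gcongr
    linarith

lemma add_branch {U : Set ℝ} {u u₁ u₂ R : ℝ → ℝ} (h : IsC2Branch U u u₁ u₂ R) {k : ℝ}
    (hk : 0 ≤ k) : IsC2Branch U (fun x => u x + k) u₁ u₂ R :=
  ⟨fun x hx => by linarith [h.pos x hx], fun x hx => (h.hasDerivAt x hx).add_const k, h.deriv_pos,
    h.hasDerivAt₂, h.cont, h.abs_le⟩

lemma exists_branch_iterate (hA : AssumptionA f₀) {M : ℝ}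
    (hM : ∀ y, 0 < y → |ddg₀ f₀ y| ≤ M * dg₀ f₀ y) (j : ℕ) :
    ∃ u₂, IsC2Branch (Ioi 0) ((g₀ f₀)^[j]) (dIter f₀ j) u₂
      fun x => M * ∑ k ∈ Finset.range j, dIter f₀ k x := by
  induction j with
  | zero =>
    have e : dIter f₀ 0 = fun _ => 1 := by funext x; simp [dIter]
    refine ⟨fun _ => 0, fun x hx => hx, fun x _ => ?_, fun x _ => ?_, fun x _ => ?_,
      continuousOn_const, fun x _ => by simp⟩
    · rw [e]; exact hasDerivAt_id x
    · rw [e]; exact one_pos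
    · rw [e]; exact hasDerivAt_const x 1
  | succ j ih =>
    obtain ⟨u₂, hu⟩ := ih
    refine ⟨fun x => ddg₀ f₀ ((g₀ f₀)^[j] x) * dIter f₀ j x * dIter f₀ j x +
      dg₀ f₀ ((g₀ f₀)^[j] x) * u₂ x, ?_⟩
    convert hA.comp_branch hM hu using 1
    · funext x; rw [Function.iterate_succ_apply']
    · funext x; rw [dIter, Finset.prod_range_succ, mul_comm]; rfl
    · funext x; rw [Finset.sum_range_succ, mul_add]

/-- The translation by `c.1 + 1` adds no nonlinearity, so the bound does not involve `c.1` and is a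
partial sum of one series in `k`. -/
lemma exists_branch_phi (hA : AssumptionA f₀) {M : ℝ}
    (hM : ∀ y, 0 < y → |ddg₀ f₀ y| ≤ M * dg₀ f₀ y) (c : ℕ × ℕ) :
    ∃ u₂, IsC2Branch (Ioi 0) (phi f₀ c) (dphi f₀ c) u₂
      fun x => M * ∑ k ∈ Finset.range (c.2 + 1), dIter f₀ k x := by
  obtain ⟨u₂, hu⟩ := hA.exists_branch_iterate hM c.2
  refine ⟨fun x => ddg₀ f₀ ((g₀ f₀)^[c.2] x + (c.1 + 1)) * dIter f₀ c.2 x * dIter f₀ c.2 x +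
    dg₀ f₀ ((g₀ f₀)^[c.2] x + (c.1 + 1)) * u₂ x, ?_⟩
  convert hA.comp_branch hM (add_branch hu (k := (c.1 : ℝ) + 1) (by positivity)) using 1
  · rfl
  · rfl
  · funext x; rw [Finset.sum_range_succ, mul_add]

lemma dIter_pos (hA : AssumptionA f₀) {x : ℝ} (hx : 0 < x) (j : ℕ) : 0 < dIter f₀ j x :=
  Finset.prod_pos fun k _ => hA.dg₀_pos (hA.iterate_g₀_pos hx k)

lemma dIter_le_one (hA : AssumptionA f₀) {x : ℝ} (hx : 0 < x) (j : ℕ) : dIter f₀ j x ≤ 1 :=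
  Finset.prod_le_one (fun k _ => (hA.dg₀_pos (hA.iterate_g₀_pos hx k)).le)
    fun k _ => (hA.dg₀_lt_one (hA.iterate_g₀_pos hx k)).le

lemma g₀_one_pos (hA : AssumptionA f₀) : 0 < g₀ f₀ 1 := (hA.g₀_mem one_pos).1

lemma pos_of_mem (hA : AssumptionA f₀) {x : ℝ} (hx : x ∈ Ioo (g₀ f₀ 1) 1) : 0 < x :=
  hA.g₀_one_pos.trans hx.1

/-- Since `g₀(1) < x`, the point `g₀^j(x)` is at least `g₀^(j+1)(1)`, and `g₀'` is decreasing. The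
shift by one gives the product of (B), which starts at `j = 1`. -/
lemma dIter_le (hA : AssumptionA f₀) {x : ℝ} (hx : x ∈ Ioo (g₀ f₀ 1) 1) (k : ℕ) :
    dIter f₀ k x ≤ ∏ j ∈ Finset.Ico 1 (k + 1), deriv (g₀ f₀) ((g₀ f₀)^[j] 1) := by
  rw [Finset.prod_Ico_eq_prod_range]
  refine Finset.prod_le_prod (fun j _ => (hA.dg₀_pos (hA.iterate_g₀_pos (hA.pos_of_mem hx) j)).le)
    fun j _ => ?_
  rw [add_comm 1 j, (hA.hasDerivAt_g₀ (hA.iterate_g₀_pos one_pos _)).deriv]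
  refine hA.dg₀_anti (hA.iterate_g₀_pos one_pos _) ?_
  rw [Function.iterate_succ_apply]
  exact hA.monotone_g₀.iterate j hx.1.le

lemma iterate_mem_Ioo (hA : AssumptionA f₀) {x : ℝ} (hx : x ∈ Ioo (g₀ f₀ 1) 1) (j : ℕ) :
    (g₀ f₀)^[j] x ∈ Ioo (0 : ℝ) 1 :=
  ⟨hA.iterate_g₀_pos (hA.pos_of_mem hx) j, (hA.iterate_g₀_le (hA.pos_of_mem hx) j).trans_lt hx.2⟩

lemma mapsTo_phi (hA : AssumptionA f₀) (c : ℕ × ℕ) :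
    MapsTo (phi f₀ c) (Ioo (g₀ f₀ 1) 1) (Ioo (g₀ f₀ 1) 1) := by
  intro x hx
  have h := hA.iterate_mem_Ioo hx c.2
  have h0 : (0 : ℝ) ≤ c.1 := Nat.cast_nonneg _
  have h1 : (1 : ℝ) < (g₀ f₀)^[c.2] x + (c.1 + 1) := by linarith [h.1]
  exact ⟨hA.strictMonoOn_g₀ (mem_Ioi.2 one_pos) (mem_Ioi.2 (one_pos.trans h1)) h1,
    (hA.g₀_mem (one_pos.trans h1)).2⟩

lemma dphi_le (hA : AssumptionA f₀) (c : ℕ × ℕ) {x : ℝ} (hx : x ∈ Ioo (g₀ f₀ 1) 1) :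
    dphi f₀ c x ≤ dg₀ f₀ (c.1 + 1) * dIter f₀ c.2 x := by
  have h := hA.iterate_mem_Ioo hx c.2
  refine mul_le_mul_of_nonneg_right (hA.dg₀_anti (by positivity) (by linarith [h.1]))
    (hA.dIter_pos (hA.pos_of_mem hx) _).le

lemma isOpen_image_iterate_g₀ (hA : AssumptionA f₀) {U : Set ℝ} (hU : U ⊆ Ioi 0) (hUo : IsOpen U)
    (j : ℕ) : IsOpen ((g₀ f₀)^[j] '' U) := by
  induction j with
  | zero => simpa using hUo
  | succ j ih =>
    rw [Function.iterate_succ', image_comp]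
    refine hA.isOpen_image_g₀ ?_ ih
    rintro _ ⟨x, hx, rfl⟩
    exact hA.iterate_g₀_pos (hU hx) j

lemma isOpen_image_phi (hA : AssumptionA f₀) {U : Set ℝ} (hU : U ⊆ Ioi 0) (hUo : IsOpen U)
    (c : ℕ × ℕ) : IsOpen (phi f₀ c '' U) := by
  have : phi f₀ c = g₀ f₀ ∘ (fun y => y + ((c.1 : ℝ) + 1)) ∘ (g₀ f₀)^[c.2] := rfl
  rw [this, image_comp, image_comp]
  refine hA.isOpen_image_g₀ ?_ ((Homeomorph.addRight ((c.1 : ℝ) + 1)).isOpenMap _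
    (hA.isOpen_image_iterate_g₀ hU hUo _))
  rintro _ ⟨_, ⟨x, hx, rfl⟩, rfl⟩
  have := hA.iterate_g₀_pos (hU hx) c.2
  have : (0 : ℝ) < (g₀ f₀)^[c.2] x + (c.1 + 1) := by positivity
  exact this

/-! ### Orbits -/

lemma f_of_mem {x : ℝ} (hx : x ∈ Ioo (0 : ℝ) 1) : f f₀ x = f₀ x := if_pos hx

lemma P₀_g₀ (hA : AssumptionA f₀) {t : ℝ} (ht : 0 < t) (y : ℝ) :
    P₀ f₀ (g₀ f₀ t, y) = (t, g₀ f₀ y) := by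
  have h := hA.g₀_mem ht
  simp only [P₀, g, f_of_mem h, hA.apply_g₀ ht, if_pos h.2]

lemma P₀_of_one_lt {x : ℝ} (hx : 1 < x) (y : ℝ) : P₀ f₀ (x, y) = (x - 1, y + 1) := by
  have h1 : x ∉ Ioo (0 : ℝ) 1 := fun h => h.2.not_gt hx
  simp only [P₀, f, g, if_neg h1, if_pos hx, if_neg hx.not_gt]

lemma P₀_iterate_add {t : ℝ} (ht : 0 < t) (n k : ℕ) (y : ℝ) :
    (P₀ f₀)^[k] (t + (n + k : ℕ), y) = (t + n, y + k) := by
  induction k generalizing y with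
  | zero => simp
  | succ k ih =>
    have h0 : (0 : ℝ) ≤ (n + k : ℕ) := Nat.cast_nonneg _
    have h1 : 1 < t + (n + (k + 1) : ℕ) := by push_cast at h0 ⊢; linarith
    rw [Function.iterate_succ_apply, P₀_of_one_lt h1,
      show t + ((n + (k + 1) : ℕ) : ℝ) - 1 = t + ((n + k : ℕ) : ℝ) by push_cast; ring, ih]
    congr 1
    push_cast; ring

lemma P₀_iterate_fst (n : ℕ) (z : ℝ × ℝ) : ((P₀ f₀)^[n] z).1 = (f f₀)^[n] z.1 := by
  induction n with
  | zero => rfl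
  | succ n ih => rw [Function.iterate_succ_apply', Function.iterate_succ_apply', ← ih]; rfl

lemma P₁_fst (z : ℝ × ℝ) : (P₁ f₀ z).1 = F f₀ z.1 := P₀_iterate_fst _ _

lemma P₁_iterate_fst (n : ℕ) (z : ℝ × ℝ) : ((P₁ f₀)^[n] z).1 = (F f₀)^[n] z.1 := by
  induction n with
  | zero => rfl
  | succ n ih => rw [Function.iterate_succ_apply', Function.iterate_succ_apply', ← ih, P₁_fst]

lemma Phat_fst (z : ℝ × ℝ) : (Phat f₀ z).1 = Fhat f₀ z.1 := P₁_iterate_fst _ _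

lemma Phat_iterate_fst (n : ℕ) (z : ℝ × ℝ) : ((Phat f₀)^[n] z).1 = (Fhat f₀)^[n] z.1 := by
  induction n with
  | zero => rfl
  | succ n ih => rw [Function.iterate_succ_apply', Function.iterate_succ_apply', ← ih, Phat_fst]

/-- The first steps of an orbit that starts in `(g₀(n), g₀(n+1))`. -/
lemma P₀_iterate_succ (hA : AssumptionA f₀) {t : ℝ} (ht : 0 < t) {n k : ℕ} (hk : k ≤ n) (y : ℝ) :
    (P₀ f₀)^[k + 1] (g₀ f₀ (t + n), y) = (t + (n - k : ℕ), g₀ f₀ y + k) := by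
  have : 0 < t + n := by positivity
  rw [Function.iterate_succ_apply, hA.P₀_g₀ this]
  have := P₀_iterate_add (f₀ := f₀) ht (n - k) k (g₀ f₀ y)
  rwa [Nat.sub_add_cancel hk] at this

/-- From `g₀(t + n)` the orbit jumps to `t + n` and descends by unit steps, staying above `1` until
it reaches `t`. -/
lemma tau_eq (hA : AssumptionA f₀) {t : ℝ} (ht : t ∈ Ioo (0 : ℝ) 1) (n : ℕ) :
    τ f₀ (g₀ f₀ (t + n)) = n + 1 := by
  have key : ∀ k ≤ n, (f f₀)^[k + 1] (g₀ f₀ (t + n)) = t + (n - k : ℕ) := fun k hk => by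
    have := P₀_iterate_fst (f₀ := f₀) (k + 1) (g₀ f₀ (t + n), 0)
    rw [hA.P₀_iterate_succ ht.1 hk] at this
    exact this.symm
  refine returnTime_eq (by omega) ?_ fun j hj hjn hmem => ?_
  · rw [key n le_rfl]; simpa using ht
  · obtain ⟨k, rfl⟩ : ∃ k, j = k + 1 := ⟨j - 1, by omega⟩
    rw [key k (by omega)] at hmem
    have : (1 : ℝ) ≤ (n - k : ℕ) := by exact_mod_cast (by omega : 1 ≤ n - k)
    linarith [hmem.2, ht.1]

lemma P₁_eq (hA : AssumptionA f₀) {t : ℝ} (ht : t ∈ Ioo (0 : ℝ) 1) (n : ℕ) (y : ℝ) :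
    P₁ f₀ (g₀ f₀ (t + n), y) = (t, g₀ f₀ y + n) := by
  rw [P₁]
  simp only [hA.tau_eq ht]
  rw [hA.P₀_iterate_succ ht.1 le_rfl]
  simp

lemma F_eq (hA : AssumptionA f₀) {t : ℝ} (ht : t ∈ Ioo (0 : ℝ) 1) (n : ℕ) :
    F f₀ (g₀ f₀ (t + n)) = t := by
  rw [← P₁_fst (g₀ f₀ (t + n), 0), hA.P₁_eq ht]

variable {x : ℝ}

lemma P₁_iterate_eq (hA : AssumptionA f₀) (hx : x ∈ Ioo (g₀ f₀ 1) 1) (k l : ℕ) (y : ℝ) :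
    (P₁ f₀)^[k] ((g₀ f₀)^[l + k] x, y) = ((g₀ f₀)^[l] x, (g₀ f₀)^[k] y) := by
  induction k generalizing y with
  | zero => rfl
  | succ k ih =>
    have := hA.P₁_eq (hA.iterate_mem_Ioo hx (l + k)) 0 y
    rw [Nat.cast_zero, add_zero, add_zero] at this
    rw [Function.iterate_succ_apply, ← add_assoc, Function.iterate_succ_apply' _ (l + k), this, ih,
      ← Function.iterate_succ_apply]

lemma P₀_iterate_eq (hA : AssumptionA f₀) (hx : x ∈ Ioo (g₀ f₀ 1) 1) (k l : ℕ) (y : ℝ) :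
    (P₀ f₀)^[k] ((g₀ f₀)^[l + k] x, y) = ((g₀ f₀)^[l] x, (g₀ f₀)^[k] y) := by
  induction k generalizing y with
  | zero => rfl
  | succ k ih =>
    rw [Function.iterate_succ_apply, ← add_assoc, Function.iterate_succ_apply' _ (l + k),
      hA.P₀_g₀ (hA.iterate_mem_Ioo hx (l + k)).1, ih, ← Function.iterate_succ_apply]

lemma iterate_succ_notMem (hA : AssumptionA f₀) (hx : x ∈ Ioo (g₀ f₀ 1) 1) (l : ℕ) :
    (g₀ f₀)^[l + 1] x ∉ Ioo (g₀ f₀ 1) 1 := by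
  intro h
  rw [Function.iterate_succ_apply'] at h
  exact (hA.monotone_g₀ (hA.iterate_mem_Ioo hx l).2.le).not_gt h.1

lemma phi_eq (c : ℕ × ℕ) (x : ℝ) : phi f₀ c x = g₀ f₀ ((g₀ f₀)^[c.2] x + (c.1 + 1 : ℕ)) := by
  rw [phi]; push_cast; rfl

lemma tau_phi (hA : AssumptionA f₀) (c : ℕ × ℕ) (hx : x ∈ Ioo (g₀ f₀ 1) 1) :
    τ f₀ (phi f₀ c x) = c.1 + 2 := by
  rw [phi_eq, hA.tau_eq (hA.iterate_mem_Ioo hx c.2)]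

lemma F_phi (hA : AssumptionA f₀) (c : ℕ × ℕ) (hx : x ∈ Ioo (g₀ f₀ 1) 1) :
    F f₀ (phi f₀ c x) = (g₀ f₀)^[c.2] x := by
  rw [phi_eq, hA.F_eq (hA.iterate_mem_Ioo hx c.2)]

/-- After one step `F` is at `g₀^j(x)` with `j = c.2`, and each further step removes one `g₀`. All
`g₀^l(x)` with `l ≥ 1` lie below `g₀(1)`. -/
lemma kappa_phi (hA : AssumptionA f₀) (c : ℕ × ℕ) (hx : x ∈ Ioo (g₀ f₀ 1) 1) :
    κ f₀ (phi f₀ c x) = c.2 + 1 := by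
  have key : ∀ k ≤ c.2, (F f₀)^[k + 1] (phi f₀ c x) = (g₀ f₀)^[c.2 - k] x := fun k hk => by
    rw [Function.iterate_succ_apply, hA.F_phi c hx]
    have := P₁_iterate_fst (f₀ := f₀) k ((g₀ f₀)^[c.2 - k + k] x, 0)
    rw [hA.P₁_iterate_eq hx, Nat.sub_add_cancel hk] at this
    exact this.symm
  refine returnTime_eq (by omega) ?_ fun j hj hjn => ?_
  · rw [key c.2 le_rfl]; simpa using hx
  · obtain ⟨k, rfl⟩ : ∃ k, j = k + 1 := ⟨j - 1, by omega⟩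
    rw [key k (by omega), show c.2 - k = (c.2 - k - 1) + 1 by omega]
    exact hA.iterate_succ_notMem hx _

/-- The skew product structure: the action on `y` involves the branch `c` but not the point `x`. -/
lemma Phat_phi (hA : AssumptionA f₀) (c : ℕ × ℕ) (hx : x ∈ Ioo (g₀ f₀ 1) 1) (y : ℝ) :
    Phat f₀ (phi f₀ c x, y) = (x, (g₀ f₀)^[c.2] (g₀ f₀ y + (c.1 + 1))) := by
  rw [Phat]
  simp only [hA.kappa_phi c hx]
  rw [Function.iterate_succ_apply, phi_eq, hA.P₁_eq (hA.iterate_mem_Ioo hx c.2)]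
  have := hA.P₁_iterate_eq hx c.2 0 (g₀ f₀ y + (c.1 + 1 : ℕ))
  rw [zero_add] at this
  rw [this]
  push_cast
  rfl

lemma Fhat_phi (hA : AssumptionA f₀) (c : ℕ × ℕ) (hx : x ∈ Ioo (g₀ f₀ 1) 1) :
    Fhat f₀ (phi f₀ c x) = x := by
  rw [← Phat_fst (phi f₀ c x, 0), hA.Phat_phi c hx]

/-- `P̂` is the first return map of `𝒫` to the strip over `(g₀(1), 1)`. -/
lemma firstReturn_phi (hA : AssumptionA f₀) (c : ℕ × ℕ) (hx : x ∈ Ioo (g₀ f₀ 1) 1) (y : ℝ) :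
    (P₀ f₀)^[c.1 + c.2 + 2] (phi f₀ c x, y) = Phat f₀ (phi f₀ c x, y) ∧
    ∀ k, 1 ≤ k → k < c.1 + c.2 + 2 →
      ((P₀ f₀)^[k] (phi f₀ c x, y)).1 ∉ Ioo (g₀ f₀ 1) 1 := by
  have hm := hA.iterate_mem_Ioo hx c.2
  have hlate : ∀ l ≤ c.2, (P₀ f₀)^[l + (c.1 + 2)] (phi f₀ c x, y) =
      ((g₀ f₀)^[c.2 - l] x, (g₀ f₀)^[l] (g₀ f₀ y + (c.1 + 1 : ℕ))) := fun l hl => by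
    rw [Function.iterate_add_apply, phi_eq,
      hA.P₀_iterate_succ (n := c.1 + 1) (k := c.1 + 1) hm.1 le_rfl, Nat.sub_self, Nat.cast_zero,
      add_zero]
    have := hA.P₀_iterate_eq hx l (c.2 - l) (g₀ f₀ y + (c.1 + 1 : ℕ))
    rwa [Nat.sub_add_cancel hl] at this
  constructor
  · rw [show c.1 + c.2 + 2 = c.2 + (c.1 + 2) by ring, hlate c.2 le_rfl, hA.Phat_phi c hx]
    simp
  · intro k hk hkn hmem
    -- During the descent the first coordinate exceeds `1`; afterwards it is some `g₀^l(x)` with `l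
    -- ≥ 1`, below `g₀(1)`.
    rcases le_or_gt k (c.1 + 1) with h | h
    · obtain ⟨l, rfl⟩ : ∃ l, k = l + 1 := ⟨k - 1, by omega⟩
      rw [phi_eq, hA.P₀_iterate_succ (n := c.1 + 1) hm.1 (by omega)] at hmem
      have : (1 : ℝ) ≤ (c.1 + 1 - l : ℕ) := by exact_mod_cast (by omega : 1 ≤ c.1 + 1 - l)
      have h2 := hmem.2
      simp only at h2
      linarith [hm.1]
    · obtain ⟨l, rfl⟩ : ∃ l, k = l + (c.1 + 2) := ⟨k - (c.1 + 2), by omega⟩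
      rw [hlate l (by omega), show c.2 - l = (c.2 - l - 1) + 1 by omega] at hmem
      exact hA.iterate_succ_notMem hx _ hmem

/-! ### The sets `J`, `Δ` and `Δ̃` -/

lemma exists_iterate_eq (hA : AssumptionA f₀) {u v t : ℝ} (hu : 0 < u) (huv : u < v) (j : ℕ)
    (ht : t ∈ Ioo ((g₀ f₀)^[j] u) ((g₀ f₀)^[j] v)) : ∃ z ∈ Ioo u v, (g₀ f₀)^[j] z = t := by
  induction j generalizing t with
  | zero => exact ⟨t, ht, rfl⟩
  | succ j ih =>
    rw [Function.iterate_succ_apply', Function.iterate_succ_apply'] at ht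
    have hu' := hA.iterate_g₀_pos hu j
    have hv' := hA.iterate_g₀_pos (hu.trans huv) j
    have ht1 : t ∈ Ioo (0 : ℝ) 1 :=
      ⟨(hA.g₀_mem hu').1.trans ht.1, ht.2.trans (hA.g₀_mem hv').2⟩
    have e := hA.g₀_apply ht1
    have hp := hA.mapsTo ht1
    rw [← e] at ht
    obtain ⟨z, hz, hzt⟩ := ih (t := f₀ t) ⟨(hA.strictMonoOn_g₀.lt_iff_lt hu' hp).1 ht.1,
      (hA.strictMonoOn_g₀.lt_iff_lt hp hv').1 ht.2⟩
    exact ⟨z, hz, by rw [Function.iterate_succ_apply', hzt, e]⟩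

/-- On `I_{i+2}` the map `F` is `f₀ - (i + 1)`, and the points of the target interval are the
`g₀^j(z)` with `z ∈ (g₀(1), 1)`. Hence every branch is full. -/
lemma J_eq (hA : AssumptionA f₀) (i j : ℕ) :
    J f₀ (i + 2) (j + 1) = phi f₀ (i, j) '' Ioo (g₀ f₀ 1) 1 := by
  have hi : (0 : ℝ) ≤ i := Nat.cast_nonneg i
  ext x
  simp only [J, I, mem_ofPred_eq, Nat.add_sub_cancel]
  have ei : (((i + 2 : ℕ) : ℝ) - 1) = i + 1 := by push_cast; ring
  have ei2 : ((i + 2 : ℕ) : ℝ) = i + 1 + 1 := by push_cast; ring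
  rw [ei, ei2, Function.iterate_succ_apply]
  constructor
  · rintro ⟨hx, hF⟩
    have hx1 : x ∈ Ioo (0 : ℝ) 1 :=
      ⟨(hA.g₀_mem (by positivity)).1.trans hx.1, hx.2.trans (hA.g₀_mem (by positivity)).2⟩
    have e := hA.g₀_apply hx1
    have hp := hA.mapsTo hx1
    rw [← e] at hx
    have h1 := (hA.strictMonoOn_g₀.lt_iff_lt (show (0 : ℝ) < i + 1 by positivity) hp).1 hx.1
    have h2 := (hA.strictMonoOn_g₀.lt_iff_lt hp (show (0 : ℝ) < i + 1 + 1 by positivity)).1 hx.2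
    have ht : f₀ x - (i + 1) ∈ Ioo (0 : ℝ) 1 := ⟨by linarith, by linarith⟩
    have e2 : x = g₀ f₀ (f₀ x - (i + 1) + (i + 1 : ℕ)) := by
      rw [Nat.cast_add_one, sub_add_cancel, e]
    have e3 : F f₀ x = f₀ x - (i + 1) := by
      conv_lhs => rw [e2]
      exact hA.F_eq ht (i + 1)
    rw [e3] at hF
    obtain ⟨z, hz, hzt⟩ := hA.exists_iterate_eq hA.g₀_one_pos (hA.g₀_lt one_pos) j hF
    exact ⟨z, hz, by rw [phi, hzt, sub_add_cancel, e]⟩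
  · rintro ⟨z, hz, rfl⟩
    have hm := hA.iterate_mem_Ioo hz j
    have hzp := hA.pos_of_mem hz
    rw [hA.F_phi (i, j) hz]
    refine ⟨⟨?_, ?_⟩, hA.strictMonoOn_iterate_g₀ j hA.g₀_one_pos hzp hz.1,
      hA.strictMonoOn_iterate_g₀ j hzp (mem_Ioi.2 one_pos) hz.2⟩
    · exact hA.strictMonoOn_g₀ (show (0 : ℝ) < i + 1 by positivity)
        (show 0 < (g₀ f₀)^[j] z + ((i : ℝ) + 1) by linarith [hm.1])
        (show (i : ℝ) + 1 < (g₀ f₀)^[j] z + ((i : ℝ) + 1) by linarith [hm.1])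
    · exact hA.strictMonoOn_g₀ (show 0 < (g₀ f₀)^[j] z + ((i : ℝ) + 1) by linarith [hm.1])
        (show (0 : ℝ) < i + 1 + 1 by positivity)
        (show (g₀ f₀)^[j] z + ((i : ℝ) + 1) < i + 1 + 1 by linarith [hm.2])

lemma Δ_eq (hA : AssumptionA f₀) : Δ f₀ = ⋃ c, phi f₀ c '' Ioo (g₀ f₀ 1) 1 := by
  ext x
  simp only [Δ, mem_ofPred_eq, mem_iUnion]
  constructor
  · rintro ⟨s, q, hs, hq, hx⟩
    obtain ⟨i, rfl⟩ : ∃ i, s = i + 2 := ⟨s - 2, by omega⟩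
    obtain ⟨j, rfl⟩ : ∃ j, q = j + 1 := ⟨q - 1, by omega⟩
    exact ⟨(i, j), hA.J_eq i j ▸ hx⟩
  · rintro ⟨⟨i, j⟩, hx⟩
    exact ⟨i + 2, j + 1, by omega, by omega, (hA.J_eq i j).symm ▸ hx⟩

lemma Δtilde_eq (hA : AssumptionA f₀) :
    Δtilde f₀ = ⋃ c, phi f₀ c '' (⋃ c', phi f₀ c' '' Ioo (g₀ f₀ 1) 1) := by
  ext x
  simp only [Δtilde, mem_ofPred_eq, mem_iUnion]
  constructor
  · rintro ⟨s₀, s₁, q₀, q₁, hs₀, hs₁, hq₀, hq₁, hx, hx'⟩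
    obtain ⟨i, rfl⟩ : ∃ i, s₀ = i + 2 := ⟨s₀ - 2, by omega⟩
    obtain ⟨j, rfl⟩ : ∃ j, q₀ = j + 1 := ⟨q₀ - 1, by omega⟩
    obtain ⟨i', rfl⟩ : ∃ i, s₁ = i + 2 := ⟨s₁ - 2, by omega⟩
    obtain ⟨j', rfl⟩ : ∃ j, q₁ = j + 1 := ⟨q₁ - 1, by omega⟩
    rw [hA.J_eq] at hx
    obtain ⟨z, hz, rfl⟩ := hx
    rw [mem_preimage, hA.Fhat_phi _ hz, hA.J_eq] at hx'
    exact ⟨(i, j), z, mem_iUnion.2 ⟨(i', j'), hx'⟩, rfl⟩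
  · rintro ⟨⟨i, j⟩, z, hz, rfl⟩
    obtain ⟨⟨i', j'⟩, hz'⟩ := mem_iUnion.1 hz
    have hzA : z ∈ Ioo (g₀ f₀ 1) 1 := by
      obtain ⟨w, hw, rfl⟩ := hz'
      exact hA.mapsTo_phi _ hw
    refine ⟨i + 2, i' + 2, j + 1, j' + 1, by omega, by omega, by omega, by omega, ?_, ?_⟩
    · rw [hA.J_eq]; exact ⟨z, hzA, rfl⟩
    · rw [mem_preimage, hA.Fhat_phi _ hzA, hA.J_eq]; exact hz'

lemma Δ_subset (hA : AssumptionA f₀) : Δ f₀ ⊆ Ioo (g₀ f₀ 1) 1 := by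
  rw [hA.Δ_eq]
  exact iUnion_subset fun c => (hA.mapsTo_phi c).image_subset

lemma Δtilde_subset_Δ (hA : AssumptionA f₀) : Δtilde f₀ ⊆ Δ f₀ := by
  rw [hA.Δtilde_eq, hA.Δ_eq]
  refine iUnion_mono fun c => image_mono ?_
  exact iUnion_subset fun c => (hA.mapsTo_phi c).image_subset

lemma Ioo_subset_Ioi (hA : AssumptionA f₀) : Ioo (g₀ f₀ 1) 1 ⊆ Ioi 0 := fun _ hx =>
  hA.pos_of_mem hx

lemma isOpen_Δ (hA : AssumptionA f₀) : IsOpen (Δ f₀) := by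
  rw [hA.Δ_eq]
  exact isOpen_iUnion fun c => hA.isOpen_image_phi hA.Ioo_subset_Ioi isOpen_Ioo c

lemma isOpen_Δtilde (hA : AssumptionA f₀) : IsOpen (Δtilde f₀) := by
  rw [hA.Δtilde_eq, ← hA.Δ_eq]
  exact isOpen_iUnion fun c => hA.isOpen_image_phi (hA.Δ_subset.trans hA.Ioo_subset_Ioi) hA.isOpen_Δ c

lemma Fhat_mem_Δ (hA : AssumptionA f₀) (hx : x ∈ Δtilde f₀) : Fhat f₀ x ∈ Δ f₀ := by
  rw [hA.Δtilde_eq, ← hA.Δ_eq] at hx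
  obtain ⟨c, z, hz, rfl⟩ := mem_iUnion.1 hx
  rwa [hA.Fhat_phi c (hA.Δ_subset hz)]

/-- Outside a countable set every point of `(0, ∞)` is of the form `g₀^j(z) + n` with
`z ∈ (g₀(1), 1)`. -/
lemma exists_eq_iterate_add (hA : AssumptionA f₀) (hx : 0 < x)
    (hZ : x ∉ range fun p : ℕ × ℕ => (p.1 : ℝ) + (g₀ f₀)^[p.2] 1) :
    ∃ n j : ℕ, ∃ z ∈ Ioo (g₀ f₀ 1) 1, x = (g₀ f₀)^[j] z + n := by
  set n := ⌊x⌋₊ with hn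
  have h1 : (n : ℝ) ≤ x := Nat.floor_le hx.le
  have h2 : x < n + 1 := Nat.lt_floor_add_one x
  have hne : (n : ℝ) ≠ x := by
    intro h
    have h3 : n ≠ 0 := by rintro h0; rw [h0, Nat.cast_zero] at h; exact hx.ne h
    obtain ⟨k, hk⟩ := Nat.exists_eq_succ_of_ne_zero h3
    exact hZ ⟨(k, 0), by simp [← h, hk]⟩
  have ht : 0 < x - n := sub_pos.2 (lt_of_le_of_ne h1 hne)
  have hex : ∃ j, (g₀ f₀)^[j] 1 ≤ x - n :=
    ((hA.tendsto_iterate_g₀_one.eventually (gt_mem_nhds ht)).exists).imp fun _ h => le_of_lt h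
  classical
  have hspec := Nat.find_spec hex
  have hpos : Nat.find hex ≠ 0 := by
    intro h0
    rw [h0, Function.iterate_zero, id] at hspec
    linarith
  obtain ⟨j, hj⟩ := Nat.exists_eq_succ_of_ne_zero hpos
  have hlt : x - n < (g₀ f₀)^[j] 1 := not_le.1 (Nat.find_min hex (by omega))
  rw [hj] at hspec
  have hlt' : (g₀ f₀)^[j] (g₀ f₀ 1) < x - n := by
    rw [← Function.iterate_succ_apply]
    refine lt_of_le_of_ne hspec fun h => hZ ⟨(n, j + 1), ?_⟩
    simp only
    rw [Nat.succ_eq_add_one] at h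
    rw [h]; ring
  obtain ⟨z, hz, hzt⟩ := hA.exists_iterate_eq hA.g₀_one_pos (hA.g₀_lt one_pos) j ⟨hlt', hlt⟩
  exact ⟨n, j, z, hz, by rw [hzt]; ring⟩

/-- Here `f₀ x > 1`, so outside a countable set `f₀ x = g₀^j(z) + n` with `n ≥ 1`, which puts `x` on
the branch `(n - 1, j)`. -/
lemma countable_diff_Δ (hA : AssumptionA f₀) : (Ioo (g₀ f₀ 1) 1 \ Δ f₀).Countable := by
  refine ((countable_range fun p : ℕ × ℕ => (p.1 : ℝ) + (g₀ f₀)^[p.2] 1).image (g₀ f₀)).mono ?_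
  rintro x ⟨hx, hxΔ⟩
  by_contra hcon
  have hx1 : x ∈ Ioo (0 : ℝ) 1 := ⟨hA.pos_of_mem hx, hx.2⟩
  have e := hA.g₀_apply hx1
  have hp := hA.mapsTo hx1
  obtain ⟨n, j, z, hz, hzx⟩ := hA.exists_eq_iterate_add hp fun h => hcon ⟨_, h, e⟩
  have h1 : 1 < f₀ x := by
    rw [← hA.strictMonoOn_g₀.lt_iff_lt (mem_Ioi.2 one_pos) hp, e]; exact hx.1
  have hn : n ≠ 0 := by
    rintro rfl
    rw [Nat.cast_zero, add_zero] at hzx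
    linarith [(hA.iterate_mem_Ioo hz j).2]
  obtain ⟨i, rfl⟩ := Nat.exists_eq_succ_of_ne_zero hn
  apply hxΔ
  rw [hA.Δ_eq]
  refine mem_iUnion.2 ⟨(i, j), z, hz, ?_⟩
  rw [phi_eq, ← e, hzx]

lemma countable_diff_Δtilde (hA : AssumptionA f₀) :
    (Ioo (g₀ f₀ 1) 1 \ Δtilde f₀).Countable := by
  refine (hA.countable_diff_Δ.union
    (countable_iUnion fun c => hA.countable_diff_Δ.image (phi f₀ c))).mono ?_
  rintro x ⟨hx, hxΔ⟩
  by_cases h : x ∈ Δ f₀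
  · right
    rw [hA.Δ_eq] at h
    obtain ⟨c, z, hz, rfl⟩ := mem_iUnion.1 h
    refine mem_iUnion.2 ⟨c, z, ⟨hz, fun hzΔ => hxΔ ?_⟩, rfl⟩
    rw [hA.Δtilde_eq, ← hA.Δ_eq]
    exact mem_iUnion.2 ⟨c, z, hzΔ, rfl⟩
  · exact Or.inl ⟨hx, h⟩

end AssumptionA

/-! ### The system of inverse branches of `F̂` -/

/-- As `ω` takes values in `(0, 1)`, it is at most `ω ^ (1 - σ)`. -/
lemma IsRate.summable_succ {ω : ℕ → ℝ} {σ : ℝ} (h : IsRate ω σ) (hσ : σ ∈ Ioo (0 : ℝ) 1) :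
    Summable fun n => ω (n + 1) := by
  refine h.summable.of_nonneg_of_le (fun n => (h.mem_Ioo _ (by omega)).1.le) fun n => ?_
  have := h.mem_Ioo (n + 1) (by omega)
  conv_lhs => rw [← Real.rpow_one (ω (n + 1))]
  exact Real.rpow_le_rpow_of_exponent_ge this.1 this.2.le (by linarith [hσ.1])

namespace AssumptionA

variable {f₀ : ℝ → ℝ}

/-- The derivative of the branch `(i, j)` is at most `g₀'(i + 1)` times that of `g₀^j`. The two
clauses of (B) control these factors separately, so the product is summable over pairs. The
contraction rate is `g₀'(1)`, as the outer `g₀` acts above `1`. -/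
lemma exists_weightedIFS (hA : AssumptionA f₀) (hB : AssumptionB f₀) :
    ∃ S : WeightedIFS (ℕ × ℕ) (g₀ f₀ 1) 1, S.φ = phi f₀ ∧ S.p = dphi f₀ ∧ S.w = dphi f₀ := by
  obtain ⟨ω₁, ω₂, C₁, C₂, σ₁, σ₂, hC₁, hC₂, hσ₁, hσ₂, h₁, h₂, hb₁, hb₂⟩ := hB
  obtain ⟨M, hM0, hM⟩ := hA.exists_abs_ddg₀_le
  choose u₂ hu using hA.exists_branch_phi hM
  have hpos : ∀ {x}, x ∈ Ioo (g₀ f₀ 1) 1 → x ∈ Ioi (0 : ℝ) := fun hx => hA.pos_of_mem hx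
  have s₂ : Summable fun k => C₂ * ω₂ (k + 1) := (h₂.summable_succ hσ₂).mul_left _
  have s₁ : Summable fun k => C₁ * ω₁ (k + 2) :=
    (((summable_nat_add_iff 1).2 (h₁.summable_succ hσ₁))).mul_left _
  have n₁ : ∀ k, 0 ≤ C₁ * ω₁ (k + 2) := fun k => mul_nonneg hC₁.le (h₁.mem_Ioo _ (by omega)).1.le
  have n₂ : ∀ k, 0 ≤ C₂ * ω₂ (k + 1) := fun k => mul_nonneg hC₂.le (h₂.mem_Ioo _ (by omega)).1.le
  have d₂ : ∀ k, ∀ x ∈ Ioo (g₀ f₀ 1) 1, dIter f₀ k x ≤ C₂ * ω₂ (k + 1) := fun k x hx =>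
    (hA.dIter_le hx k).trans (hb₂ _ (by omega))
  have d₁ : ∀ k : ℕ, dg₀ f₀ (k + 1) ≤ C₁ * ω₁ (k + 2) := fun k => by
    have := hb₁ (k + 2) (by omega)
    rwa [show ((k + 2 : ℕ) : ℝ) - 1 = k + 1 by push_cast; ring,
      (hA.hasDerivAt_g₀ (by positivity)).deriv] at this
  have dpos : ∀ k : ℕ, 0 < dg₀ f₀ (k + 1) := fun k => hA.dg₀_pos (by positivity)
  exact ⟨{
    φ := phi f₀
    p := dphi f₀
    w := dphi f₀
    w' := u₂
    M := fun c => (C₁ * ω₁ (c.1 + 2)) * (C₂ * ω₂ (c.2 + 1))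
    -- The nonlinearity bounds of all branches are partial sums of this one series.
    K := M * ∑' k, C₂ * ω₂ (k + 1)
    lam := dg₀ f₀ 1
    mapsTo := hA.mapsTo_phi
    hasDerivAt_φ := fun c x hx => (hu c).hasDerivAt x (hpos hx)
    continuousOn_p := fun c x hx =>
      ((hu c).hasDerivAt₂ x (hpos hx)).continuousAt.continuousWithinAt
    p_pos := fun c x hx => (hu c).deriv_pos x (hpos hx)
    p_le := fun c x hx => (hA.dphi_le c hx).trans <| by
      have h3 : dg₀ f₀ (c.1 + 1) ≤ dg₀ f₀ 1 := hA.dg₀_anti one_pos (by simp)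
      nlinarith [dpos c.1, hA.dIter_le_one (hpos hx) c.2, hA.dIter_pos (hpos hx) c.2]
    lam_pos := hA.dg₀_pos one_pos
    lam_lt_one := hA.dg₀_lt_one one_pos
    hasDerivAt_w := fun c x hx => (hu c).hasDerivAt₂ x (hpos hx)
    continuousOn_w' := fun c => (hu c).cont.mono fun x hx => hpos hx
    w_pos := fun c x hx => (hu c).deriv_pos x (hpos hx)
    w_le := fun c x hx => (hA.dphi_le c hx).trans
      (mul_le_mul (d₁ _) (d₂ _ x hx) (hA.dIter_pos (hpos hx) _).le (n₁ _))
    summable_M := s₁.mul_of_nonneg s₂ n₁ n₂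
    K_nonneg := mul_nonneg hM0 (tsum_nonneg n₂)
    abs_w'_le := fun c x hx => ((hu c).abs_le x (hpos hx)).trans <| by
      refine mul_le_mul_of_nonneg_right (mul_le_mul_of_nonneg_left ?_ hM0)
        ((hu c).deriv_pos x (hpos hx)).le
      exact (Finset.sum_le_sum fun k _ => d₂ k x hx).trans
        (s₂.sum_le_tsum _ fun k _ => n₂ k) }, rfl, rfl, rfl⟩

lemma injOn_phi (hA : AssumptionA f₀) (c : ℕ × ℕ) : InjOn (phi f₀ c) (Ioo (g₀ f₀ 1) 1) :=
  fun x hx y hy h => by rw [← hA.Fhat_phi c hx, h, hA.Fhat_phi c hy]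

/-- The return times `τ` and `κ` determine the branch. -/
lemma pairwise_disjoint_image_phi (hA : AssumptionA f₀) :
    Pairwise (Function.onFun Disjoint fun c => phi f₀ c '' Ioo (g₀ f₀ 1) 1) := by
  intro c c' hcc
  refine disjoint_left.2 ?_
  rintro _ ⟨x, hx, rfl⟩ ⟨y, hy, e⟩
  have h1 := hA.tau_phi c hx
  have h2 := hA.kappa_phi c hx
  rw [← e, hA.tau_phi c' hy] at h1
  rw [← e, hA.kappa_phi c' hy] at h2
  exact hcc (Prod.ext (by omega) (by omega))

lemma Ioo_ae_eq_Δ (hA : AssumptionA f₀) : (Ioo (g₀ f₀ 1) 1 : Set ℝ) =ᵐ[volume] Δ f₀ :=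
  (ae_eq_of_subset_of_measure_ge hA.Δ_subset (by
    rw [← measure_inter_add_sdiff (Ioo (g₀ f₀ 1) 1) hA.isOpen_Δ.measurableSet,
      hA.countable_diff_Δ.measure_zero volume, add_zero]
    exact measure_mono inter_subset_right) hA.isOpen_Δ.measurableSet.nullMeasurableSet
    (by simp)).symm

/-- The images of the branches are disjoint and fill the interval up to a countable, hence null,
set; the rest is the change of variables on each branch. -/
lemma isBranchSystem (hA : AssumptionA f₀) {S : WeightedIFS (ℕ × ℕ) (g₀ f₀ 1) 1}
    (hφ : S.φ = phi f₀) (hp : S.p = dphi f₀) (hw : S.w = dphi f₀) : S.IsBranchSystem where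
  w_eq := hw.trans hp.symm
  lintegral_eq Γ hΓ := by
    have key : ∀ c, ∫⁻ x in phi f₀ c '' Ioo (g₀ f₀ 1) 1, Γ x =
        ∫⁻ x in Ioo (g₀ f₀ 1) 1, ENNReal.ofReal (S.p c x) * Γ (S.φ c x) := fun c => by
      rw [lintegral_image_eq_lintegral_abs_deriv_mul measurableSet_Ioo
        (fun x hx => hφ ▸ (S.hasDerivAt_φ c x hx).hasDerivWithinAt) (hA.injOn_phi c)]
      refine setLIntegral_congr_fun measurableSet_Ioo fun x hx => ?_
      simp only [abs_of_pos (S.p_pos c x hx), hφ]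
    rw [setLIntegral_congr hA.Ioo_ae_eq_Δ, hA.Δ_eq, lintegral_iUnion
      (fun c => (hA.isOpen_image_phi hA.Ioo_subset_Ioi isOpen_Ioo c).measurableSet)
      hA.pairwise_disjoint_image_phi, lintegral_tsum]
    · exact tsum_congr key
    · intro c
      have h1 : AEMeasurable (S.p c) (volume.restrict (Ioo (g₀ f₀ 1) 1)) :=
        (S.continuousOn_p c).aemeasurable measurableSet_Ioo
      have h2 : AEMeasurable (S.φ c) (volume.restrict (Ioo (g₀ f₀ 1) 1)) :=
        ContinuousOn.aemeasurable (fun x hx =>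
          (S.hasDerivAt_φ c x hx).continuousAt.continuousWithinAt) measurableSet_Ioo
      exact h1.ennreal_ofReal.mul (hΓ.comp_aemeasurable h2)

/-! ### The fibre maps of `P̂` -/

lemma psi_pos (hA : AssumptionA f₀) (c : ℕ × ℕ) (y : Ioi (0 : ℝ)) :
    0 < (g₀ f₀)^[c.2] (g₀ f₀ y + (c.1 + 1)) :=
  hA.iterate_g₀_pos (by have := (hA.g₀_mem y.2).1; positivity) _

/-- The fibre map of `P̂` over the branch `c`. -/
def psi (hA : AssumptionA f₀) (c : ℕ × ℕ) (y : Ioi (0 : ℝ)) : Ioi (0 : ℝ) :=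
  ⟨(g₀ f₀)^[c.2] (g₀ f₀ y + (c.1 + 1)), hA.psi_pos c y⟩

lemma measurable_psi (hA : AssumptionA f₀) (c : ℕ × ℕ) : Measurable (hA.psi c) :=
  ((hA.measurable_g₀.iterate c.2).comp
    ((hA.measurable_g₀.comp measurable_subtype_coe).add_const _)).subtype_mk

/-- As `g₀ y ∈ (0, 1)`, the fibre map forgets how large or how close to `0` the point `y` was. -/
lemma range_psi_subset (hA : AssumptionA f₀) (c : ℕ × ℕ) :
    ∃ K, IsCompact K ∧ range (hA.psi c) ⊆ K := by
  have h0 : (0 : ℝ) ≤ c.1 := Nat.cast_nonneg _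
  have hp : (0 : ℝ) < c.1 + 1 := by positivity
  refine ⟨Subtype.val ⁻¹' Icc ((g₀ f₀)^[c.2] (c.1 + 1)) ((g₀ f₀)^[c.2] (1 + (c.1 + 1))),
    ?_, ?_⟩
  · refine (Topology.IsInducing.subtypeVal.isCompact_preimage_iff ?_).2 isCompact_Icc
    rw [Subtype.range_coe]
    exact fun y hy => (hA.iterate_g₀_pos hp c.2).trans_le hy.1
  · rintro _ ⟨y, rfl⟩
    have hy := hA.g₀_mem y.2
    exact ⟨hA.monotone_g₀.iterate _ (by linarith [hy.1]),
      hA.monotone_g₀.iterate _ (by linarith [hy.2])⟩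

lemma dist_psi_le_one (hA : AssumptionA f₀) (c : ℕ × ℕ) (y y' : Ioi (0 : ℝ)) :
    dist (hA.psi c y) (hA.psi c y') ≤ 1 := by
  have h0 : (0 : ℝ) ≤ c.1 := Nat.cast_nonneg _
  have hy := hA.g₀_mem y.2
  have hy' := hA.g₀_mem y'.2
  refine (hA.abs_iterate_g₀_sub_le (by linarith [hy.1]) (by linarith [hy'.1]) c.2).trans ?_
  rw [abs_le]
  constructor <;> linarith [hy.1, hy'.1, hy.2, hy'.2]

lemma dist_psi_le (hA : AssumptionA f₀) (c : ℕ × ℕ) (y y' : Ioi (0 : ℝ)) :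
    dist (hA.psi c y) (hA.psi c y') ≤ dist y y' := by
  have h0 : (0 : ℝ) ≤ c.1 := Nat.cast_nonneg _
  have hy := hA.g₀_mem y.2
  have hy' := hA.g₀_mem y'.2
  refine (hA.abs_iterate_g₀_sub_le (by linarith [hy.1]) (by linarith [hy'.1]) c.2).trans ?_
  rw [add_sub_add_right_eq_sub]
  exact hA.abs_g₀_sub_le_abs_sub y.2 y'.2

lemma dist_psi_le_of_one_le (hA : AssumptionA f₀) (c : ℕ × ℕ) {y y' : Ioi (0 : ℝ)}
    (hy1 : (1 : ℝ) ≤ y) (hy1' : (1 : ℝ) ≤ y') :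
    dist (hA.psi c y) (hA.psi c y') ≤ dg₀ f₀ 1 * dist y y' := by
  have h0 : (0 : ℝ) ≤ c.1 := Nat.cast_nonneg _
  have hy := hA.g₀_mem y.2
  have hy' := hA.g₀_mem y'.2
  refine (hA.abs_iterate_g₀_sub_le (by linarith [hy.1]) (by linarith [hy'.1]) c.2).trans ?_
  rw [add_sub_add_right_eq_sub]
  exact hA.abs_g₀_sub_le one_pos hy1 hy1'

/-- One fibre map need not contract uniformly, since `g₀' → 1` at `0`. In a product of two, some
`g₀` acts on `[1, ∞)`, where its derivative is at most `g₀'(1)`: the first `g₀` of the outer map if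
`j = 0`, and the one right after the translation in the inner map if `j ≥ 1`. -/
lemma dist_psi_psi_le (hA : AssumptionA f₀) (c c' : ℕ × ℕ) (y y' : Ioi (0 : ℝ)) :
    dist (hA.psi c (hA.psi c' y)) (hA.psi c (hA.psi c' y')) ≤ dg₀ f₀ 1 * dist y y' := by
  have h0 : (0 : ℝ) ≤ c'.1 := Nat.cast_nonneg _
  have hy := hA.g₀_mem y.2
  have hy' := hA.g₀_mem y'.2
  have hl := (hA.dg₀_pos one_pos).le
  obtain ⟨i, j⟩ := c'
  simp only at h0
  cases j with
  | zero =>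
    refine (hA.dist_psi_le_of_one_le c ?_ ?_).trans
      (mul_le_mul_of_nonneg_left (hA.dist_psi_le _ _ _) hl)
    · change (1 : ℝ) ≤ g₀ f₀ y + (i + 1)
      linarith [hy.1]
    · change (1 : ℝ) ≤ g₀ f₀ y' + (i + 1)
      linarith [hy'.1]
  | succ j =>
    refine (hA.dist_psi_le _ _ _).trans ?_
    change |(g₀ f₀)^[j + 1] (g₀ f₀ y + (i + 1)) - (g₀ f₀)^[j + 1] (g₀ f₀ y' + (i + 1))| ≤ _
    have p1 : (1 : ℝ) ≤ g₀ f₀ y + (i + 1) := by linarith [hy.1]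
    have p2 : (1 : ℝ) ≤ g₀ f₀ y' + (i + 1) := by linarith [hy'.1]
    rw [Function.iterate_succ_apply, Function.iterate_succ_apply]
    refine (hA.abs_iterate_g₀_sub_le (hA.g₀_mem (by linarith)).1
      (hA.g₀_mem (by linarith)).1 j).trans ?_
    refine (hA.abs_g₀_sub_le one_pos p1 p2).trans (mul_le_mul_of_nonneg_left ?_ hl)
    rw [add_sub_add_right_eq_sub]
    exact hA.abs_g₀_sub_le_abs_sub y.2 y'.2

/-- The innermost map brings any two points within distance `1`; each pair of maps outside it
contributes a factor `g₀'(1)`. -/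
lemma dist_foldr_psi_le (hA : AssumptionA f₀) (n : ℕ) (l : List (ℕ × ℕ))
    (hl : l.length = 2 * n + 1) (y y' : Ioi (0 : ℝ)) :
    dist (l.foldr hA.psi y) (l.foldr hA.psi y') ≤ dg₀ f₀ 1 ^ n := by
  induction n generalizing l with
  | zero =>
    obtain ⟨c, rfl⟩ := List.length_eq_one_iff.1 hl
    simpa using hA.dist_psi_le_one c y y'
  | succ n ih =>
    match l, hl with
    | c :: c' :: t, hl =>
      rw [List.foldr_cons, List.foldr_cons, List.foldr_cons, List.foldr_cons, pow_succ']
      refine (hA.dist_psi_psi_le c c' _ _).trans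
        (mul_le_mul_of_nonneg_left (ih t ?_) (hA.dg₀_pos one_pos).le)
      simp only [List.length_cons] at hl
      omega

lemma contracting_psi (hA : AssumptionA f₀) (ε : ℝ) (hε : 0 < ε) :
    ∃ k, ∀ l : List (ℕ × ℕ), l.length = k → ∀ y y',
      dist (l.foldr hA.psi y) (l.foldr hA.psi y') ≤ ε := by
  obtain ⟨n, hn⟩ := exists_pow_lt_of_lt_one hε (hA.dg₀_lt_one one_pos)
  exact ⟨2 * n + 1, fun l hl y y' => (hA.dist_foldr_psi_le n l hl y y').trans hn.le⟩

/-- The word `l` is the itinerary of `x`, latest branch first. It depends on `x` only, so all points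
of a fibre share it. -/
lemma exists_foldr_psi_eq (hA : AssumptionA f₀) (n : ℕ) {x : ℝ}
    (hx : ∀ i < n, (Fhat f₀)^[i] x ∈ Δ f₀) :
    ∃ l : List (ℕ × ℕ), l.length = n ∧ ∀ y : Ioi (0 : ℝ),
      (Phat f₀)^[n] (x, (y : ℝ)) = ((Fhat f₀)^[n] x, ((l.foldr hA.psi y : Ioi (0 : ℝ)) : ℝ)) := by
  induction n with
  | zero => exact ⟨[], rfl, fun y => rfl⟩
  | succ n ih =>
    obtain ⟨l, hl, h⟩ := ih fun i hi => hx i (by omega)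
    have hm := hx n (by omega)
    rw [hA.Δ_eq] at hm
    obtain ⟨c, z, hz, hzx⟩ := mem_iUnion.1 hm
    refine ⟨c :: l, by simp [hl], fun y => ?_⟩
    rw [Function.iterate_succ_apply', h, ← hzx, hA.Phat_phi c hz, Function.iterate_succ_apply',
      ← hzx, hA.Fhat_phi c hz]
    rfl

end AssumptionA

/-! ### Measurability of the induced maps -/

namespace AssumptionA

variable {f₀ : ℝ → ℝ}

lemma measurable_f (hA : AssumptionA f₀) : Measurable (f f₀) := by
  classical
  -- `f₀` may be non-measurable outside `(0, 1)` and is cut off first.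
  have h1 : Measurable ((Ioo (0 : ℝ) 1).piecewise f₀ 0) :=
    hA.continuousOn.measurable_piecewise continuousOn_const measurableSet_Ioo
  have h2 : Measurable fun x : ℝ => if 1 < x then x - 1 else 0 :=
    (measurable_id.sub_const 1).ite measurableSet_Ioi measurable_const
  have e : f f₀ = (Ioo (0 : ℝ) 1).piecewise ((Ioo (0 : ℝ) 1).piecewise f₀ 0)
      fun x => if 1 < x then x - 1 else 0 := by
    funext x
    by_cases hx : x ∈ Ioo (0 : ℝ) 1
    · rw [f, if_pos hx, piecewise_eq_of_mem _ _ _ hx, piecewise_eq_of_mem _ _ _ hx]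
    · rw [f, if_neg hx, piecewise_eq_of_notMem _ _ _ hx]
  rw [e]
  exact h1.piecewise measurableSet_Ioo h2

lemma measurable_P₀ (hA : AssumptionA f₀) : Measurable (P₀ f₀) := by
  refine (hA.measurable_f.comp measurable_fst).prodMk ?_
  exact (hA.measurable_g₀.comp measurable_snd).ite (measurableSet_lt measurable_fst measurable_const)
    ((measurable_snd.add_const 1).ite (measurableSet_lt measurable_const measurable_fst)
      measurable_const)

lemma measurable_τ (hA : AssumptionA f₀) : Measurable (τ f₀) :=
  measurable_returnTime hA.measurable_f measurableSet_Ioo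

lemma measurable_F (hA : AssumptionA f₀) : Measurable (F f₀) :=
  measurable_iterate_apply hA.measurable_f hA.measurable_τ

lemma measurable_κ (hA : AssumptionA f₀) : Measurable (κ f₀) :=
  measurable_returnTime hA.measurable_F measurableSet_Ioo

lemma measurable_Fhat (hA : AssumptionA f₀) : Measurable (Fhat f₀) :=
  measurable_iterate_apply hA.measurable_F hA.measurable_κ

lemma measurable_Phat (hA : AssumptionA f₀) : Measurable (Phat f₀) :=
  measurable_iterate_apply (measurable_iterate_apply hA.measurable_P₀
    (hA.measurable_τ.comp measurable_fst)) (hA.measurable_κ.comp measurable_fst)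

lemma isOpen_Space (hA : AssumptionA f₀) : IsOpen (Space f₀) := hA.isOpen_Δtilde.prod isOpen_Ioi

lemma Ptilde_iterate (n : ℕ) : (Ptilde f₀)^[n] = (Phat f₀)^[2 * n] :=
  (Function.iterate_mul (Phat f₀) 2 n).symm

end AssumptionA

/-! ### The measure on the strip over `(g₀(1), 1)` -/

/-- The set `(g₀(1), 1) × ℝ`. -/
def strip (f₀ : ℝ → ℝ) : Set (ℝ × ℝ) := Prod.fst ⁻¹' Ioo (g₀ f₀ 1) 1

lemma measurableSet_strip {f₀ : ℝ → ℝ} : MeasurableSet (strip f₀) :=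
  measurable_fst measurableSet_Ioo

/-- A semiconjugacy pushes invariance forward. -/
lemma measurePreserving_map_of_semiconj {α β : Type*} [MeasurableSpace α] [MeasurableSpace β]
    {μ : Measure α} {R : α → α} {T : β → β} {q : α → β} (hR : MeasurePreserving R μ μ)
    (hT : Measurable T) (hq : Measurable q) (h : Function.Semiconj q R T) :
    MeasurePreserving T (μ.map q) (μ.map q) := by
  refine ⟨hT, ?_⟩
  rw [Measure.map_map hT hq, ← h.comp_eq, ← Measure.map_map hq hR.measurable, hR.map_eq]

namespace AssumptionC

variable {f₀ : ℝ → ℝ} {m : Measure (ℝ × ℝ)}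

lemma map_fst_absolutelyContinuous (hC : AssumptionC f₀ m) : m.map Prod.fst ≪ volume :=
  (hC.absolutelyContinuous.map measurable_fst).trans
    (Measure.quasiMeasurePreserving_fst (μ := (volume : Measure ℝ))
      (ν := (volume : Measure ℝ))).absolutelyContinuous

lemma ae_fst_notMem (hC : AssumptionC f₀ m) {Z : Set ℝ} (hZ : Z.Countable) :
    ∀ᵐ z ∂m, z.1 ∉ Z :=
  ae_of_ae_map measurable_fst.aemeasurable
    (hC.map_fst_absolutelyContinuous.ae_le (measure_eq_zero_iff_ae_notMem.1 (hZ.measure_zero volume)))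

lemma ae_mem (hC : AssumptionC f₀ m) : ∀ᵐ z ∂m, z ∈ Ioi (0 : ℝ) ×ˢ Ioi (0 : ℝ) :=
  hC.concentrated

lemma measure_strip_ne_top (hA : AssumptionA f₀) (hC : AssumptionC f₀ m) : m (strip f₀) ≠ ⊤ := by
  refine ne_top_of_le_ne_top (hC.finite _ _ hA.g₀_one_pos (hA.g₀_lt one_pos)).ne ?_
  refine measure_mono_ae ?_
  filter_upwards [hC.ae_mem] with z hz hs
  exact ⟨hs, hz.2⟩

/-- Almost every point is `(g₀^j(w) + n, y)` with `w ∈ (g₀(1), 1)` and enters the strip after `n +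
j` steps. If the strip were null, so would be all its preimages, hence everything. -/
lemma measure_strip_ne_zero (hA : AssumptionA f₀) (hC : AssumptionC f₀ m) : m (strip f₀) ≠ 0 := by
  intro h0
  have h1 : ∀ᵐ z ∂m, ∀ n, (P₀ f₀)^[n] z ∉ strip f₀ := ae_all_iff.2 fun n =>
    (hC.ergodic.toMeasurePreserving.iterate n).quasiMeasurePreserving.ae
      (measure_eq_zero_iff_ae_notMem.1 h0)
  have h2 : ∀ᵐ z ∂m, False := by
    filter_upwards [h1, hC.ae_mem, hC.ae_fst_notMem
      (countable_range fun p : ℕ × ℕ => (p.1 : ℝ) + (g₀ f₀)^[p.2] 1)] with z hz hp hZ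
    obtain ⟨n, j, w, hw, e⟩ := hA.exists_eq_iterate_add hp.1 hZ
    apply hz (j + n)
    obtain ⟨x, y⟩ := z
    simp only at e
    have e1 := AssumptionA.P₀_iterate_add (f₀ := f₀) (hA.iterate_g₀_pos (hA.pos_of_mem hw) j) 0 n y
    have e2 := hA.P₀_iterate_eq hw j 0 (y + n)
    rw [zero_add, Nat.cast_zero, add_zero] at e1
    rw [zero_add] at e2
    rw [e, Function.iterate_add_apply, e1, e2]
    exact hw
  have h3 : ae m = ⊥ := by simpa using h2
  exact hC.ne_zero (ae_eq_bot.1 h3)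

lemma ae_strip_mem_Δ (hA : AssumptionA f₀) (hC : AssumptionC f₀ m) :
    ∀ᵐ z ∂m.restrict (strip f₀), z.1 ∈ Δ f₀ := by
  filter_upwards [ae_restrict_mem measurableSet_strip,
    ae_restrict_of_ae (hC.ae_fst_notMem hA.countable_diff_Δ)] with z hz hz'
  by_contra h
  exact hz' ⟨hz, h⟩

lemma ae_strip_mem_Space (hA : AssumptionA f₀) (hC : AssumptionC f₀ m) :
    ∀ᵐ z ∂m.restrict (strip f₀), z ∈ Space f₀ := by
  filter_upwards [ae_restrict_mem measurableSet_strip, ae_restrict_of_ae hC.ae_mem,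
    ae_restrict_of_ae (hC.ae_fst_notMem hA.countable_diff_Δtilde)] with z hz hp hz'
  refine ⟨?_, hp.2⟩
  by_contra h
  exact hz' ⟨hz, h⟩

lemma measurePreserving_Phat (hA : AssumptionA f₀) (hC : AssumptionC f₀ m) :
    MeasurePreserving (Phat f₀) (m.restrict (strip f₀)) (m.restrict (strip f₀)) := by
  -- The first `F`-step takes `τ` steps of `𝒫` and each of the other `κ - 1` takes one, hence the
  -- return time `τ + κ - 1`.
  refine measurePreserving_firstReturn hC.ergodic.toMeasurePreserving hA.measurable_Phat
    measurableSet_strip (hC.measure_strip_ne_top hA) (N := fun z => τ f₀ z.1 + κ f₀ z.1 - 1)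
    (((hA.measurable_τ.comp measurable_fst).add (hA.measurable_κ.comp measurable_fst)).sub_const 1)
    ?_
  filter_upwards [hC.ae_strip_mem_Δ hA] with z hz
  obtain ⟨x, y⟩ := z
  rw [hA.Δ_eq] at hz
  obtain ⟨c, w, hw, rfl⟩ := mem_iUnion.1 hz
  have hN : τ f₀ (phi f₀ c w) + κ f₀ (phi f₀ c w) - 1 = c.1 + c.2 + 2 := by
    rw [hA.tau_phi c hw, hA.kappa_phi c hw]; omega
  simp only [hN]
  obtain ⟨h1, h2⟩ := hA.firstReturn_phi c hw y
  refine ⟨by omega, h1.symm, ?_, h2⟩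
  rw [h1, hA.Phat_phi c hw]
  exact hw

lemma restrict_Δ (hA : AssumptionA f₀) (hC : AssumptionC f₀ m) :
    (m.map Prod.fst).restrict (Δ f₀) = (m.restrict (strip f₀)).map Prod.fst := by
  rw [strip, ← Measure.restrict_map measurable_fst measurableSet_Ioo]
  have h : (Ioo (g₀ f₀ 1) 1 : Set ℝ) =ᵐ[m.map Prod.fst] Δ f₀ :=
    hC.map_fst_absolutelyContinuous.ae_le hA.Ioo_ae_eq_Δ
  exact Measure.restrict_congr_set h.symm

lemma map_fst_Δ (hA : AssumptionA f₀) (hC : AssumptionC f₀ m) :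
    m.map Prod.fst (Δ f₀) = m (strip f₀) := by
  have := congrArg (fun ρ : Measure ℝ => ρ univ) (hC.restrict_Δ hA)
  simpa [Measure.map_apply measurable_fst MeasurableSet.univ] using this

/-- The normalised restriction of `m` to the strip is a lift of `μ̂`. -/
lemma isInvariantLift (hA : AssumptionA f₀) (hC : AssumptionC f₀ m) :
    IsInvariantLift f₀ m ((m (strip f₀))⁻¹ • m.restrict (strip f₀)) where
  isProbability := ⟨by
    simp only [Measure.smul_apply, smul_eq_mul, Measure.restrict_apply_univ]
    exact ENNReal.inv_mul_cancel (hC.measure_strip_ne_zero hA) (hC.measure_strip_ne_top hA)⟩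
  concentrated := by
    have h : m.restrict (strip f₀) (Space f₀)ᶜ = 0 := hC.ae_strip_mem_Space hA
    rw [Measure.smul_apply, smul_eq_mul, h, mul_zero]
  invariant := ((hC.measurePreserving_Phat hA).comp (hC.measurePreserving_Phat hA)).smul_measure _
  projects := by
    rw [Measure.map_smul, muHat, hC.map_fst_Δ hA, hC.restrict_Δ hA]

lemma muHat_absolutelyContinuous (hC : AssumptionC f₀ m) : muHat f₀ m ≪ volume :=
  (Measure.smul_absolutelyContinuous.trans Measure.restrict_le_self.absolutelyContinuous).trans
    hC.map_fst_absolutelyContinuous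

end AssumptionC

/-! ### Projections and integrals of lifts -/

section Lifts

variable {f₀ : ℝ → ℝ} {m : Measure (ℝ × ℝ)} {S : WeightedIFS (ℕ × ℕ) (g₀ f₀ 1) 1} {B : ℝ}
  {h : ℝ → ℝ}

/-- An absolutely continuous projection of an invariant measure is a multiple of the invariant
density. -/
lemma AssumptionA.map_fst_eq (hA : AssumptionA f₀) (hφ : S.φ = phi f₀) (hS : S.IsBranchSystem)
    (hh : S.IsInvariantDensity B h) {ρ : Measure (ℝ × ℝ)} [IsFiniteMeasure ρ]
    (hρ : MeasurePreserving (Ptilde f₀) ρ ρ) (hac : ρ.map Prod.fst ≪ volume)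
    (hsupp : ρ (Space f₀)ᶜ = 0) :
    ρ.map Prod.fst = ρ univ • WeightedIFS.densityMeasure (g₀ f₀ 1) 1 h := by
  have h1 : MeasurePreserving (Fhat f₀)^[2] (ρ.map Prod.fst) (ρ.map Prod.fst) :=
    measurePreserving_map_of_semiconj hρ (hA.measurable_Fhat.iterate 2) measurable_fst
      fun z => AssumptionA.Phat_iterate_fst 2 z
  have h2 : ρ.map Prod.fst (Ioo (g₀ f₀ 1) 1)ᶜ = 0 := by
    rw [Measure.map_apply measurable_fst measurableSet_Ioo.compl]
    refine measure_mono_null (compl_subset_compl.2 fun z hzS => ?_) hsupp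
    exact hA.Δ_subset (hA.Δtilde_subset_Δ hzS.1)
  have h3 := hh.eq_withDensity hS (hA.g₀_lt one_pos) hA.measurable_Fhat
    (fun c x hx => hφ ▸ hA.Fhat_phi c hx) one_le_two hac h2 h1
  rwa [Measure.map_apply measurable_fst .univ] at h3

lemma AssumptionA.muHat_eq (hA : AssumptionA f₀) (hC : AssumptionC f₀ m) (hφ : S.φ = phi f₀)
    (hS : S.IsBranchSystem) (hh : S.IsInvariantDensity B h) :
    muHat f₀ m = WeightedIFS.densityMeasure (g₀ f₀ 1) 1 h := by
  have hL := hC.isInvariantLift hA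
  have := hL.isProbability
  have h1 := hA.map_fst_eq hφ hS hh hL.invariant (hL.projects ▸ hC.muHat_absolutelyContinuous)
    hL.concentrated
  rwa [hL.projects, measure_univ, one_smul] at h1

lemma AssumptionA.orbit_mem_Δ (hA : AssumptionA f₀) {z : ℝ × ℝ}
    (hz : ∀ n, (Ptilde f₀)^[n] z ∈ Space f₀) (i : ℕ) : (Fhat f₀)^[i] z.1 ∈ Δ f₀ := by
  have h2 : ∀ k, (Fhat f₀)^[2 * k] z.1 ∈ Δtilde f₀ := fun k => by
    have := (hz k).1
    rwa [AssumptionA.Ptilde_iterate, AssumptionA.Phat_iterate_fst] at this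
  rcases Nat.even_or_odd' i with ⟨k, rfl | rfl⟩
  · exact hA.Δtilde_subset_Δ (h2 k)
  · rw [Function.iterate_succ_apply']
    exact hA.Fhat_mem_Δ (h2 k)

/-- Two points over the same base point follow the same word of fibre maps, so the height can be
replaced by `1` at a cost uniform in the fibre. -/
lemma AssumptionA.contracting_Phat (hA : AssumptionA f₀) {v : ℝ × ℝ → ℝ}
    (hv : UniformContinuousOn v (Space f₀)) {ε : ℝ} (hε : 0 < ε) :
    ∃ N, ∀ n ≥ N, ∀ z : ℝ × ℝ, (∀ n, (Ptilde f₀)^[n] z ∈ Space f₀) →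
      (Phat f₀)^[2 * n] z ∈ Space f₀ ∧ (Phat f₀)^[2 * n] (z.1, 1) ∈ Space f₀ ∧
      |v ((Phat f₀)^[2 * n] z) - v ((Phat f₀)^[2 * n] (z.1, 1))| ≤ ε := by
  obtain ⟨δ, hδ, hvδ⟩ := Metric.uniformContinuousOn_iff.1 hv ε hε
  obtain ⟨k, hk⟩ := hA.contracting_psi (δ / 2) (half_pos hδ)
  refine ⟨k, fun n hn z hz => ?_⟩
  obtain ⟨l, hl, hlz⟩ := hA.exists_foldr_psi_eq (2 * n) fun i _ => hA.orbit_mem_Δ hz i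
  have m1 := hz n
  rw [AssumptionA.Ptilde_iterate] at m1
  have hz0 : z ∈ Space f₀ := hz 0
  have e1 := hlz ⟨z.2, hz0.2⟩
  have e2 := hlz ⟨1, mem_Ioi.2 one_pos⟩
  simp only [Prod.mk.eta] at e1 e2
  have m2 : (Phat f₀)^[2 * n] (z.1, 1) ∈ Space f₀ := by
    rw [e2]
    refine ⟨?_, Subtype.prop _⟩
    rw [e1] at m1
    exact m1.1
  refine ⟨m1, m2, ?_⟩
  rw [← Real.dist_eq]
  refine (hvδ _ m1 _ m2 ?_).le
  -- The contraction is known for words of length exactly `k`. The outermost `k` letters are split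
  -- off, and the remaining ones only change the starting points.
  rw [e1, e2, dist_prodMk_left, ← Subtype.dist_eq, ← List.take_append_drop k l, List.foldr_append,
    List.foldr_append]
  exact (hk _ (by rw [List.length_take]; omega) _ _).trans_lt (half_lt_self hδ)

lemma IsInvariantLift.ae_mem_Δtilde {ρ : Measure (ℝ × ℝ)} (hρ : IsInvariantLift f₀ m ρ)
    (hA : AssumptionA f₀) : ∀ᵐ x ∂muHat f₀ m, x ∈ Δtilde f₀ := by
  have hmem : ∀ᵐ z ∂ρ, z ∈ Space f₀ := hρ.concentrated
  have h : Prod.fst ⁻¹' Δtilde f₀ ∈ ae ρ := hmem.mono fun z hz => hz.1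
  rw [← hρ.projects]
  exact (mem_ae_map_iff measurable_fst.aemeasurable hA.isOpen_Δtilde.measurableSet).2 h

/-- The integral of an observable against a lift of `μ̂` is the integral of its fibre averages
against the limit laws. -/
lemma AssumptionA.integral_lift_eq (hA : AssumptionA f₀) (hC : AssumptionC f₀ m)
    (hφ : S.φ = phi f₀) (hS : S.IsBranchSystem) (hh : S.IsInvariantDensity B h)
    {η : ℝ → Measure (Ioi (0 : ℝ))} (hη : ∀ (v : Ioi (0 : ℝ) → ℝ) (C : ℝ), UniformContinuous v → (∀ y, |v y| ≤ C) →
      ∀ x ∈ Ioo (g₀ f₀ 1) 1, Tendsto (fun n => ∫ y, v y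
        ∂(S.normalized hh.logLip (hA.g₀_lt one_pos)).fibreLaw hA.psi ⟨1, mem_Ioi.2 one_pos⟩ n x)
        atTop (𝓝 (∫ y, v y ∂η x)))
    {ρ : Measure (ℝ × ℝ)} (hρ : IsInvariantLift f₀ m ρ) {v : ℝ × ℝ → ℝ}
    (hv : UniformContinuousOn v (Space f₀)) {C : ℝ} (hvC : ∀ z ∈ Space f₀, |v z| ≤ C) :
    ∫ z, v z ∂ρ = ∫ x, fibreAverage (fibreMeasures η) v x ∂muHat f₀ m := by
  classical
  have := hρ.isProbability
  have hab := hA.g₀_lt one_pos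
  have hprob := hh.isProbabilityMeasure hab
  have h1 := hh.hasSum_normalized hab
  have hSm := hA.isOpen_Space.measurableSet
  have hmu := hA.muHat_eq hC hφ hS hh
  set d := WeightedIFS.densityMeasure (g₀ f₀ 1) 1 h with hd
  -- `v` is controlled only on `Space f₀`; its truncation is measurable and bounded everywhere and
  -- agrees with it almost everywhere for every lift.
  set W : ℝ × ℝ → ℝ := (Space f₀).piecewise v 0 with hW
  have hWm : Measurable W := hv.continuousOn.measurable_piecewise continuousOn_const hSm
  have hWv : ∀ z ∈ Space f₀, W z = v z := fun z hz => Set.piecewise_eq_of_mem _ _ _ hz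
  have hWC : ∀ z, |W z| ≤ max C 0 := fun z => by
    by_cases hz : z ∈ Space f₀
    · rw [hWv z hz]; exact (hvC z hz).trans (le_max_left _ _)
    · rw [hW, Set.piecewise_eq_of_notMem _ _ _ hz]; simp
  have hmem : ∀ᵐ z ∂ρ, z ∈ Space f₀ := hρ.concentrated
  have horb : ∀ᵐ z ∂ρ, ∀ n, (Ptilde f₀)^[n] z ∈ Space f₀ := ae_all_iff.2 fun n =>
    (hρ.invariant.iterate n).quasiMeasurePreserving.ae hmem
  set y₀ : Ioi (0 : ℝ) := ⟨1, mem_Ioi.2 one_pos⟩ with hy₀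
  set a : ℕ → ℝ := fun n => ∫ x, W ((Phat f₀)^[2 * n] (x, 1)) ∂d with ha
  have hWn : ∀ n, Measurable fun x : ℝ => W ((Phat f₀)^[2 * n] (x, 1)) := fun n =>
    hWm.comp ((hA.measurable_Phat.iterate _).comp (measurable_id.prodMk measurable_const))
  have ha' : ∀ n, a n = ∫ z, W ((Phat f₀)^[2 * n] (z.1, 1)) ∂ρ := fun n => by
    rw [ha]
    simp only
    rw [← hmu, ← hρ.projects, integral_map measurable_fst.aemeasurable
      (hWn n).aestronglyMeasurable]
  have hinv : ∀ n, ∫ z, v z ∂ρ = ∫ z, W ((Phat f₀)^[2 * n] z) ∂ρ := fun n => by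
    have hmp := hρ.invariant.iterate n
    rw [integral_congr_ae (hmem.mono fun z hz => (hWv z hz).symm)]
    conv_lhs => rw [← hmp.map_eq]
    rw [integral_map hmp.measurable.aemeasurable hWm.aestronglyMeasurable,
      AssumptionA.Ptilde_iterate]
  -- By invariance `v` may be evaluated at time `2 * n`, and by contraction over the point of height
  -- `1`; what remains depends on `μ̂` only.
  have lim1 : Tendsto a atTop (𝓝 (∫ z, v z ∂ρ)) := by
    rw [Metric.tendsto_atTop]
    intro ε hε
    obtain ⟨N, hN⟩ := hA.contracting_Phat hv (half_pos hε)
    refine ⟨N, fun n hn => ?_⟩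
    have i1 : Integrable (fun z => W ((Phat f₀)^[2 * n] z)) ρ :=
      WeightedIFS.integrable_of_bdd (hWm.comp (hA.measurable_Phat.iterate _)) fun z => hWC _
    have i2 : Integrable (fun z : ℝ × ℝ => W ((Phat f₀)^[2 * n] (z.1, 1))) ρ :=
      WeightedIFS.integrable_of_bdd ((hWn n).comp measurable_fst) fun z => hWC _
    rw [dist_comm, Real.dist_eq, hinv n, ha' n, ← integral_sub i1 i2]
    have hle : ∀ᵐ z ∂ρ, ‖W ((Phat f₀)^[2 * n] z) - W ((Phat f₀)^[2 * n] (z.1, 1))‖ ≤ ε / 2 := by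
      filter_upwards [horb] with z hz
      obtain ⟨m1, m2, h3⟩ := hN n hn z hz
      rwa [hWv _ m1, hWv _ m2]
    have := norm_integral_le_of_norm_le_const hle
    rw [probReal_univ, mul_one] at this
    exact this.trans_lt (half_lt_self hε)
  -- Duality turns the same sequence into averages over the fibre laws, which converge pointwise and
  -- boundedly.
  have lim2 : Tendsto a atTop (𝓝 (∫ x, fibreAverage (fibreMeasures η) v x ∂d)) := by
    have e : a = fun n => ∫ x, (∫ y, W (x, (y : ℝ))
        ∂(S.normalized hh.logLip hab).fibreLaw hA.psi y₀ (2 * n) x) ∂d := funext fun n =>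
      WeightedIFS.integral_iterate_skew hS hab hh measurable_subtype_coe hA.measurable_psi y₀
        hA.measurable_Phat (fun c x hx y => by rw [hφ, hA.Phat_phi c hx]; rfl) (2 * n) hWm hWC
    rw [e]
    refine tendsto_integral_of_dominated_convergence (fun _ => max C 0) (fun n =>
      WeightedIFS.aestronglyMeasurable_integral_fibreLaw measurable_subtype_coe h1
        hA.measurable_psi y₀ (2 * n) hWm hWC) (integrable_const _) (fun n => ?_) ?_
    · filter_upwards [WeightedIFS.ae_densityMeasure_mem] with x hx
      have := WeightedIFS.isProbabilityMeasure_fibreLaw (y₀ := y₀) h1 hA.measurable_psi (2 * n) hx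
      exact WeightedIFS.abs_integral_le_of_bdd fun y => hWC _
    · have hxt : ∀ᵐ x ∂d, x ∈ Δtilde f₀ := by
        rw [← hmu]
        exact hρ.ae_mem_Δtilde hA
      filter_upwards [hxt] with x hx
      have e1 : ∀ y : Ioi (0 : ℝ), W (x, (y : ℝ)) = v (x, y) := fun y => hWv _ ⟨hx, y.2⟩
      simp only [e1, fibreAverage_fibreMeasures]
      exact (hη _ C (IsC1Family.uniformContinuous_slice hx hv) (fun y => hvC _ ⟨hx, y.2⟩) x
        (hA.Δ_subset (hA.Δtilde_subset_Δ hx))).comp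
          (tendsto_id.const_mul_atTop' two_pos)
  rw [hmu]
  exact tendsto_nhds_unique lim1 lim2

end Lifts

/-! ### Uniqueness, ergodicity and the disintegration. -/

lemma uniformContinuous_compactlySupported {X : Type*} [UniformSpace X]
    (u : CompactlySupportedContinuousMap X ℝ) : UniformContinuous u :=
  u.continuous.uniformContinuous_of_tendsto_cocompact u.hasCompactSupport.is_zero_at_infty

/-- Lifts whose integrals of bounded uniformly continuous observables agree are equal. -/
lemma IsInvariantLift.ext {f₀ : ℝ → ℝ} {m ρ ρ' : Measure (ℝ × ℝ)} (hρ : IsInvariantLift f₀ m ρ)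
    (hρ' : IsInvariantLift f₀ m ρ') (H : ∀ (v : ℝ × ℝ → ℝ) (C : ℝ), UniformContinuous v →
      (∀ z, |v z| ≤ C) → ∫ z, v z ∂ρ = ∫ z, v z ∂ρ') : ρ = ρ' := by
  have := hρ.isProbability
  have := hρ'.isProbability
  refine Measure.ext_of_integral_eq_on_compactlySupported fun u => ?_
  obtain ⟨C, hC⟩ := u.hasCompactSupport.exists_bound_of_continuous u.continuous
  exact H u C (uniformContinuous_compactlySupported u) hC

theorem exists_lift_and_disintegration {f₀ : ℝ → ℝ} {m : Measure (ℝ × ℝ)} (hA : AssumptionA f₀)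
    (hB : AssumptionB f₀) (hC : AssumptionC f₀ m) :
    ∃ ν, IsInvariantLift f₀ m ν ∧ Ergodic (Ptilde f₀) ν ∧
      (∀ ν', IsInvariantLift f₀ m ν' → ν' = ν) ∧ ∃ νx, IsC1Disintegration f₀ m ν νx := by
  obtain ⟨S, hφ, hp, hw⟩ := hA.exists_weightedIFS hB
  have hS := hA.isBranchSystem hφ hp hw
  have hab := hA.g₀_lt one_pos
  obtain ⟨B, h, hh⟩ := WeightedIFS.exists_invariantDensity hS hab
  set N := S.normalized hh.logLip hab with hN
  obtain ⟨η, hηp, hη⟩ := N.exists_limitLaw (hh.hasSum_normalized hab) hA.measurable_psi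
    hA.range_psi_subset hA.contracting_psi ⟨1, mem_Ioi.2 one_pos⟩
  have hfam : IsC1Family (g₀ f₀ 1) 1 N.distortion η :=
    ⟨hηp, fun v C hv hC => (hη v C hv hC).2.1, fun v C hv hC => (hη v C hv hC).2.2⟩
  have hOab : Δtilde f₀ ⊆ Ioo (g₀ f₀ 1) 1 := hA.Δtilde_subset_Δ.trans hA.Δ_subset
  have hint : ∀ ρ, IsInvariantLift f₀ m ρ → ∀ v : ℝ × ℝ → ℝ, UniformContinuousOn v (Space f₀) →
      (∃ C : ℝ, ∀ z ∈ Space f₀, |v z| ≤ C) →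
      ∫ z, v z ∂ρ = ∫ x, fibreAverage (fibreMeasures η) v x ∂muHat f₀ m :=
    fun ρ hρ v hv ⟨C, hvC⟩ => hA.integral_lift_eq hC hφ hS hh
      (fun v C hv hvC => (hη v C hv hvC).1) hρ hv hvC
  have huniq : ∀ ρ ρ', IsInvariantLift f₀ m ρ → IsInvariantLift f₀ m ρ' → ρ = ρ' :=
    fun ρ ρ' hρ hρ' => hρ.ext hρ' fun v C hv hvC =>
      (hint ρ hρ v hv.uniformContinuousOn ⟨C, fun z _ => hvC z⟩).trans
        (hint ρ' hρ' v hv.uniformContinuousOn ⟨C, fun z _ => hvC z⟩).symm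
  have hL := hC.isInvariantLift hA
  have hmu := hA.muHat_eq hC hφ hS hh
  set ν := (m (strip f₀))⁻¹ • m.restrict (strip f₀) with hν
  have := hL.isProbability
  have hmuP : IsProbabilityMeasure (muHat f₀ m) := hmu ▸ hh.isProbabilityMeasure hab
  refine ⟨ν, hL, ⟨hL.invariant, ⟨fun s hs hinv => ?_⟩⟩, fun ν' hν' => huniq _ _ hν' hL,
    fibreMeasures η, ?_⟩
  · rw [eventuallyConst_set']
    by_cases h0 : ν s = 0
    · exact Or.inl (ae_eq_empty.2 h0)
    right
    -- The restriction to an invariant set is again invariant, and its projection is a multiple of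
    -- `muHat`. Once normalised it is a lift, so uniqueness identifies it with `ν` and the
    -- complement of `s` is null.
    have hr : MeasurePreserving (Ptilde f₀) (ν.restrict s) (ν.restrict s) := by
      have := hL.invariant.restrict_preimage hs
      rwa [hinv] at this
    have hsupp : ν.restrict s (Space f₀)ᶜ = 0 :=
      Measure.absolutelyContinuous_of_le Measure.restrict_le_self hL.concentrated
    have hac : (ν.restrict s).map Prod.fst ≪ volume :=
      ((Measure.absolutelyContinuous_of_le Measure.restrict_le_self).map measurable_fst).trans
        (hL.projects ▸ hC.muHat_absolutelyContinuous)
    have hproj := hA.map_fst_eq hφ hS hh hr hac hsupp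
    rw [Measure.restrict_apply_univ, ← hmu] at hproj
    have hLs : IsInvariantLift f₀ m ((ν s)⁻¹ • ν.restrict s) := {
      isProbability := ⟨by
        rw [Measure.smul_apply, Measure.restrict_apply_univ, smul_eq_mul,
          ENNReal.inv_mul_cancel h0 (measure_ne_top _ _)]⟩
      concentrated := by rw [Measure.smul_apply, hsupp, smul_zero]
      invariant := hr.smul_measure _
      projects := by
        rw [Measure.map_smul, hproj, smul_smul, ENNReal.inv_mul_cancel h0 (measure_ne_top _ _),
          one_smul] }
    rw [ae_eq_univ, huniq _ _ hL hLs, Measure.smul_apply, Measure.restrict_apply hs.compl]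
    simp
  · refine ⟨fun x _ => ?_, fun x _ => ?_, fun v hv ⟨C, hvC⟩ => ?_, hint ν hL,
      N.distortion + 1, by have := N.distortion_nonneg; linarith, fun v hv hdv =>
        hfam.isCb1_fibreAverage N.distortion_nonneg hA.isOpen_Δtilde hOab hv hdv⟩
    · have := hηp x
      exact Measure.isProbabilityMeasure_map (measurableEmbedding_fibre x).measurable.aemeasurable
    · rw [fibreMeasures, (measurableEmbedding_fibre x).map_apply]
      convert measure_empty (μ := η x)
      ext y
      simp
    -- Measurability of the average comes from its continuity on the open set `Δtilde f₀`, which has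
    -- full measure.
    · have hmem := hL.ae_mem_Δtilde hA
      have hcont : ContinuousOn (fibreAverage (fibreMeasures η) v) (Δtilde f₀) := by
        rw [funext fun x => fibreAverage_fibreMeasures η v x]
        exact hfam.continuousOn_average hA.isOpen_Δtilde hOab hv hvC
      refine MemLp.of_bound ?_ C ?_
      · rw [← Measure.restrict_eq_self_of_ae_mem hmem]
        exact hcont.aestronglyMeasurable hA.isOpen_Δtilde.measurableSet
      · filter_upwards [hmem] with x hx
        have := hηp x
        rw [fibreAverage_fibreMeasures]
        exact WeightedIFS.abs_integral_le_of_bdd fun y => hvC _ ⟨hx, y.2⟩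

end NonCompactMixing

end

theorem proposition4p7 (f₀ : ℝ → ℝ) (m : MeasureTheory.Measure (ℝ × ℝ))
    (hA : NonCompactMixing.AssumptionA f₀) (hB : NonCompactMixing.AssumptionB f₀)
    (hC : NonCompactMixing.AssumptionC f₀ m) :
    ∃ ν : MeasureTheory.Measure (ℝ × ℝ),
      NonCompactMixing.IsInvariantLift f₀ m ν ∧
      Ergodic (NonCompactMixing.Ptilde f₀) ν ∧
      (∀ ν' : MeasureTheory.Measure (ℝ × ℝ),
        NonCompactMixing.IsInvariantLift f₀ m ν' → ν' = ν) ∧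
      ∃ νx : ℝ → MeasureTheory.Measure (ℝ × ℝ),
        NonCompactMixing.IsC1Disintegration f₀ m ν νx :=
  NonCompactMixing.exists_lift_and_disintegration hA hB hC
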